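/- Fix a field $k$. A linear category is a $k$-linear abelian category; it is finite if its morphism spaces are finite dimensional, every object has finite length, it has enough projectives, and it has finitely many isomorphism classes of simple objects. Let $\mathcal C$ be a finite tensor category, i.e. a finite linear category with a rigid (every object has a left and a right dual) monoidal structure whose tensor product is bilinear. Let $\mathcal M$ be a finite right $\mathcal C$-module category and $\mathcal N$ a finite left $\mathcal C$-module category (finite linear categories with bilinear, coherently associative and unital actions of $\mathcal C$), whose actions $x\otimes(-)\colon\mathcal C\to\mathcal M$ $(x\in\mathcal M)$ and $(-)\otimes y\colon\mathcal C\to\mathcal N$ $(y\in\mathcal N)$ are right exact. A $\mathcal C$-balanced functor $\mathcal M\times\mathcal N\to\mathcal D$ to a linear category $\mathcal D$ is a functor that is $k$-linear and right exact in each variable, with a natural isomorphism $F(x\otimes c,y)\cong F(x,c\otimes y)$ satisfying the pentagon and triangle identities; its morphisms are the natural transformations compatible with these isomorphisms. A balanced tensor product of $\mathcal M$ and $\mathcal N$ is a linear category $\mathcal M\boxtimes_{\mathcal C}\mathcal N$ with a $\mathcal C$-balanced functor $\boxtimes\colon\mathcal M\times\mathcal N\to\mathcal M\boxtimes_{\mathcal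 C}\mathcal N$ such that, for every linear category $\mathcal D$, composition with $\boxtimes$ is an equivalence from the category of right exact linear functors $\mathcal M\boxtimes_{\mathcal C}\mathcal N\to\mathcal D$ to the category of $\mathcal C$-balanced functors $\mathcal M\times\mathcal N\to\mathcal D$. 1. A balanced tensor product $\mathcal M\boxtimes_{\mathcal C}\mathcal N$ exists, and it is a finite linear category. 2. Let $A,B$ be algebra objects of $\mathcal C$, and let $\mathcal M\simeq A\text{-mod}(\mathcal C)$ (left $A$-module objects) and $\mathcal N\simeq \text{mod-}B(\mathcal C)$ (right $B$-module objects) be linear equivalences of $\mathcal C$-module categories. Then there is a linear equivalence from $\mathcal M\boxtimes_{\mathcal C}\mathcal N$ to the category of $A$–$B$-bimodule objects of $\mathcal C$, under which $\boxtimes$ corresponds, as a balanced functor, to $(x,y)\mapsto x\otimes y$ with the balancing given by the associator of $\mathcal C$. 3. The functor $\boxtimes$ is exact in each variable. The enriched homs $\underline{\mathrm{Hom}}_{\mathcal M}$ and $\underline{\mathrm{Hom}}_{\mathcal N}$, defined by natural isomorphisms $\mathrm{Hom}_{\mathcal C}(c,\underline{\mathrm{Hom}}_{\mathcal M}(x,x'))\cong\mathrm{Hom}_{\mathcal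 M}(x\otimes c,x')$ and $\mathrm{Hom}_{\mathcal C}(c,\underline{\mathrm{Hom}}_{\mathcal N}(y,y'))\cong\mathrm{Hom}_{\mathcal N}(c\otimes y,y')$, exist, and there are $k$-linear isomorphisms, natural in $x,x',y,y'$, $$\mathrm{Hom}_{\mathcal M\boxtimes_{\mathcal C}\mathcal N}(x\boxtimes y,\,x'\boxtimes y')\;\cong\;\mathrm{Hom}_{\mathcal C}\bigl(1,\;\underline{\mathrm{Hom}}_{\mathcal M}(x,x')\otimes\underline{\mathrm{Hom}}_{\mathcal N}(y,y')\bigr).$$ 4. Let $\mathcal M'$ and $\mathcal N'$ be finite right and left $\mathcal C$-module categories satisfying the same exactness assumption, and let $F_0\colon\mathcal M\to\mathcal M'$ and $F_1\colon\mathcal N\to\mathcal N'$ be exact (linear, strong) $\mathcal C$-module functors. Then there is a right exact linear functor $\overline F\colon\mathcal M\boxtimes_{\mathcal C}\mathcal N\to\mathcal M'\boxtimes_{\mathcal C}\mathcal N'$ whose composite with $\boxtimes$ is isomorphic, as a balanced functor, to $(x,y)\mapsto F_0(x)\boxtimes F_1(y)$, and every such $\overline F$ is exact. -/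

import Mathlib

open CategoryTheory CategoryTheory.Limits MonoidalCategory Opposite
open scoped MonoidalLeftAction MonoidalRightAction

namespace BalancedTensor

/-! ## Finite linear categories -/

section FiniteLinear

universe u v w

/-- A `k`-linear abelian category is *finite* if its morphism spaces are finite dimensional, every
object has finite length (equivalently, is Artinian and Noetherian), there are enough projectives,
and there are finitely many isomorphism classes of simple objects. -/
class FiniteLinear (k : Type w) [Field k] (X : Type u) [Category.{v} X] [Abelian X] [Linear k X] :
    Prop where
  finite_hom : ∀ x y : X, Module.Finite k (x ⟶ y)
  artinian : ∀ x : X, IsArtinianObject x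
  noetherian : ∀ x : X, IsNoetherianObject x
  enough_projectives : EnoughProjectives X
  finite_simples : ∃ S : Set X, S.Finite ∧ ∀ x : X, Simple x → ∃ s ∈ S, Nonempty (x ≅ s)

end FiniteLinear

section ModuleCategories

universe w u₁ v₁ u₂ v₂

variable (k : Type w) [Field k] (C : Type u₁) [Category.{v₁} C] [MonoidalCategory C]
  [Preadditive C] [Linear k C]

/-- The action of `C` on the right of `M` is additive and `k`-linear in each variable: together
with `MonoidalRightAction C M` this says that `M` is a right `C`-module category. -/
class LinearRightAction (M : Type u₂) [Category.{v₂} M] [Preadditive M] [Linear k M]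
    [MonoidalRightAction C M] : Prop where
  additive_left : ∀ c : C, (MonoidalRightAction.actionRight M c).Additive
  linear_left : ∀ c : C, (MonoidalRightAction.actionRight M c).Linear k
  additive_right : ∀ m : M, (MonoidalRightAction.actionLeft C m).Additive
  linear_right : ∀ m : M, (MonoidalRightAction.actionLeft C m).Linear k

/-- The action of `C` on the left of `N` is additive and `k`-linear in each variable: together
with `MonoidalLeftAction C N` this says that `N` is a left `C`-module category. -/
class LinearLeftAction (N : Type u₂) [Category.{v₂} N] [Preadditive N] [Linear k N]
    [MonoidalLeftAction C N] : Prop where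
  additive_right : ∀ c : C, (MonoidalLeftAction.actionLeft N c).Additive
  linear_right : ∀ c : C, (MonoidalLeftAction.actionLeft N c).Linear k
  additive_left : ∀ n : N, (MonoidalLeftAction.actionRight C n).Additive
  linear_left : ∀ n : N, (MonoidalLeftAction.actionRight C n).Linear k

/-- The right action of `C` on `M` is right exact in the `C`-variable. -/
def RightActionRightExact (M : Type u₂) [Category.{v₂} M] [MonoidalRightAction C M] : Prop :=
  ∀ m : M, PreservesFiniteColimits (MonoidalRightAction.actionLeft C m)

/-- The left action of `C` on `N` is right exact in the `C`-variable. -/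
def LeftActionRightExact (N : Type u₂) [Category.{v₂} N] [MonoidalLeftAction C N] : Prop :=
  ∀ n : N, PreservesFiniteColimits (MonoidalLeftAction.actionRight C n)

end ModuleCategories

/-! ## Balanced functors

A functor `M × N → D` is written in curried form `M ⥤ N ⥤ D`. -/

section Balanced

universe w u₁ v₁ u₂ v₂ u₃ v₃ u₄ v₄ u₅ v₅

/-- A `C`-balancing of a functor of two variables `F`: a natural isomorphism
`F (m ⊙ c, n) ≅ F (m, c ⊙ n)` satisfying the pentagon and triangle identities. -/
structure Balancing (C : Type u₁) [Category.{v₁} C] [MonoidalCategory C]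
    {M : Type u₂} [Category.{v₂} M] [MonoidalRightAction C M]
    {N : Type u₃} [Category.{v₃} N] [MonoidalLeftAction C N]
    {D : Type u₄} [Category.{v₄} D] (F : M ⥤ N ⥤ D) where
  iso (m : M) (c : C) (n : N) : (F.obj (m ⊙ᵣ c)).obj n ≅ (F.obj m).obj (c ⊙ₗ n)
  naturality_left {m m' : M} (f : m ⟶ m') (c : C) (n : N) :
    (F.map (f ⊵ᵣ c)).app n ≫ (iso m' c n).hom = (iso m c n).hom ≫ (F.map f).app (c ⊙ₗ n)
  naturality_middle (m : M) {c c' : C} (g : c ⟶ c') (n : N) :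
    (F.map (m ⊴ᵣ g)).app n ≫ (iso m c' n).hom = (iso m c n).hom ≫ (F.obj m).map (g ⊵ₗ n)
  naturality_right (m : M) (c : C) {n n' : N} (h : n ⟶ n') :
    (F.obj (m ⊙ᵣ c)).map h ≫ (iso m c n').hom = (iso m c n).hom ≫ (F.obj m).map (c ⊴ₗ h)
  pentagon (m : M) (c c' : C) (n : N) :
    (iso m (c ⊗ c') n).hom ≫ (F.obj m).map (αₗ c c' n).hom =
      (F.map (αᵣ m c c').hom).app n ≫ (iso (m ⊙ᵣ c) c' n).hom ≫ (iso m c (c' ⊙ₗ n)).hom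
  triangle (m : M) (n : N) :
    (iso m (𝟙_ C) n).hom ≫ (F.obj m).map (λₗ n).hom = (F.map (ρᵣ m).hom).app n

namespace Balancing

variable {C : Type u₁} [Category.{v₁} C] [MonoidalCategory C]
  {M : Type u₂} [Category.{v₂} M] [MonoidalRightAction C M]
  {N : Type u₃} [Category.{v₃} N] [MonoidalLeftAction C N]
  {D : Type u₄} [Category.{v₄} D]

/-- A natural transformation `η : F ⟶ G` is a balanced transformation if it intertwines the
balancings of `F` and `G`. -/
def Compatible {F G : M ⥤ N ⥤ D} (β : Balancing C F) (γ : Balancing C G) (η : F ⟶ G) : Prop :=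
  ∀ (m : M) (c : C) (n : N),
    (β.iso m c n).hom ≫ (η.app m).app (c ⊙ₗ n) = (η.app (m ⊙ᵣ c)).app n ≫ (γ.iso m c n).hom

/-- The balancing induced on the composite `M × N → D → E`. -/
@[simps]
def postcomp {F : M ⥤ N ⥤ D} (β : Balancing C F) {E : Type u₅} [Category.{v₅} E] (G : D ⥤ E) :
    Balancing C (F ⋙ (Functor.whiskeringRight N D E).obj G) where
  iso m c n := G.mapIso (β.iso m c n)
  naturality_left f c n := by
    simpa using congrArg G.map (β.naturality_left f c n)
  naturality_middle m _ _ g n := by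
    simpa using congrArg G.map (β.naturality_middle m g n)
  naturality_right m c _ _ h := by
    simpa using congrArg G.map (β.naturality_right m c h)
  pentagon m c c' n := by
    simpa using congrArg G.map (β.pentagon m c c' n)
  triangle m n := by
    simpa using congrArg G.map (β.triangle m n)

/-- The balancing induced on the composite `M' × N' → M × N → D` of a balanced functor with a
pair of module functors `P : M' → M` and `Q : N' → N`. It is the composite
`F (P (m ⊙ c), Q n) ≅ F (P m ⊙ c, Q n) ≅ F (P m, c ⊙ Q n) ≅ F (P m, Q (c ⊙ n))`. -/
@[simps]
def precomp {F : M ⥤ N ⥤ D} (β : Balancing C F)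
    {M' : Type*} [Category* M'] [MonoidalRightAction C M']
    {N' : Type*} [Category* N'] [MonoidalLeftAction C N']
    (P : M' ⥤ M) [P.RightLinear C] (Q : N' ⥤ N) [Q.LeftLinear C] :
    Balancing C (P ⋙ F ⋙ (Functor.whiskeringLeft N' N D).obj Q) where
  iso m c n :=
    (F.mapIso (Functor.RightLinear.μᵣIso P m c).symm).app (Q.obj n) ≪≫ β.iso (P.obj m) c (Q.obj n) ≪≫
      (F.obj (P.obj m)).mapIso (Functor.LeftLinear.μₗIso Q c n)
  naturality_left {m m'} f c n := by
    have h := congrArg (fun t => (F.map t).app (Q.obj n))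
      (Functor.OplaxRightLinear.δᵣ_naturality_left P f c)
    have h' := β.naturality_left (P.map f) c (Q.obj n)
    simp only [Functor.map_comp, NatTrans.comp_app] at h
    simp [reassoc_of% h, reassoc_of% h']
  naturality_middle m c c' g n := by
    have h := congrArg (fun t => (F.map t).app (Q.obj n))
      (Functor.OplaxRightLinear.δᵣ_naturality_right P m g)
    have h' := β.naturality_middle (P.obj m) g (Q.obj n)
    have h'' := congrArg (F.obj (P.obj m)).map (Functor.LaxLeftLinear.μₗ_naturality_left Q g n)
    simp only [Functor.map_comp, NatTrans.comp_app] at h h''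
    simp [reassoc_of% h, reassoc_of% h', h'']
  naturality_right m c n n' h := by
    have h' := β.naturality_right (P.obj m) c (Q.map h)
    have h'' := congrArg (F.obj (P.obj m)).map (Functor.LaxLeftLinear.μₗ_naturality_right Q c h)
    simp only [Functor.map_comp] at h''
    simp [reassoc_of% h', h'']
  pentagon m c c' n := by
    have h := congrArg (fun t => (F.map t).app (Q.obj n))
      (Functor.OplaxRightLinear.δᵣ_associativity P m c c')
    have h' := congrArg (F.obj (P.obj m)).map (Functor.LaxLeftLinear.μₗ_associativity Q c c' n)
    have p := β.pentagon (P.obj m) c c' (Q.obj n)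
    have l := β.naturality_left (Functor.OplaxRightLinear.δᵣ P m c) c' (Q.obj n)
    have r := β.naturality_right (P.obj m) c (Functor.LaxLeftLinear.μₗ Q c' n)
    have x := (F.map (Functor.OplaxRightLinear.δᵣ P m c)).naturality
      (Functor.LaxLeftLinear.μₗ Q c' n)
    simp only [Functor.map_comp, NatTrans.comp_app] at h h'
    dsimp
    simp only [Category.assoc]
    rw [h', reassoc_of% p, reassoc_of% h, reassoc_of% l, ← reassoc_of% r, reassoc_of% x]
  triangle m n := by
    have h := congrArg (fun t => (F.map t).app (Q.obj n))
      (Functor.OplaxRightLinear.δᵣ_unitality_hom (C := C) P m)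
    have h' := congrArg (F.obj (P.obj m)).map (Functor.LaxLeftLinear.μₗ_unitality (C := C) Q n)
    have t := β.triangle (P.obj m) (Q.obj n)
    simp only [Functor.map_comp, NatTrans.comp_app] at h h'
    dsimp
    simp only [Category.assoc]
    rw [← h', t, h]

end Balancing

/-- A functor of two variables is *bilinear* if it is (additive and) `k`-linear in each one. -/
structure IsBilinear (k : Type w) [Field k]
    {M : Type u₂} [Category.{v₂} M] [Preadditive M] [Linear k M]
    {N : Type u₃} [Category.{v₃} N] [Preadditive N] [Linear k N]
    {D : Type u₄} [Category.{v₄} D] [Preadditive D] [Linear k D] (F : M ⥤ N ⥤ D) : Prop where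
  additive_left : ∀ n : N, (F.flip.obj n).Additive
  linear_left : ∀ n : N, (F.flip.obj n).Linear k
  additive_right : ∀ m : M, (F.obj m).Additive
  linear_right : ∀ m : M, (F.obj m).Linear k

/-- A functor of two variables is right exact if it is right exact in each variable. -/
structure IsRightExact₂ {M : Type u₂} [Category.{v₂} M] {N : Type u₃} [Category.{v₃} N]
    {D : Type u₄} [Category.{v₄} D] (F : M ⥤ N ⥤ D) : Prop where
  left : ∀ n : N, PreservesFiniteColimits (F.flip.obj n)
  right : ∀ m : M, PreservesFiniteColimits (F.obj m)

/-- A functor of two variables is left exact in each variable. -/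
structure IsLeftExact₂ {M : Type u₂} [Category.{v₂} M] {N : Type u₃} [Category.{v₃} N]
    {D : Type u₄} [Category.{v₄} D] (F : M ⥤ N ⥤ D) : Prop where
  left : ∀ n : N, PreservesFiniteLimits (F.flip.obj n)
  right : ∀ m : M, PreservesFiniteLimits (F.obj m)

/-- A `C`-balanced functor `M × N → D`: a right exact bilinear functor with a balancing. -/
structure BalancedFunctor (k : Type w) [Field k] (C : Type u₁) [Category.{v₁} C]
    [MonoidalCategory C]
    (M : Type u₂) [Category.{v₂} M] [Preadditive M] [Linear k M] [MonoidalRightAction C M]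
    (N : Type u₃) [Category.{v₃} N] [Preadditive N] [Linear k N] [MonoidalLeftAction C N]
    (D : Type u₄) [Category.{v₄} D] [Preadditive D] [Linear k D] where
  functor : M ⥤ N ⥤ D
  bilinear : IsBilinear k functor
  rightExact : IsRightExact₂ functor
  balancing : Balancing C functor

/-- The full subcategory of the category of functors `T ⥤ D` on the right exact `k`-linear
functors. -/
abbrev RightExactLinearFunctor (k : Type w) [Field k]
    (T : Type u₂) [Category.{v₂} T] [Preadditive T] [Linear k T]
    (D : Type u₃) [Category.{v₃} D] [Preadditive D] [Linear k D] :=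
  ObjectProperty.FullSubcategory (C := T ⥤ D)
    (fun G => G.Additive ∧ G.Linear k ∧ PreservesFiniteColimits G)

namespace BalancedFunctor

variable {k : Type w} [Field k] {C : Type u₁} [Category.{v₁} C] [MonoidalCategory C]
  {M : Type u₂} [Category.{v₂} M] [Preadditive M] [Linear k M] [MonoidalRightAction C M]
  {N : Type u₃} [Category.{v₃} N] [Preadditive N] [Linear k N] [MonoidalLeftAction C N]
  {D : Type u₄} [Category.{v₄} D] [Preadditive D] [Linear k D]

/-- A morphism of balanced functors is a balanced transformation. -/
@[ext]
structure Hom (F G : BalancedFunctor k C M N D) where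
  trans : F.functor ⟶ G.functor
  compatible : F.balancing.Compatible G.balancing trans

instance : Category (BalancedFunctor k C M N D) where
  Hom F G := Hom F G
  id F := ⟨𝟙 F.functor, fun m c n => by simp⟩
  comp η θ := ⟨η.trans ≫ θ.trans, fun m c n => by
    have h := η.compatible m c n
    have h' := θ.compatible m c n
    simp only [NatTrans.comp_app, Category.assoc]
    rw [← h', ← Category.assoc, h, Category.assoc]⟩

@[simp]
lemma id_trans (F : BalancedFunctor k C M N D) : Hom.trans (𝟙 F) = 𝟙 F.functor := rfl

@[simp]
lemma comp_trans {F G H : BalancedFunctor k C M N D} (f : F ⟶ G) (g : G ⟶ H) :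
    (f ≫ g).trans = f.trans ≫ g.trans := rfl

@[ext]
lemma hom_ext {F G : BalancedFunctor k C M N D} (f g : F ⟶ G) (h : f.trans = g.trans) : f = g :=
  Hom.ext h

/-- The composite of a balanced functor `M × N → D` with a right exact linear functor `D → E`. -/
@[simps]
def postcomp (F : BalancedFunctor k C M N D)
    {E : Type u₅} [Category.{v₅} E] [Preadditive E] [Linear k E]
    (G : RightExactLinearFunctor k D E) : BalancedFunctor k C M N E where
  functor := F.functor ⋙ (Functor.whiskeringRight N D E).obj G.obj
  bilinear := by
    obtain ⟨G, h₁, h₂, h₃⟩ := G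
    have hF := F.bilinear
    constructor
    · intro n
      have := hF.additive_left n
      exact inferInstanceAs (F.functor.flip.obj n ⋙ G).Additive
    · intro n
      have := hF.linear_left n
      exact inferInstanceAs ((F.functor.flip.obj n ⋙ G).Linear k)
    · intro m
      have := hF.additive_right m
      exact inferInstanceAs (F.functor.obj m ⋙ G).Additive
    · intro m
      have := hF.linear_right m
      exact inferInstanceAs ((F.functor.obj m ⋙ G).Linear k)
  rightExact := by
    obtain ⟨G, h₁, h₂, h₃⟩ := G
    have hF := F.rightExact
    constructor
    · intro n
      have := hF.left n
      exact comp_preservesFiniteColimits (F.functor.flip.obj n) G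
    · intro m
      have := hF.right m
      exact comp_preservesFiniteColimits (F.functor.obj m) G
  balancing := F.balancing.postcomp G.obj

/-- Composition with a balanced functor `B : M × N → T`, as a functor from the category of right
exact linear functors `T → D` to the category of balanced functors `M × N → D`. -/
@[simps]
def restriction {T : Type u₅} [Category.{v₅} T] [Preadditive T] [Linear k T]
    (B : BalancedFunctor k C M N T)
    (D : Type u₄) [Category.{v₄} D] [Preadditive D] [Linear k D] :
    RightExactLinearFunctor k T D ⥤ BalancedFunctor k C M N D where
  obj G := B.postcomp G
  map {G G'} e :=
    { trans := Functor.whiskerLeft B.functor ((Functor.whiskeringRight N T D).map e.hom)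
      compatible := fun m c n => e.hom.naturality _ }

/-- The balanced functor `M × N → M' × N' → D` obtained from a balanced functor `M' × N' → D` and
right exact linear module functors `P : M → M'` and `Q : N → N'`. -/
@[simps]
def precomp
    {M' : Type*} [Category* M'] [Preadditive M'] [Linear k M'] [MonoidalRightAction C M']
    {N' : Type*} [Category* N'] [Preadditive N'] [Linear k N'] [MonoidalLeftAction C N']
    (F : BalancedFunctor k C M' N' D)
    (P : M ⥤ M') [P.Additive] [P.Linear k] [PreservesFiniteColimits P] [P.RightLinear C]
    (Q : N ⥤ N') [Q.Additive] [Q.Linear k] [PreservesFiniteColimits Q] [Q.LeftLinear C] :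
    BalancedFunctor k C M N D where
  functor := P ⋙ F.functor ⋙ (Functor.whiskeringLeft N N' D).obj Q
  bilinear := by
    have hF := F.bilinear
    constructor
    · intro n
      have := hF.additive_left (Q.obj n)
      exact inferInstanceAs (P ⋙ F.functor.flip.obj (Q.obj n)).Additive
    · intro n
      have := hF.linear_left (Q.obj n)
      exact inferInstanceAs ((P ⋙ F.functor.flip.obj (Q.obj n)).Linear k)
    · intro m
      have := hF.additive_right (P.obj m)
      exact inferInstanceAs (Q ⋙ F.functor.obj (P.obj m)).Additive
    · intro m
      have := hF.linear_right (P.obj m)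
      exact inferInstanceAs ((Q ⋙ F.functor.obj (P.obj m)).Linear k)
  rightExact := by
    have hF := F.rightExact
    constructor
    · intro n
      have := hF.left (Q.obj n)
      exact comp_preservesFiniteColimits P (F.functor.flip.obj (Q.obj n))
    · intro m
      have := hF.right (P.obj m)
      exact comp_preservesFiniteColimits Q (F.functor.obj (P.obj m))
  balancing := F.balancing.precomp P Q

end BalancedFunctor

/-- A `C`-balanced functor `B : M × N → T` exhibits the linear category `T` as the *balanced tensor
product* `M ⊠ N` over `C` if, for every linear category `D`, composition with `B` is an equivalence
from the category of right exact linear functors `T → D` to the category of balanced functors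
`M × N → D`. -/
def IsBalancedTensorProduct {k : Type w} [Field k] {C : Type u₁} [Category.{v₁} C]
    [MonoidalCategory C]
    {M : Type u₂} [Category.{v₂} M] [Preadditive M] [Linear k M] [MonoidalRightAction C M]
    {N : Type u₃} [Category.{v₃} N] [Preadditive N] [Linear k N] [MonoidalLeftAction C N]
    {T : Type u₄} [Category.{v₄} T] [Abelian T] [Linear k T]
    (B : BalancedFunctor k C M N T) : Prop :=
  ∀ (D : Type u₄) [Category.{v₄} D] [Abelian D] [Linear k D], (B.restriction D).IsEquivalence

/-- `prodMap F f g : F (x, y) ⟶ F (x', y')` is the action of a functor of two variables on a pair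
of morphisms. -/
def prodMap {M : Type u₂} [Category.{v₂} M] {N : Type u₃} [Category.{v₃} N]
    {D : Type u₄} [Category.{v₄} D] (F : M ⥤ N ⥤ D) {x x' : M} {y y' : N} (f : x ⟶ x')
    (g : y ⟶ y') : (F.obj x).obj y ⟶ (F.obj x').obj y' :=
  (F.map f).app y ≫ (F.obj x').map g

/-- `H` is the enriched hom of the right `C`-module category `M`: there are isomorphisms
`Hom (x ⊙ c, x') ≅ Hom (c, H (x, x'))` natural in `x x' : M` and `c : C`. -/
abbrev RightEnrichedHom (C : Type u₁) [Category.{v₁} C] [MonoidalCategory C]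
    (M : Type u₂) [Category.{v₂} M] [MonoidalRightAction C M] (H : Mᵒᵖ ⥤ M ⥤ C) :=
  (MonoidalRightAction.curriedAction C M).flip ⊣₂ H

/-- `K` is the enriched hom of the left `C`-module category `N`: there are isomorphisms
`Hom (c ⊙ y, y') ≅ Hom (c, K (y, y'))` natural in `y y' : N` and `c : C`. -/
abbrev LeftEnrichedHom (C : Type u₁) [Category.{v₁} C] [MonoidalCategory C]
    (N : Type u₂) [Category.{v₂} N] [MonoidalLeftAction C N] (K : Nᵒᵖ ⥤ N ⥤ C) :=
  (MonoidalLeftAction.curriedAction C N).flip ⊣₂ K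

/-- There are `k`-linear isomorphisms `Hom (F (x, y), F (x', y')) ≅ Hom (𝟙, H (x, x') ⊗ K (y, y'))`
which are natural in all four variables. -/
def HomFormula (k : Type w) [Field k] {C : Type u₁} [Category.{v₁} C] [MonoidalCategory C]
    [Preadditive C] [Linear k C]
    {M : Type u₂} [Category.{v₂} M] {N : Type u₃} [Category.{v₃} N]
    {T : Type u₄} [Category.{v₄} T] [Preadditive T] [Linear k T]
    (F : M ⥤ N ⥤ T) (H : Mᵒᵖ ⥤ M ⥤ C) (K : Nᵒᵖ ⥤ N ⥤ C) : Prop :=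
  ∃ φ : ∀ (x x' : M) (y y' : N), ((F.obj x).obj y ⟶ (F.obj x').obj y') ≃ₗ[k]
      (𝟙_ C ⟶ (H.obj (op x)).obj x' ⊗ (K.obj (op y)).obj y'),
    ∀ (x₁ x₂ x₁' x₂' : M) (y₁ y₂ y₁' y₂' : N) (f : x₂ ⟶ x₁) (f' : x₁' ⟶ x₂')
      (g : y₂ ⟶ y₁) (g' : y₁' ⟶ y₂') (h : (F.obj x₁).obj y₁ ⟶ (F.obj x₁').obj y₁'),
      φ x₂ x₂' y₂ y₂' (prodMap F f g ≫ h ≫ prodMap F f' g') =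
        φ x₁ x₁' y₁ y₁' h ≫ (prodMap H f.op f' ⊗ₘ prodMap K g.op g')

end Balanced

/-! ## Module and bimodule objects -/

section ModuleObjects

open scoped MonObj

universe w u v

variable {C : Type u} [Category.{v} C] [MonoidalCategory C]

section Whiskering

variable [Preadditive C] [MonoidalPreadditive C] {X Y : C} (f g : X ⟶ Y) (Z : C)

lemma neg_whiskerRight : (-f) ▷ Z = -(f ▷ Z) := (tensorRight Z).map_neg
lemma sub_whiskerRight : (f - g) ▷ Z = f ▷ Z - g ▷ Z := (tensorRight Z).map_sub
lemma nsmul_whiskerRight (n : ℕ) : (n • f) ▷ Z = n • (f ▷ Z) := (tensorRight Z).map_nsmul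
lemma zsmul_whiskerRight (n : ℤ) : (n • f) ▷ Z = n • (f ▷ Z) := (tensorRight Z).map_zsmul
lemma whiskerLeft_neg : Z ◁ (-f) = -(Z ◁ f) := (tensorLeft Z).map_neg
lemma whiskerLeft_sub : Z ◁ (f - g) = Z ◁ f - Z ◁ g := (tensorLeft Z).map_sub
lemma whiskerLeft_nsmul (n : ℕ) : Z ◁ (n • f) = n • (Z ◁ f) := (tensorLeft Z).map_nsmul
lemma whiskerLeft_zsmul (n : ℤ) : Z ◁ (n • f) = n • (Z ◁ f) := (tensorLeft Z).map_zsmul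

end Whiskering

/-- A right module object over an algebra (monoid) object `B` of `C`. -/
structure RightMod (B : Mon C) where
  X : C
  act : X ⊗ B.X ⟶ X
  act_one : X ◁ η ≫ act = (ρ_ X).hom
  act_mul : X ◁ μ ≫ act = (α_ X B.X B.X).inv ≫ act ▷ B.X ≫ act

namespace RightMod

variable {B : Mon C}

/-- A morphism of right module objects. -/
@[ext]
structure Hom (N N' : RightMod B) where
  hom : N.X ⟶ N'.X
  act_hom : N.act ≫ hom = hom ▷ B.X ≫ N'.act

instance : Category (RightMod B) where
  Hom N N' := Hom N N'
  id N := ⟨𝟙 N.X, by simp⟩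
  comp f g := ⟨f.hom ≫ g.hom, by
    rw [← Category.assoc, f.act_hom, Category.assoc, g.act_hom, comp_whiskerRight, Category.assoc]⟩

@[ext]
lemma hom_ext {N N' : RightMod B} (f g : N ⟶ N') (h : f.hom = g.hom) : f = g :=
  Hom.ext h

@[simp]
lemma id_hom (N : RightMod B) : Hom.hom (𝟙 N) = 𝟙 N.X := rfl

@[simp]
lemma comp_hom {N N' N'' : RightMod B} (f : N ⟶ N') (g : N' ⟶ N'') :
    (f ≫ g).hom = f.hom ≫ g.hom := rfl

/-- The left action of `C` on the category of right `B`-module objects: `c ⊙ N` is `c ⊗ N` with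
the action of `B` on `N`. -/
instance : MonoidalLeftAction C (RightMod B) where
  actionObj c N :=
    { X := c ⊗ N.X
      act := (α_ c N.X B.X).hom ≫ c ◁ N.act
      act_one := by
        have h := congrArg (fun t => c ◁ t) N.act_one
        simp only [whiskerLeft_comp] at h
        simp [h]
      act_mul := by
        have h := congrArg (fun t => c ◁ t) N.act_mul
        simp only [whiskerLeft_comp] at h
        simp [h] }
  actionHomLeft f N := ⟨f ▷ N.X, by simp [whisker_exchange]⟩
  actionHomRight c _ _ g := ⟨c ◁ g.hom, by simp [← whiskerLeft_comp, g.act_hom]⟩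
  actionAssocIso c c' N :=
    { hom := ⟨(α_ c c' N.X).hom, by simp⟩
      inv := ⟨(α_ c c' N.X).inv, by simp⟩
      hom_inv_id := hom_ext _ _ (α_ c c' N.X).hom_inv_id
      inv_hom_id := hom_ext _ _ (α_ c c' N.X).inv_hom_id }
  actionUnitIso N :=
    { hom := ⟨(λ_ N.X).hom, by simp⟩
      inv := ⟨(λ_ N.X).inv, by simp⟩
      hom_inv_id := hom_ext _ _ (λ_ N.X).hom_inv_id
      inv_hom_id := hom_ext _ _ (λ_ N.X).inv_hom_id }
  actionHom_def _ _ := rfl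
  actionHomRight_id c N := hom_ext _ _ (whiskerLeft_id c N.X)
  id_actionHomLeft c N := hom_ext _ _ (id_whiskerRight c N.X)
  actionHom_comp f₁ f₂ g₁ g₂ := hom_ext _ _ (by
    simp [whisker_exchange_assoc])
  actionAssocIso_hom_naturality f g h := hom_ext _ _ (by
    simp [MonoidalCategory.tensorHom_def])
  actionUnitIso_hom_naturality f := hom_ext _ _ (by simp)
  whiskerLeft_actionHomLeft c _ _ f N := hom_ext _ _ (by simp)
  whiskerRight_actionHomLeft c f N := hom_ext _ _ (by simp)
  associator_actionHom c₁ c₂ c₃ N := hom_ext _ _ (pentagon c₁ c₂ c₃ N.X)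
  leftUnitor_actionHom c N := hom_ext _ _ (by simp)
  rightUnitor_actionHom c N := hom_ext _ _ (by simp)

section

variable [Preadditive C] [MonoidalPreadditive C]

instance : Preadditive (RightMod B) where
  homGroup N N' :=
    letI : Zero (N ⟶ N') := ⟨⟨0, by simp⟩⟩
    letI : Add (N ⟶ N') := ⟨fun f g => ⟨f.hom + g.hom, by simp [f.act_hom, g.act_hom]⟩⟩
    letI : Neg (N ⟶ N') := ⟨fun f => ⟨-f.hom, by simp [neg_whiskerRight, f.act_hom]⟩⟩
    letI : Sub (N ⟶ N') := ⟨fun f g => ⟨f.hom - g.hom, by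
      simp [sub_whiskerRight, f.act_hom, g.act_hom]⟩⟩
    letI : SMul ℕ (N ⟶ N') := ⟨fun n f => ⟨n • f.hom, by
      simp [nsmul_whiskerRight, f.act_hom]⟩⟩
    letI : SMul ℤ (N ⟶ N') := ⟨fun n f => ⟨n • f.hom, by
      simp [zsmul_whiskerRight, f.act_hom]⟩⟩
    Function.Injective.addCommGroup (fun f : N ⟶ N' => f.hom) (fun _ _ => hom_ext _ _)
      rfl (fun _ _ => rfl) (fun _ => rfl) (fun _ _ => rfl) (fun _ _ => rfl) (fun _ _ => rfl)
  add_comp _ _ _ _ _ _ := hom_ext _ _ (Preadditive.add_comp _ _ _ _ _ _)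
  comp_add _ _ _ _ _ _ := hom_ext _ _ (Preadditive.comp_add _ _ _ _ _ _)

instance (k : Type w) [Field k] [Linear k C] [MonoidalLinear k C] : Linear k (RightMod B) where
  homModule N N' :=
    letI : SMul k (N ⟶ N') := ⟨fun r f => ⟨r • f.hom, by simp [f.act_hom]⟩⟩
    Function.Injective.module k
      (AddMonoidHom.mk' (fun f : N ⟶ N' => f.hom) (fun _ _ => rfl)) (fun _ _ => hom_ext _ _)
      (fun _ _ => rfl)
  smul_comp _ _ _ _ _ _ := hom_ext _ _ (Linear.smul_comp _ _ _ _ _ _)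
  comp_smul _ _ _ _ _ _ := hom_ext _ _ (Linear.comp_smul _ _ _ _ _ _)

end

end RightMod

/-! The category of left module objects over `A` is Mathlib's `Mod C A.X`. -/

section LeftMod

variable {A : Mon C}

/-- The structure morphism `A ⊗ M ⟶ M` of a left module object. -/
def leftAct (M : Mod C A.X) : A.X ⊗ M.X ⟶ M.X := ModObj.smul (M := A.X) (X := M.X)

lemma leftAct_one (M : Mod C A.X) : η ▷ M.X ≫ leftAct M = (λ_ M.X).hom :=
  ModObj.one_smul_self A.X M.X

lemma leftAct_mul (M : Mod C A.X) :
    μ ▷ M.X ≫ leftAct M = (α_ A.X A.X M.X).hom ≫ A.X ◁ leftAct M ≫ leftAct M :=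
  ModObj.mul_smul_self A.X M.X

lemma leftAct_hom {M M' : Mod C A.X} (f : M ⟶ M') :
    leftAct M ≫ f.hom = A.X ◁ f.hom ≫ leftAct M' :=
  IsModHom.smul_hom (A := A.X) (f := f.hom)

/-- A morphism of left module objects from a morphism compatible with the structure morphisms. -/
def leftModHom {M M' : Mod C A.X} (f : M.X ⟶ M'.X)
    (h : leftAct M ≫ f = A.X ◁ f ≫ leftAct M') : M ⟶ M' :=
  Mod.Hom.mk' f h

@[simp]
lemma leftModHom_hom {M M' : Mod C A.X} (f : M.X ⟶ M'.X)
    (h : leftAct M ≫ f = A.X ◁ f ≫ leftAct M') : (leftModHom f h).hom = f := rfl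

/-- The left `A`-module object `M ⊗ c` with the action of `A` on `M`. -/
def leftModTensor (M : Mod C A.X) (c : C) : Mod C A.X where
  X := M.X ⊗ c
  mod :=
    { smul := (α_ A.X M.X c).inv ≫ leftAct M ▷ c
      one_smul := by
        have h := congrArg (fun t => t ▷ c) (leftAct_one M)
        simp only [comp_whiskerRight] at h
        simp [h]
      mul_smul := by
        have h := congrArg (fun t => t ▷ c) (leftAct_mul M)
        simp only [comp_whiskerRight] at h
        simp [h] }

lemma leftModTensor_X (M : Mod C A.X) (c : C) : (leftModTensor M c).X = M.X ⊗ c := rfl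

lemma leftModTensor_act (M : Mod C A.X) (c : C) :
    leftAct (leftModTensor M c) = (α_ A.X M.X c).inv ≫ leftAct M ▷ c := rfl

/-- The right action of `C` on the category of left `A`-module objects: `M ⊙ c` is `M ⊗ c` with
the action of `A` on `M`. -/
instance : MonoidalRightAction C (Mod C A.X) where
  actionObj M c := leftModTensor M c
  actionHomRight M _ _ f := leftModHom (M.X ◁ f) (by
    simp [leftModTensor_act, leftModTensor_X, ← whisker_exchange])
  actionHomLeft {M M'} g c := leftModHom (g.hom ▷ c) (by
    have h := congrArg (fun t => t ▷ c) (leftAct_hom g)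
    simp only [comp_whiskerRight] at h
    simp [leftModTensor_act, leftModTensor_X, h])
  actionAssocIso M c c' :=
    { hom := leftModHom (α_ M.X c c').inv (by
        dsimp only [leftModTensor_act, leftModTensor_X]
        simp)
      inv := leftModHom (α_ M.X c c').hom (by
        dsimp only [leftModTensor_act, leftModTensor_X]
        simp)
      hom_inv_id := Mod.hom_ext _ _ (α_ M.X c c').inv_hom_id
      inv_hom_id := Mod.hom_ext _ _ (α_ M.X c c').hom_inv_id }
  actionUnitIso M :=
    { hom := leftModHom (ρ_ M.X).hom (by
        dsimp only [leftModTensor_act, leftModTensor_X]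
        simp)
      inv := leftModHom (ρ_ M.X).inv (by
        dsimp only [leftModTensor_act, leftModTensor_X]
        simp)
      hom_inv_id := Mod.hom_ext _ _ (ρ_ M.X).hom_inv_id
      inv_hom_id := Mod.hom_ext _ _ (ρ_ M.X).inv_hom_id }
  actionHom_def _ _ := rfl
  actionHomRight_id c M := Mod.hom_ext _ _ (whiskerLeft_id M.X c)
  id_actionHomLeft c M := Mod.hom_ext _ _ (id_whiskerRight M.X c)
  actionHom_comp {c c' c'' M M' M''} f₁ f₂ g₁ g₂ := Mod.hom_ext _ _ (by
    change (f₁.hom ≫ f₂.hom) ▷ c ≫ M''.X ◁ (g₁ ≫ g₂) =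
      (f₁.hom ▷ c ≫ M'.X ◁ g₁) ≫ f₂.hom ▷ c' ≫ M''.X ◁ g₂
    simp [whisker_exchange_assoc])
  actionAssocIso_hom_naturality {M M' c₁ c₂ c₃ c₄} f g h := Mod.hom_ext _ _ (by
    change (f.hom ▷ (c₁ ⊗ c₃) ≫ M'.X ◁ (g ⊗ₘ h)) ≫ (α_ M'.X c₂ c₄).inv =
      (α_ M.X c₁ c₃).inv ≫ (f.hom ▷ c₁ ≫ M'.X ◁ g) ▷ c₃ ≫ (M'.X ⊗ c₂) ◁ h
    simp [MonoidalCategory.tensorHom_def])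
  actionUnitIso_hom_naturality f := Mod.hom_ext _ _ (rightUnitor_naturality f.hom).symm
  actionHomRight_whiskerRight {c' c''} f c M := Mod.hom_ext _ _ (by
    change M.X ◁ (f ▷ c) = (α_ M.X c' c).inv ≫ (M.X ◁ f) ▷ c ≫ (α_ M.X c'' c).hom
    simp)
  whiskerRight_actionHomLeft c {c' c''} f M := Mod.hom_ext _ _ (by
    change M.X ◁ (c ◁ f) = (α_ M.X c c').inv ≫ (M.X ⊗ c) ◁ f ≫ (α_ M.X c c'').hom
    simp)
  actionHom_associator c₁ c₂ c₃ M := Mod.hom_ext _ _ (by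
    change M.X ◁ (α_ c₁ c₂ c₃).hom ≫ (α_ M.X c₁ (c₂ ⊗ c₃)).inv ≫ (α_ (M.X ⊗ c₁) c₂ c₃).inv =
      (α_ M.X (c₁ ⊗ c₂) c₃).inv ≫ (α_ M.X c₁ c₂).inv ▷ c₃
    simp)
  actionHom_leftUnitor c M := Mod.hom_ext _ _ (by
    change M.X ◁ (λ_ c).hom = (α_ M.X (𝟙_ C) c).inv ≫ (ρ_ M.X).hom ▷ c
    simp)
  actionHom_rightUnitor c M := Mod.hom_ext _ _ (by
    change M.X ◁ (ρ_ c).hom = (α_ M.X c (𝟙_ C)).inv ≫ (ρ_ (M.X ⊗ c)).hom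
    simp)

section

variable [Preadditive C] [MonoidalPreadditive C]

instance : Preadditive (Mod C A.X) where
  homGroup M M' :=
    letI : Zero (M ⟶ M') := ⟨Mod.Hom.mk' 0 (by simp)⟩
    letI : Add (M ⟶ M') := ⟨fun f g => Mod.Hom.mk' (f.hom + g.hom) (by simp)⟩
    letI : Neg (M ⟶ M') := ⟨fun f => Mod.Hom.mk' (-f.hom) (by simp [whiskerLeft_neg])⟩
    letI : Sub (M ⟶ M') := ⟨fun f g => Mod.Hom.mk' (f.hom - g.hom) (by simp [whiskerLeft_sub])⟩
    letI : SMul ℕ (M ⟶ M') := ⟨fun n f => Mod.Hom.mk' (n • f.hom) (by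
      simp [whiskerLeft_nsmul])⟩
    letI : SMul ℤ (M ⟶ M') := ⟨fun n f => Mod.Hom.mk' (n • f.hom) (by
      simp [whiskerLeft_zsmul])⟩
    Function.Injective.addCommGroup (fun f : M ⟶ M' => f.hom) (fun _ _ => Mod.hom_ext _ _)
      rfl (fun _ _ => rfl) (fun _ => rfl) (fun _ _ => rfl) (fun _ _ => rfl) (fun _ _ => rfl)
  add_comp _ _ _ _ _ _ := Mod.hom_ext _ _ (Preadditive.add_comp _ _ _ _ _ _)
  comp_add _ _ _ _ _ _ := Mod.hom_ext _ _ (Preadditive.comp_add _ _ _ _ _ _)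

instance (k : Type w) [Field k] [Linear k C] [MonoidalLinear k C] : Linear k (Mod C A.X) where
  homModule M M' :=
    letI : SMul k (M ⟶ M') := ⟨fun r f => Mod.Hom.mk' (r • f.hom) (by simp)⟩
    Function.Injective.module k
      (AddMonoidHom.mk' (fun f : M ⟶ M' => f.hom) (fun _ _ => rfl)) (fun _ _ => Mod.hom_ext _ _)
      (fun _ _ => rfl)
  smul_comp _ _ _ _ _ _ := Mod.hom_ext _ _ (Linear.smul_comp _ _ _ _ _ _)
  comp_smul _ _ _ _ _ _ := Mod.hom_ext _ _ (Linear.comp_smul _ _ _ _ _ _)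

end

end LeftMod

/-! The category of `A`-`B`-bimodule objects is Mathlib's `Bimod A B`. -/

section Bimodules

variable {A B : Mon C}

section

variable [Preadditive C] [MonoidalPreadditive C]

instance : Preadditive (Bimod A B) where
  homGroup P Q :=
    letI : Zero (P ⟶ Q) := ⟨⟨0, by simp, by simp⟩⟩
    letI : Add (P ⟶ Q) := ⟨fun f g => ⟨f.hom + g.hom, by simp, by simp⟩⟩
    letI : Neg (P ⟶ Q) := ⟨fun f => ⟨-f.hom, by simp [whiskerLeft_neg],
      by simp [neg_whiskerRight]⟩⟩
    letI : Sub (P ⟶ Q) := ⟨fun f g => ⟨f.hom - g.hom, by simp [whiskerLeft_sub],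
      by simp [sub_whiskerRight]⟩⟩
    letI : SMul ℕ (P ⟶ Q) := ⟨fun n f => ⟨n • f.hom, by simp [whiskerLeft_nsmul],
      by simp [nsmul_whiskerRight]⟩⟩
    letI : SMul ℤ (P ⟶ Q) := ⟨fun n f => ⟨n • f.hom, by simp [whiskerLeft_zsmul],
      by simp [zsmul_whiskerRight]⟩⟩
    Function.Injective.addCommGroup (fun f : P ⟶ Q => f.hom) (fun _ _ => Bimod.hom_ext _ _)
      rfl (fun _ _ => rfl) (fun _ => rfl) (fun _ _ => rfl) (fun _ _ => rfl) (fun _ _ => rfl)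
  add_comp _ _ _ _ _ _ := Bimod.hom_ext _ _ (Preadditive.add_comp _ _ _ _ _ _)
  comp_add _ _ _ _ _ _ := Bimod.hom_ext _ _ (Preadditive.comp_add _ _ _ _ _ _)

instance (k : Type w) [Field k] [Linear k C] [MonoidalLinear k C] : Linear k (Bimod A B) where
  homModule P Q :=
    letI : SMul k (P ⟶ Q) := ⟨fun r f => ⟨r • f.hom, by simp, by simp⟩⟩
    Function.Injective.module k
      (AddMonoidHom.mk' (fun f : P ⟶ Q => f.hom) (fun _ _ => rfl)) (fun _ _ => Bimod.hom_ext _ _)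
      (fun _ _ => rfl)
  smul_comp _ _ _ _ _ _ := Bimod.hom_ext _ _ (Linear.smul_comp _ _ _ _ _ _)
  comp_smul _ _ _ _ _ _ := Bimod.hom_ext _ _ (Linear.comp_smul _ _ _ _ _ _)

end

variable (A B)

/-- The functor sending a left `A`-module object `M` and a right `B`-module object `N` to the
`A`-`B`-bimodule object `M ⊗ N`. -/
@[simps]
def tensorBimod : Mod C A.X ⥤ RightMod B ⥤ Bimod A B where
  obj M :=
    { obj N :=
        { X := M.X ⊗ N.X
          actLeft := (α_ A.X M.X N.X).inv ≫ leftAct M ▷ N.X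
          actRight := (α_ M.X N.X B.X).hom ≫ M.X ◁ N.act
          one_actLeft := by
            have h := congrArg (fun t => t ▷ N.X) (leftAct_one M)
            simp only [comp_whiskerRight] at h
            simp [h]
          left_assoc := by
            have h := congrArg (fun t => t ▷ N.X) (leftAct_mul M)
            simp only [comp_whiskerRight] at h
            simp [h]
          actRight_one := by
            have h := congrArg (fun t => M.X ◁ t) N.act_one
            simp only [whiskerLeft_comp] at h
            simp [h]
          right_assoc := by
            have h := congrArg (fun t => M.X ◁ t) N.act_mul
            simp only [whiskerLeft_comp] at h
            simp [h]
          middle_assoc := by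
            have h := whisker_exchange (leftAct M) N.act
            simp only [tensor_whiskerLeft, Category.assoc, whiskerRight_tensor] at h
            rw [Iso.eq_inv_comp] at h
            simp [← h] }
      map g :=
        { hom := M.X ◁ g.hom
          left_act_hom := by simp [← whisker_exchange]
          right_act_hom := by simp [← whiskerLeft_comp, g.act_hom] }
      map_id N := Bimod.hom_ext _ _ (whiskerLeft_id M.X N.X)
      map_comp f g := Bimod.hom_ext _ _ (whiskerLeft_comp M.X f.hom g.hom) }
  map {M M'} f :=
    { app N :=
        { hom := f.hom ▷ N.X
          left_act_hom := by
            have h := congrArg (fun t => t ▷ N.X) (leftAct_hom f)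
            simp only [comp_whiskerRight] at h
            simp [h]
          right_act_hom := by simp [whisker_exchange] }
      naturality N N' g := Bimod.hom_ext _ _ (whisker_exchange f.hom g.hom) }
  map_id M := by
    ext N
    exact id_whiskerRight M.X N.X
  map_comp f g := by
    ext N
    exact comp_whiskerRight f.hom g.hom N.X

/-- The functor `(M, N) ↦ M ⊗ N` with values in bimodule objects is balanced by the associator
`(M ⊗ c) ⊗ N ≅ M ⊗ (c ⊗ N)` of `C`. -/
@[simps]
def tensorBimodBalancing : Balancing C (tensorBimod A B) where
  iso M c N := Bimod.isoOfIso (P := ((tensorBimod A B).obj (M ⊙ᵣ c)).obj N)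
    (Q := ((tensorBimod A B).obj M).obj (c ⊙ₗ N)) (α_ M.X c N.X)
    (by
      change ((α_ A.X (M.X ⊗ c) N.X).inv ≫ ((α_ A.X M.X c).inv ≫ leftAct M ▷ c) ▷ N.X) ≫
        (α_ M.X c N.X).hom =
          A.X ◁ (α_ M.X c N.X).hom ≫ (α_ A.X M.X (c ⊗ N.X)).inv ≫ leftAct M ▷ (c ⊗ N.X)
      simp)
    (by
      change ((α_ (M.X ⊗ c) N.X B.X).hom ≫ (M.X ⊗ c) ◁ N.act) ≫ (α_ M.X c N.X).hom =
        (α_ M.X c N.X).hom ▷ B.X ≫ (α_ M.X (c ⊗ N.X) B.X).hom ≫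
          M.X ◁ ((α_ c N.X B.X).hom ≫ c ◁ N.act)
      simp)
  naturality_left f c N := Bimod.hom_ext _ _ (associator_naturality_left f.hom c N.X)
  naturality_middle M _ _ g N := Bimod.hom_ext _ _ (associator_naturality_middle M.X g N.X)
  naturality_right M c _ _ h := Bimod.hom_ext _ _ (associator_naturality_right M.X c h.hom)
  pentagon M c c' N := Bimod.hom_ext _ _ (by
    change (α_ M.X (c ⊗ c') N.X).hom ≫ M.X ◁ (α_ c c' N.X).hom =
      (α_ M.X c c').inv ▷ N.X ≫ (α_ (M.X ⊗ c) c' N.X).hom ≫ (α_ M.X c (c' ⊗ N.X)).hom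
    simp)
  triangle M N := Bimod.hom_ext _ _ (MonoidalCategory.triangle M.X N.X)

end Bimodules

end ModuleObjects

end BalancedTensor

open BalancedTensor

universe w t t' u₁ v₁ u₂ v₂ u₃ v₃ u₄ v₄ u₅ v₅

set_option linter.unusedSectionVars false

/-! Everything is computed in one explicit model. By `isLeftAdjoint_of_rightExact`, a right exact
linear functor out of a finite linear category into one with finite dimensional morphism spaces has
a right adjoint, so internal homs exist. For a progenerator `m` of `M`, rigidity of `C` makes the
internal hom functor `R = Hom(m, -) : M ⥤ C` exact, faithful and compatible with the action, and a
monadicity argument (`homMod_isEquivalence`) identifies `M` with the left modules over the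
endomorphism algebra `A` of `m`. The model of the tensor product is `ModIn A.X N`, the `A`-module
objects in `N`, with `(x, n) ↦ x ⊙ n`. No algebra is chosen for `N`.

Universality comes from the bar presentation. A module object `X` of `N` is the cokernel of the
difference of two maps `(A ⊗ A) ⊙ X ⇉ A ⊙ X`, both objects being values of the universal functor. So
a balanced functor `F` can only be extended by `X ↦ coker (F (A ⊗ A, X) ⟶ F (A, X))`. The same
presentation of `x`, moved across the balancing, shows that this does extend `F`
(`BalancedFunctor.induced`, `isEquivalence_restriction_modBalanced`). The model is finite because it
is exact and faithful over `N` and has free objects (`FiniteLinear.of_faithful_of_adjunction`). If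
`N` is the category of right `B`-modules, its `A`-module objects are bimodules (`modInBimod`).
Exactness of `⊠` reduces to exactness of the action of `C` on `N`. In the acting variable this
follows by tensoring with a projective cover of the unit, which splits all short exact sequences
(`preservesFiniteLimits_of_leftActionRightExact`).

The hom formula and the exactness of induced functors use a second family of balanced functors. A
right exact linear `C`-module functor `S : N ⥤ C` gives `(x, n) ↦ x ⊙ S n` with values in `M`, hence
a functor `W : T ⥤ M`. In the model `W` is `S` on underlying objects (`inducedModelIso`), so it
inherits left exactness and faithfulness from `S`.

For `y` projective and `S = Hom(y, -)`, the functor `W` is right adjoint to `- ⊠ y`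
(`homOfAct_bijective`). Therefore `Hom(x ⊠ y, x' ⊠ y') ≅ Hom(x, x' ⊙ Hom(y, y')) ≅ Hom(1, Hom(x, x')
⊗ Hom(y, y'))`. A general `y` has a projective presentation, and both sides turn cokernels in `y`
into kernels (`homOfTensor_bijective_of_isCoker`).

For a progenerator `n` of `N'` and `S = Hom(n, -)`, the functor `W'` is exact and faithful. Its
composite with an induced functor `G` is `F₀` after the functor `W` attached to `F₁ ⋙ S`
(`inducedSquareIso`), so `G` is left exact.

A last point concerns size. `IsBalancedTensorProduct` tests only against categories in the universes
of `T`, so the model is replaced by an equivalent category there (`exists_small_modIn`), and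
universality is then extended to all universes
(`isEquivalence_restriction_of_isBalancedTensorProduct`). -/

namespace BalancedTensor

/-! ### Progenerators and simple objects of finite linear categories -/

section FiniteLinearCategories

universe w' u v u' v'

attribute [local instance] Abelian.hasFiniteBiproducts

/-- A *progenerator* of an abelian category: a projective object `P` such that every object is a
quotient of a finite direct sum of copies of `P`. -/
structure IsProgenerator {X : Type u} [Category.{v} X] [Abelian X] (P : X) : Prop where
  projective : Projective P
  exists_epi : ∀ x : X, ∃ (n : ℕ) (f : (⨁ fun _ : Fin n => P) ⟶ x), Epi f

/-- `x` is a quotient of copies of `P`, and a map out of a direct sum is determined by its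
components. -/
lemma IsProgenerator.hom_ext {X : Type u} [Category.{v} X] [Abelian X] {P : X}
    (hP : IsProgenerator P) {x y : X} {f g : x ⟶ y} (h : ∀ p : P ⟶ x, p ≫ f = p ≫ g) : f = g := by
  obtain ⟨n, q, _⟩ := hP.exists_epi x
  rw [← cancel_epi q]
  refine biproduct.hom_ext' _ _ fun j => ?_
  simpa using h (biproduct.ι (fun _ : Fin n => P) j ≫ q)

/-- The direct sum `P` of projectives covering the finitely many simples has a nonzero map to every
nonzero object, because an Artinian object contains a simple one. Among the maps from powers of `P`
to the Noetherian object `x`, one has maximal image. If its cokernel were nonzero, a nonzero map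
from `P` to the cokernel would lift to `x` and, adjoined as a further summand, enlarge the image. -/
theorem exists_isProgenerator (k : Type w') [Field k] (X : Type u) [Category.{v} X] [Abelian X]
    [Linear k X] [FiniteLinear k X] : ∃ P : X, IsProgenerator P := by
  have := FiniteLinear.enough_projectives k (X := X)
  have ha := FiniteLinear.artinian k (X := X)
  have hn := FiniteLinear.noetherian k (X := X)
  obtain ⟨S, hS, h⟩ := FiniteLinear.finite_simples k (X := X)
  have := hS.to_subtype
  let P : X := ⨁ fun s : S => Projective.over s.1
  have hP : ∀ x : X, ¬ IsZero x → ∃ f : P ⟶ x, f ≠ 0 := by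
    intro x hx
    have := ha x
    obtain ⟨s, hs, ⟨e⟩⟩ := h (simpleSubobject hx) inferInstance
    refine ⟨biproduct.π (fun s : S => Projective.over s.1) ⟨s, hs⟩ ≫ Projective.π s ≫ e.inv ≫
      simpleSubobjectArrow hx, fun h0 => ?_⟩
    have h1 : biproduct.π (fun s : S => Projective.over s.1) ⟨s, hs⟩ ≫ Projective.π s ≫ e.inv ≫
      simpleSubobjectArrow hx = biproduct.π (fun s : S => Projective.over s.1) ⟨s, hs⟩ ≫ 0 := by
      rw [h0, comp_zero]
    rw [cancel_epi] at h1
    have h2 : Projective.π s ≫ e.inv ≫ simpleSubobjectArrow hx =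
      Projective.π s ≫ e.inv ≫ 0 := by rw [h1, comp_zero, comp_zero]
    rw [cancel_epi, cancel_epi] at h2
    have : IsZero (simpleSubobject hx) := by
      rw [IsZero.iff_id_eq_zero, ← cancel_mono (simpleSubobjectArrow hx), h2, comp_zero, comp_zero]
    exact Simple.not_isZero _ this
  have hproj : Projective P := ⟨fun f e _ =>
    ⟨biproduct.desc fun s : S => Projective.factorThru
      (biproduct.ι (fun s : S => Projective.over s.1) s ≫ f) e,
      biproduct.hom_ext' _ _ fun s => by simp⟩⟩
  refine ⟨P, hproj, fun x => ?_⟩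
  have := hn x
  obtain ⟨U, ⟨n, f, rfl⟩, hU⟩ := (wellFounded_gt (α := Subobject x)).has_min
    {U | ∃ (n : ℕ) (f : (⨁ fun _ : Fin n => P) ⟶ x), imageSubobject f = U}
    ⟨_, 0, 0, rfl⟩
  refine ⟨n, f, ?_⟩
  by_contra hf
  have hc : ¬ IsZero (cokernel f) := fun hz =>
    hf (Preadditive.epi_of_cokernel_zero (hz.eq_of_tgt _ _))
  obtain ⟨g, hg⟩ := hP _ hc
  let g' : P ⟶ x := Projective.factorThru g (cokernel.π f)
  have hg' : g' ≫ cokernel.π f = g := Projective.factorThru_comp _ _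
  -- The summand `0` carries the new map; the successors reproduce `f`.
  let f' : (⨁ fun _ : Fin (n + 1) => P) ⟶ x :=
    biproduct.desc (Fin.cases g' fun i => biproduct.ι (fun _ : Fin n => P) i ≫ f)
  have h1 : biproduct.desc (fun i : Fin n => biproduct.ι (fun _ : Fin (n + 1) => P) i.succ) ≫ f'
      = f := by
    refine biproduct.hom_ext' _ _ fun j => ?_
    simp [f']
  have h2 : biproduct.ι (fun _ : Fin (n + 1) => P) 0 ≫ f' = g' := by simp [f']
  have h3 : imageSubobject f ≤ imageSubobject f' := by
    conv_lhs => rw [← h1]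
    exact imageSubobject_comp_le _ _
  have h4 : imageSubobject f' = imageSubobject f := by
    refine (h3.lt_or_eq.resolve_left fun hlt => hU _ ⟨_, f', rfl⟩ hlt).symm
  have h5 : (imageSubobject f).arrow ≫ cokernel.π f = 0 := by
    rw [← cancel_epi (factorThruImageSubobject f)]
    simp
  have h6 : f' ≫ cokernel.π f = 0 := by
    have := imageSubobject_arrow_comp f'
    rw [← this, Category.assoc]
    have h7 : (imageSubobject f').arrow ≫ cokernel.π f = 0 := by rw [h4]; exact h5
    rw [h7, comp_zero]
  apply hg
  rw [← hg', ← h2, Category.assoc, h6, comp_zero]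

/-- An abelian category has finitely many simple objects up to isomorphism if it has an Artinian
object with a nonzero morphism to each of them. -/
theorem exists_finite_simples {X : Type u} [Category.{v} X] [Abelian X] (Q : X)
    [IsArtinianObject Q] (hQ : ∀ s : X, Simple s → ∃ f : Q ⟶ s, f ≠ 0) :
    ∃ S : Set X, S.Finite ∧ ∀ x : X, Simple x → ∃ s ∈ S, Nonempty (x ≅ s) := by
  -- Take `I` minimal among the subobjects such that only finitely many simples receive a nonzero
  -- map from `Q` vanishing on `I`; the top subobject qualifies vacuously. If a nonzero `f : Q ⟶ x`
  -- did not vanish on `I`, then the kernel of `f` on `I` would be strictly smaller and would still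
  -- qualify: a map to a simple `y` that vanishes there but not on `I` factors on `I` through `x`,
  -- and Schur's lemma gives `x ≅ y`. So every such `f` vanishes on `I`.
  obtain ⟨I, ⟨S, hS, hI⟩, hmin⟩ := (wellFounded_lt (α := Subobject Q)).has_min
    {I | ∃ S : Set X, S.Finite ∧ ∀ (x : X) (f : Q ⟶ x), Simple x → f ≠ 0 → I.arrow ≫ f = 0 →
      ∃ s ∈ S, Nonempty (x ≅ s)}
    ⟨⊤, ∅, Set.finite_empty, fun x f _ hf h => by
      exact absurd ((cancel_epi (⊤ : Subobject Q).arrow).1 (h.trans comp_zero.symm)) hf⟩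
  refine ⟨S, hS, fun x hx => ?_⟩
  obtain ⟨f, hf⟩ := hQ x hx
  by_cases h0 : I.arrow ≫ f = 0
  · exact hI x f hx hf h0
  exfalso
  refine hmin (Subobject.mk (kernel.ι (I.arrow ≫ f) ≫ I.arrow)) ⟨insert x S, hS.insert x, ?_⟩ ?_
  · intro y g hy hg hg0
    by_cases h1 : I.arrow ≫ g = 0
    · obtain ⟨s, hs, e⟩ := hI y g hy hg h1
      exact ⟨s, Set.mem_insert_of_mem _ hs, e⟩
    · refine ⟨x, Set.mem_insert _ _, ?_⟩
      have h2 : kernel.ι (I.arrow ≫ f) ≫ I.arrow ≫ g = 0 := by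
        simpa using congrArg
          (fun t => (Subobject.underlyingIso (kernel.ι (I.arrow ≫ f) ≫ I.arrow)).inv ≫ t) hg0
      have := epi_of_nonzero_to_simple h0
      let t : x ⟶ y := Abelian.epiDesc (I.arrow ≫ f) (I.arrow ≫ g) h2
      have ht : (I.arrow ≫ f) ≫ t = I.arrow ≫ g := Abelian.comp_epiDesc _ _ _
      have ht0 : t ≠ 0 := by
        rintro h3
        rw [h3, comp_zero] at ht
        exact h1 ht.symm
      have := isIso_of_hom_simple ht0
      exact ⟨(asIso t).symm⟩
  · refine lt_of_le_of_ne (Subobject.mk_le_of_comm (kernel.ι (I.arrow ≫ f)) rfl) fun h => h0 ?_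
    have h1 : I ≤ Subobject.mk (kernel.ι (I.arrow ≫ f) ≫ I.arrow) := h.ge
    have h2 : (Subobject.ofLEMk _ _ h1 ≫ kernel.ι (I.arrow ≫ f)) ≫ I.arrow = I.arrow := by simp
    have h3 : Subobject.ofLEMk _ _ h1 ≫ kernel.ι (I.arrow ≫ f) = 𝟙 _ := by
      rw [← cancel_mono I.arrow, h2, Category.id_comp]
    rw [← Category.id_comp (I.arrow ≫ f), ← h3, Category.assoc, kernel.condition, comp_zero]

/-! ### Right adjoints of right exact functors -/

section Representability

variable {k : Type w'} [Field k] {X : Type u} [Category.{v} X] [Abelian X] [Linear k X]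
  [FiniteLinear k X] {Y : Type u'} [Category.{v'} Y] [Preadditive Y] [Linear k Y]

/-- A right exact linear functor from a finite linear category to a linear category with finite
dimensional morphism spaces has a right adjoint. -/
theorem isLeftAdjoint_of_rightExact (hY : ∀ x y : Y, Module.Finite k (x ⟶ y))
    (L : X ⥤ Y) [L.Additive] [L.Linear k] [PreservesFiniteColimits L] : L.IsLeftAdjoint := by
  obtain ⟨P, hP⟩ := exists_isProgenerator k X
  have hn := FiniteLinear.noetherian k (X := X)
  -- The value of the right adjoint at `y` is a terminal pair `(c, L c ⟶ y)`. It is built as a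
  -- quotient of `Q = P ^ n`, where `n` maps span `Hom(L P, y)` and together form `x : L Q ⟶ y`; the
  -- subobject divided out is a maximal one on which `x` vanishes.
  rw [isLeftAdjoint_iff_hasTerminal_costructuredArrow]
  intro y
  have := hY (L.obj P) y
  obtain ⟨n, b, hb⟩ := Module.Finite.exists_fin (R := k) (M := L.obj P ⟶ y)
  let Q : X := ⨁ fun _ : Fin n => P
  let x : L.obj Q ⟶ y := ∑ i, L.map (biproduct.π (fun _ : Fin n => P) i) ≫ b i
  have := hn Q
  obtain ⟨K, hK0, hK⟩ := (wellFounded_gt (α := Subobject Q)).has_min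
    {K | L.map K.arrow ≫ x = 0} ⟨⊥, by simp⟩
  -- `x` also vanishes on the sum of `K` and the image of `g`, since `L` preserves epimorphisms.
  -- Maximality puts the image of `g` inside `K`.
  have hle : ∀ (c : X) (g : c ⟶ Q), L.map g ≫ x = 0 → g ≫ cokernel.π K.arrow = 0 := by
    intro c g hg
    let h : ((K : X) ⊞ c) ⟶ Q := biprod.desc K.arrow g
    have h1 : L.map h ≫ x = 0 := by
      have : h = biprod.fst ≫ K.arrow + biprod.snd ≫ g := by ext <;> simp [h]
      rw [this, L.map_add, L.map_comp, L.map_comp, Preadditive.add_comp, Category.assoc,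
        Category.assoc, hK0, hg]
      simp
    have h2 : L.map (imageSubobject h).arrow ≫ x = 0 := by
      rw [← cancel_epi (L.map (factorThruImageSubobject h)), ← Category.assoc, ← L.map_comp,
        imageSubobject_arrow_comp, h1, comp_zero]
    have h3 : K ≤ imageSubobject h := by
      refine Subobject.le_of_comm (biprod.inl ≫ factorThruImageSubobject h) ?_
      simp [h]
    have h4 : imageSubobject h = K :=
      (h3.lt_or_eq.resolve_left fun hlt => hK _ h2 hlt).symm
    have h5 : h ≫ cokernel.π K.arrow = 0 := by
      have h6 : (imageSubobject h).arrow ≫ cokernel.π K.arrow = 0 := by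
        rw [h4]; exact cokernel.condition _
      rw [← imageSubobject_arrow_comp h, Category.assoc, h6, comp_zero]
    have : g = biprod.inr ≫ h := by simp [h]
    rw [this, Category.assoc, h5, comp_zero]
  let I : X := cokernel K.arrow
  -- Right exactness of `L` is used here, to let `x` descend to `L I`.
  have hI : IsColimit (CokernelCofork.map (CokernelCofork.ofπ (cokernel.π K.arrow)
      (cokernel.condition K.arrow)) L) :=
    CokernelCofork.mapIsColimit _ (cokernelIsCokernel K.arrow) L
  obtain ⟨x', hx'⟩ : ∃ x' : L.obj I ⟶ y, L.map (cokernel.π K.arrow) ≫ x' = x :=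
    ⟨hI.desc (CokernelCofork.ofπ x hK0), hI.fac _ WalkingParallelPair.one⟩
  -- Uniqueness for the terminal pair: pull `f` back along the epimorphism `Q ⟶ I`, so that `hle`
  -- applies to the lifted map.
  have huniq : ∀ (c : X) (f : c ⟶ I), L.map f ≫ x' = 0 → f = 0 := by
    intro c f hf
    rw [← cancel_epi (pullback.fst f (cokernel.π K.arrow)), comp_zero, pullback.condition]
    apply hle
    rw [← hx', ← Category.assoc, ← L.map_comp, ← pullback.condition, L.map_comp, Category.assoc, hf,
      comp_zero]
  -- Existence: on a cover of `c` by copies of `P` the map `y₀` is a combination of the spanning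
  -- maps, hence comes from a map to `Q`. By `huniq` the resulting map to `I` kills the kernel of
  -- the cover.
  have hex : ∀ (c : X) (y₀ : L.obj c ⟶ y), ∃ f : c ⟶ I, L.map f ≫ x' = y₀ := by
    intro c y₀
    obtain ⟨r, q, _⟩ := hP.exists_epi c
    have h1 : ∀ z : L.obj P ⟶ y, ∃ g : P ⟶ Q, L.map g ≫ x = z := by
      intro z
      have hz : z ∈ Submodule.span k (Set.range b) := hb ▸ Submodule.mem_top
      rw [Submodule.mem_span_range_iff_exists_fun] at hz
      obtain ⟨a, rfl⟩ := hz
      refine ⟨∑ i, a i • biproduct.ι (fun _ : Fin n => P) i, ?_⟩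
      rw [L.map_sum, Preadditive.sum_comp]
      refine Finset.sum_congr rfl fun i _ => ?_
      rw [L.map_smul, Linear.smul_comp]
      congr 1
      simp only [x, Preadditive.comp_sum, ← Category.assoc, ← L.map_comp]
      rw [Finset.sum_eq_single i]
      · simp
      · intro j _ hj
        rw [biproduct.ι_π_ne _ (Ne.symm hj)]
        simp
      · simp
    choose g hg using h1
    let G : (⨁ fun _ : Fin r => P) ⟶ Q :=
      biproduct.desc fun i => g (L.map (biproduct.ι (fun _ : Fin r => P) i ≫ q) ≫ y₀)
    have hG : L.map G ≫ x = L.map q ≫ y₀ := by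
      have : (𝟙 (⨁ fun _ : Fin r => P)) = _ := biproduct.total.symm
      rw [← Category.id_comp (L.map G), ← Category.id_comp (L.map q), ← L.map_id, this, L.map_sum]
      simp only [Preadditive.sum_comp]
      refine Finset.sum_congr rfl fun i _ => ?_
      simp only [← L.map_comp, Category.assoc]
      have e : biproduct.ι (fun _ : Fin r => P) i ≫ G = _ := biproduct.ι_desc _ _
      rw [L.map_comp, Category.assoc, e, hg, L.map_comp, L.map_comp, L.map_comp, Category.assoc,
        Category.assoc, Category.assoc]
    have h2 : kernel.ι q ≫ G ≫ cokernel.π K.arrow = 0 := by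
      apply huniq
      rw [L.map_comp, L.map_comp, Category.assoc, Category.assoc, hx', hG, ← Category.assoc,
        ← L.map_comp, kernel.condition, L.map_zero, zero_comp]
    refine ⟨Abelian.epiDesc q (G ≫ cokernel.π K.arrow) h2, ?_⟩
    rw [← cancel_epi (L.map q), ← Category.assoc, ← L.map_comp, Abelian.comp_epiDesc, L.map_comp,
      Category.assoc, hx', hG]
  have hT : ∀ A : CostructuredArrow L y, Nonempty (Unique (A ⟶ CostructuredArrow.mk x')) := by
    intro A
    obtain ⟨f, hf⟩ := hex A.left A.hom
    refine ⟨⟨CostructuredArrow.homMk f hf⟩, fun g => ?_⟩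
    refine CostructuredArrow.hom_ext _ _ (sub_eq_zero.1 (huniq _ _ ?_))
    have := CostructuredArrow.w g
    dsimp at this
    rw [L.map_sub, Preadditive.sub_comp, this]
    simp [hf]
  have : ∀ A, Unique (A ⟶ CostructuredArrow.mk x') := fun A => (hT A).some
  exact hasTerminal_of_unique (CostructuredArrow.mk x')

end Representability

/-! ### Transfer of finiteness along exact faithful functors -/

section Transfer

variable {T : Type u} [Category.{v} T] [Abelian T] {N : Type u'} [Category.{v'} N] [Abelian N]
  (Ψ : T ⥤ N) [Ψ.Faithful] [PreservesFiniteLimits Ψ]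

/-- `S ≤ S'` means that the inclusion of `S` dies in the quotient by `S'`, and a faithful functor
detects whether a map is zero. -/
lemma strictMono_map_subobject (x : T) :
    StrictMono (fun S : Subobject x => Subobject.mk (Ψ.map S.arrow)) := by
  refine Monotone.strictMono_of_injective (fun S S' h => ?_) (fun S S' h => ?_)
  · refine Subobject.mk_le_mk_of_comm (Ψ.map (Subobject.ofLE S S' h)) ?_
    rw [← Ψ.map_comp, Subobject.ofLE_arrow]
  · have key : ∀ S S' : Subobject x,
        Subobject.mk (Ψ.map S.arrow) ≤ Subobject.mk (Ψ.map S'.arrow) → S ≤ S' := by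
      intro S S' h
      have h1 : S.arrow ≫ cokernel.π S'.arrow = 0 := by
        apply Ψ.map_injective
        rw [Ψ.map_comp, ← Subobject.ofMkLEMk_comp h, Category.assoc, ← Ψ.map_comp,
          cokernel.condition]
        rw [Ψ.map_zero, comp_zero, Ψ.map_zero]
      exact Subobject.le_of_comm (Abelian.monoLift S'.arrow S.arrow h1)
        (Abelian.monoLift_comp _ _ _)
    exact le_antisymm (key _ _ h.le) (key _ _ h.ge)

lemma isArtinianObject_of_faithful (x : T) (h : IsArtinianObject (Ψ.obj x)) :
    IsArtinianObject x := by
  rw [isArtinianObject_iff_not_strictAnti] at h ⊢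
  exact fun f hf => h _ ((strictMono_map_subobject Ψ x).comp_strictAnti hf)

lemma isNoetherianObject_of_faithful (x : T) (h : IsNoetherianObject (Ψ.obj x)) :
    IsNoetherianObject x := by
  rw [isNoetherianObject_iff_not_strictMono] at h ⊢
  exact fun f hf => h _ ((strictMono_map_subobject Ψ x).comp hf)

/-- An abelian category which is monadic-like over a finite linear category is finite. -/
theorem FiniteLinear.of_faithful_of_adjunction (k : Type w') [Field k] [Linear k T] [Linear k N]
    [FiniteLinear k N] [Ψ.Additive] [Ψ.Linear k] [PreservesFiniteColimits Ψ] {Λ : N ⥤ T}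
    (adj : Λ ⊣ Ψ) : FiniteLinear k T := by
  have := FiniteLinear.enough_projectives k (X := N)
  have ha : ∀ x : T, IsArtinianObject x := fun x =>
    isArtinianObject_of_faithful Ψ x (FiniteLinear.artinian k _)
  have hp : ∀ P : N, Projective P → Projective (Λ.obj P) := fun P h => adj.map_projective P h
  refine ⟨fun x y => ?_, ha, fun x =>
    isNoetherianObject_of_faithful Ψ x (FiniteLinear.noetherian k _), ⟨fun x => ?_⟩, ?_⟩
  · have := FiniteLinear.finite_hom (k := k) (Ψ.obj x) (Ψ.obj y)
    exact Module.Finite.of_injective (Ψ.mapLinearMap k (X := x) (Y := y)) Ψ.map_injective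
  · have := hp (Projective.over (Ψ.obj x)) inferInstance
    have hΛ : Λ.PreservesEpimorphisms := Functor.preservesEpimorphisms_of_adjunction adj
    have he : Epi ((adj.homEquiv _ _).symm (Projective.π (Ψ.obj x))) := by
      rw [Adjunction.homEquiv_counit]
      infer_instance
    exact ⟨⟨Λ.obj (Projective.over (Ψ.obj x)), (adj.homEquiv _ _).symm (Projective.π (Ψ.obj x))⟩⟩
  -- Maps `Λ P ⟶ s` are maps `P ⟶ Ψ s`. If they all vanished, `Ψ` would send the identity of `s` to
  -- zero, against faithfulness. So the Artinian object `Λ P` maps nontrivially to every simple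
  -- object.
  · obtain ⟨P, hP⟩ := exists_isProgenerator k N
    have := ha (Λ.obj P)
    refine exists_finite_simples (Λ.obj P) fun s hs => ?_
    by_contra! h
    refine Simple.not_isZero s ?_
    rw [IsZero.iff_id_eq_zero]
    apply Ψ.map_injective
    refine hP.hom_ext fun p => ?_
    have h1 := (adj.homEquiv _ _).symm_apply_eq.1 (h ((adj.homEquiv _ _).symm p))
    rw [Adjunction.homEquiv_unit, Ψ.map_zero, comp_zero] at h1
    rw [h1, zero_comp, zero_comp]

end Transfer

/-- A finite linear category whose morphism spaces are `w'`-small is essentially `w'`-small. -/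
theorem FiniteLinear.essentiallySmall (k : Type w') [Field k] (X : Type u) [Category.{v} X]
    [Abelian X] [Linear k X] [FiniteLinear k X] [LocallySmall.{v'} X] :
    EssentiallySmall.{v'} X := by
  obtain ⟨P, hP⟩ := exists_isProgenerator k X
  rw [essentiallySmall_iff]
  refine ⟨?_, inferInstance⟩
  -- Every object is the cokernel of a map between finite powers of `P`, and these maps form a small
  -- family.
  let I := Σ n : ℕ × ℕ, ((⨁ fun _ : Fin n.1 => P) ⟶ ⨁ fun _ : Fin n.2 => P)
  let f : I → Skeleton X := fun i => toSkeleton (cokernel i.2)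
  refine small_of_surjective (f := f) fun s => ?_
  obtain ⟨m, q, _⟩ := hP.exists_epi ((fromSkeleton X).obj s)
  obtain ⟨n, p, _⟩ := hP.exists_epi (kernel q)
  refine ⟨⟨(n, m), p ≫ kernel.ι q⟩, ?_⟩
  rw [toSkeleton_eq_iff]
  exact ⟨cokernelEpiComp p (kernel.ι q) ≪≫
    (cokernelIsCokernel (kernel.ι q)).coconePointUniqueUpToIso
    (Abelian.epiIsCokernelOfKernel (KernelFork.ofι (kernel.ι q) (kernel.condition q))
      (kernelIsKernel q))⟩

end FiniteLinearCategories

/-! ### Duality: acting by dual objects gives adjoint functors -/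

section Duality

universe u v x₂ y₂ x₃ y₃

variable {C : Type u} [Category.{v} C] [MonoidalCategory C]

section

variable {N : Type x₂} [Category.{y₂} N] [MonoidalLeftAction C N]
  {M : Type x₃} [Category.{y₃} M] [MonoidalRightAction C M]

/-- This and the following identities solve the coherence axioms of an action for the whiskered
associators and unitors. They are used to carry identities of `C` over to a module category. -/
lemma associator_inv_actionHom (a b c : C) (n : N) : (α_ a b c).inv ⊵ₗ n =
   (αₗ a (b ⊗ c) n).hom ≫ a ⊴ₗ (αₗ b c n).hom ≫ (αₗ a b (c ⊙ₗ n)).inv ≫ (αₗ (a ⊗ b) c n).inv := by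
  rw [← cancel_epi ((α_ a b c).hom ⊵ₗ n)]
  simp

lemma associator_actionHom' (a b c : C) (n : N) : (α_ a b c).hom ⊵ₗ n =
    (αₗ (a ⊗ b) c n).hom ≫ (αₗ a b (c ⊙ₗ n)).hom ≫ a ⊴ₗ (αₗ b c n).inv ≫
      (αₗ a (b ⊗ c) n).inv := by
  rw [← cancel_mono ((αₗ a (b ⊗ c) n).hom ≫ a ⊴ₗ (αₗ b c n).hom)]
  simp

lemma actionHom_associator' (a b c : C) (n : M) : n ⊴ᵣ (α_ a b c).hom =
    (αᵣ n (a ⊗ b) c).hom ≫ (αᵣ n a b).hom ⊵ᵣ c ≫ (αᵣ (n ⊙ᵣ a) b c).inv ≫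
      (αᵣ n a (b ⊗ c)).inv := by
  rw [← cancel_mono ((αᵣ n a (b ⊗ c)).hom ≫ (αᵣ (n ⊙ᵣ a) b c).hom)]
  simp

lemma rightUnitor_inv_actionHom (a : C) (n : N) : (ρ_ a).inv ⊵ₗ n =
   a ⊴ₗ (λₗ n).inv ≫ (αₗ a _ n).inv := by
  rw [← cancel_epi ((ρ_ a).hom ⊵ₗ n), MonoidalLeftAction.hom_inv_actionHomLeft]
  simp

lemma leftUnitor_inv_actionHom (a : C) (n : N) : (λ_ a).inv ⊵ₗ n =
   (λₗ (a ⊙ₗ n)).inv ≫ (αₗ _ _ n).inv := by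
  rw [← cancel_epi ((λ_ a).hom ⊵ₗ n), MonoidalLeftAction.hom_inv_actionHomLeft]
  simp

lemma actionHom_associator_inv (a b c : C) (n : M) : n ⊴ᵣ (α_ a b c).inv =
   (αᵣ n a (b ⊗ c)).hom ≫ (αᵣ (n ⊙ᵣ a) b c).hom ≫ (αᵣ n a b).inv ⊵ᵣ c ≫ (αᵣ n (a ⊗ b) c).inv := by
  rw [← cancel_epi (n ⊴ᵣ (α_ a b c).hom)]
  simp

lemma actionHom_rightUnitor_inv (a : C) (n : M) : n ⊴ᵣ (ρ_ a).inv  =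
   (ρᵣ _).inv ≫ (αᵣ n a _).inv := by
  rw [← cancel_epi (n ⊴ᵣ (ρ_ a).hom), MonoidalRightAction.actionHomRight_hom_inv]
  simp

lemma actionHom_leftUnitor_inv (a : C) (n : M) : n ⊴ᵣ (λ_ a).inv =
   (ρᵣ n).inv ⊵ᵣ a ≫ (αᵣ n _ a).inv := by
  rw [← cancel_epi (n ⊴ᵣ (λ_ a).hom), MonoidalRightAction.actionHomRight_hom_inv]
  simp

end

/-- If `Y` is a right dual of `X`, then acting by `Y` on the left is left adjoint to acting by
`X`. -/
def leftActionAdjunction (N : Type x₂) [Category.{y₂} N] [MonoidalLeftAction C N] (X Y : C)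
    [ExactPairing X Y] :
    MonoidalLeftAction.actionLeft N Y ⊣ MonoidalLeftAction.actionLeft N X where
  unit :=
    { app n := (λₗ n).inv ≫ η_ X Y ⊵ₗ n ≫ (αₗ X Y n).hom
      naturality n n' f := by
        change f ≫ (λₗ n').inv ≫ η_ X Y ⊵ₗ n' ≫ (αₗ X Y n').hom =
          ((λₗ n).inv ≫ η_ X Y ⊵ₗ n ≫ (αₗ X Y n).hom) ≫ X ⊴ₗ Y ⊴ₗ f
        rw [← MonoidalLeftAction.actionUnitIso_inv_naturality_assoc,
          MonoidalLeftAction.action_exchange_assoc]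
        simp }
  counit :=
    { app n := (αₗ Y X n).inv ≫ ε_ X Y ⊵ₗ n ≫ (λₗ n).hom
      naturality n n' f := by
        change Y ⊴ₗ X ⊴ₗ f ≫ (αₗ Y X n').inv ≫ ε_ X Y ⊵ₗ n' ≫ (λₗ n').hom =
          ((αₗ Y X n).inv ≫ ε_ X Y ⊵ₗ n ≫ (λₗ n).hom) ≫ f
        rw [Category.assoc, Category.assoc, MonoidalLeftAction.actionUnitIso_hom_naturality,
          ← MonoidalLeftAction.action_exchange_assoc]
        simp }
  left_triangle_components n := by
    -- The triangle identity is the zigzag identity of the dual pair, acting on `n`.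
    have h : (ρ_ Y).inv ≫ Y ◁ η_ X Y ≫ (α_ Y X Y).inv ≫ ε_ X Y ▷ Y ≫ (λ_ Y).hom = 𝟙 Y := by simp
    have h := congrArg (fun t => t ⊵ₗ n) h
    simp only [MonoidalLeftAction.comp_actionHomLeft, rightUnitor_inv_actionHom, Category.assoc,
      MonoidalLeftAction.whiskerLeft_actionHomLeft, associator_inv_actionHom,
      MonoidalLeftAction.leftUnitor_actionHom, Iso.inv_hom_id_assoc,
      MonoidalLeftAction.id_actionHomLeft] at h
    change Y ⊴ₗ ((λₗ n).inv ≫ η_ X Y ⊵ₗ n ≫ (αₗ X Y n).hom) ≫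
      (αₗ Y X (Y ⊙ₗ n)).inv ≫ ε_ X Y ⊵ₗ (Y ⊙ₗ n) ≫ (λₗ (Y ⊙ₗ n)).hom = 𝟙 _
    simpa using h
  right_triangle_components n := by
    have h : (λ_ X).inv ≫ η_ X Y ▷ X ≫ (α_ X Y X).hom ≫ X ◁ ε_ X Y ≫ (ρ_ X).hom = 𝟙 X := by simp
    have h := congrArg (fun t => t ⊵ₗ n) h
    simp only [MonoidalLeftAction.comp_actionHomLeft, leftUnitor_inv_actionHom, Category.assoc,
      MonoidalLeftAction.whiskerLeft_actionHomLeft, associator_actionHom',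
      MonoidalLeftAction.rightUnitor_actionHom, Iso.inv_hom_id_assoc,
      MonoidalLeftAction.id_actionHomLeft] at h
    change ((λₗ (X ⊙ₗ n)).inv ≫ η_ X Y ⊵ₗ (X ⊙ₗ n) ≫ (αₗ X Y (X ⊙ₗ n)).hom) ≫
      X ⊴ₗ ((αₗ Y X n).inv ≫ ε_ X Y ⊵ₗ n ≫ (λₗ n).hom) = 𝟙 _
    simpa using h

/-- If `Y` is a right dual of `X`, then acting by `X` on the right is left adjoint to acting by
`Y`. -/
def rightActionAdjunction (M : Type x₂) [Category.{y₂} M] [MonoidalRightAction C M] (X Y : C)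
    [ExactPairing X Y] :
    MonoidalRightAction.actionRight M X ⊣ MonoidalRightAction.actionRight M Y where
  unit :=
    { app m := (ρᵣ m).inv ≫ m ⊴ᵣ η_ X Y ≫ (αᵣ m X Y).hom
      naturality n n' f := by
        change f ≫ (ρᵣ n').inv ≫ n' ⊴ᵣ η_ X Y ≫ (αᵣ n' X Y).hom =
          ((ρᵣ n).inv ≫ n ⊴ᵣ η_ X Y ≫ (αᵣ n X Y).hom) ≫ (f ⊵ᵣ X) ⊵ᵣ Y
        rw [← MonoidalRightAction.actionUnitIso_inv_naturality_assoc,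
          ← MonoidalRightAction.action_exchange_assoc]
        simp }
  counit :=
    { app m := (αᵣ m Y X).inv ≫ m ⊴ᵣ ε_ X Y ≫ (ρᵣ m).hom
      naturality n n' f := by
        change (f ⊵ᵣ Y) ⊵ᵣ X ≫ (αᵣ n' Y X).inv ≫ n' ⊴ᵣ ε_ X Y ≫ (ρᵣ n').hom =
          ((αᵣ n Y X).inv ≫ n ⊴ᵣ ε_ X Y ≫ (ρᵣ n).hom) ≫ f
        rw [Category.assoc, Category.assoc, MonoidalRightAction.actionUnitIso_hom_naturality,
          MonoidalRightAction.action_exchange_assoc]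
        simp }
  left_triangle_components m := by
    have h : (λ_ X).inv ≫ η_ X Y ▷ X ≫ (α_ X Y X).hom ≫ X ◁ ε_ X Y ≫ (ρ_ X).hom = 𝟙 X := by simp
    have h := congrArg (fun t => m ⊴ᵣ t) h
    simp only [MonoidalRightAction.actionHomRight_comp, actionHom_leftUnitor_inv, Category.assoc,
      MonoidalRightAction.actionHomRight_whiskerRight, actionHom_associator',
      MonoidalRightAction.actionHom_rightUnitor, Iso.inv_hom_id_assoc,
      MonoidalRightAction.actionHomRight_id] at h
    change ((ρᵣ m).inv ≫ m ⊴ᵣ η_ X Y ≫ (αᵣ m X Y).hom) ⊵ᵣ X ≫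
      (αᵣ (m ⊙ᵣ X) Y X).inv ≫ (m ⊙ᵣ X) ⊴ᵣ ε_ X Y ≫ (ρᵣ (m ⊙ᵣ X)).hom = 𝟙 _
    simpa using h
  right_triangle_components m := by
    have h : (ρ_ Y).inv ≫ Y ◁ η_ X Y ≫ (α_ Y X Y).inv ≫ ε_ X Y ▷ Y ≫ (λ_ Y).hom = 𝟙 Y := by simp
    have h := congrArg (fun t => m ⊴ᵣ t) h
    simp only [MonoidalRightAction.actionHomRight_comp, actionHom_rightUnitor_inv, Category.assoc,
      MonoidalRightAction.actionHomRight_whiskerRight, actionHom_associator_inv,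
      MonoidalRightAction.actionHom_leftUnitor, Iso.inv_hom_id_assoc,
      MonoidalRightAction.actionHomRight_id] at h
    change ((ρᵣ (m ⊙ᵣ Y)).inv ≫ (m ⊙ᵣ Y) ⊴ᵣ η_ X Y ≫ (αᵣ (m ⊙ᵣ Y) X Y).hom) ≫
      ((αᵣ m Y X).inv ≫ m ⊴ᵣ ε_ X Y ≫ (ρᵣ m).hom) ⊵ᵣ Y = 𝟙 _
    simpa using h

end Duality

/-! ### Over a rigid category, lax module functors are strong -/

section Mates

universe x₁ y₁ x₂ y₂

/-- A natural transformation between composites with right adjoints is invertible if it has a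
partner between the composites with the left adjoints which is compatible with unit and counit. -/
lemma isIso_app_of_unit_counit {X : Type x₁} [Category.{y₁} X] {Y : Type x₂} [Category.{y₂} Y]
    (R : X ⥤ Y) {L₁ R₁ : X ⥤ X} (adj₁ : L₁ ⊣ R₁) {L₂ R₂ : Y ⥤ Y} (adj₂ : L₂ ⊣ R₂)
    (l : R ⋙ L₂ ⟶ L₁ ⋙ R) (r : R ⋙ R₂ ⟶ R₁ ⋙ R)
    (hu : ∀ x, adj₂.unit.app (R.obj x) ≫ R₂.map (l.app x) ≫ r.app (L₁.obj x) =
      R.map (adj₁.unit.app x))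
    (hc : ∀ x, L₂.map (r.app x) ≫ l.app (R₁.obj x) ≫ R.map (adj₁.counit.app x) =
      adj₂.counit.app (R.obj x)) (x : X) : IsIso (r.app x) := by
  -- The inverse is the mate of `l`: insert the unit of the second adjunction, apply `l`, remove the
  -- counit of the first.
  refine ⟨adj₂.unit.app _ ≫ R₂.map (l.app (R₁.obj x)) ≫ R₂.map (R.map (adj₁.counit.app x)),
    ?_, ?_⟩
  · have h1 := adj₂.unit.naturality (r.app x)
    dsimp at h1
    rw [reassoc_of% h1, ← R₂.map_comp, ← R₂.map_comp, hc]
    exact adj₂.right_triangle_components _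
  · have h1 := r.naturality (adj₁.counit.app x)
    dsimp at h1
    rw [Category.assoc, Category.assoc, h1, reassoc_of% (hu (R₁.obj x)), ← R.map_comp,
      adj₁.right_triangle_components]
    exact R.map_id _

end Mates

section RightAdjointLinear

universe u v x₁ y₁ x₂ y₂

variable {C : Type u} [Category.{v} C] [MonoidalCategory C]

open Functor

lemma adjunction_hom_ext {X : Type x₁} [Category.{y₁} X] {Y : Type x₂} [Category.{y₂} Y]
    {L : X ⥤ Y} {R : Y ⥤ X} (adj : L ⊣ R) {x : X} {y : Y} {f g : x ⟶ R.obj y}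
    (h : L.map f ≫ adj.counit.app y = L.map g ≫ adj.counit.app y) : f = g := by
  apply (adj.homEquiv _ _).symm.injective
  simpa [Adjunction.homEquiv_counit] using h

lemma adjunction_map_homEquiv_counit {X : Type x₁} [Category.{y₁} X] {Y : Type x₂}
    [Category.{y₂} Y] {L : X ⥤ Y} {R : Y ⥤ X} (adj : L ⊣ R) {x : X} {y : Y} (f : L.obj x ⟶ y) :
    L.map (adj.homEquiv x y f) ≫ adj.counit.app y = f := by
  have := (adj.homEquiv x y).symm_apply_apply f
  rwa [Adjunction.homEquiv_counit] at this

section Left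

variable {X : Type x₁} [Category.{y₁} X] [MonoidalLeftAction C X]
  {Y : Type x₂} [Category.{y₂} Y] [MonoidalLeftAction C Y]

/-- A lax linear functor with invertible structure morphisms is linear. -/
@[reducible]
noncomputable def leftLinearOfIsIso (F : X ⥤ Y) [F.LaxLeftLinear C]
    (h : ∀ (c : C) (x : X), IsIso (LaxLeftLinear.μₗ F c x)) : F.LeftLinear C where
  δₗ c x := inv (LaxLeftLinear.μₗ F c x)
  δₗ_naturality_left f x := by
    rw [IsIso.eq_inv_comp, ← Category.assoc, IsIso.comp_inv_eq, LaxLeftLinear.μₗ_naturality_left]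
  δₗ_naturality_right c _ _ f := by
    rw [IsIso.eq_inv_comp, ← Category.assoc, IsIso.comp_inv_eq, LaxLeftLinear.μₗ_naturality_right]
  δₗ_associativity c c' x := by
    rw [IsIso.inv_comp_eq, LaxLeftLinear.μₗ_associativity_assoc]
    simp
  δₗ_unitality_inv x := by
    rw [← LaxLeftLinear.μₗ_unitality_inv]; simp
  μₗ_comp_δₗ c x := by simp
  δₗ_comp_μₗ c x := by simp

/-- The right adjoint of an oplax linear functor is lax linear. -/
@[reducible]
def rightAdjointLaxLeftLinear {L : X ⥤ Y} {R : Y ⥤ X} (adj : L ⊣ R) [L.OplaxLeftLinear C] :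
    R.LaxLeftLinear C where
  μₗ c y := adj.homEquiv _ _ (OplaxLeftLinear.δₗ L c (R.obj y) ≫ c ⊴ₗ adj.counit.app y)
  μₗ_naturality_left f y := adjunction_hom_ext adj (by
    simp [adjunction_map_homEquiv_counit, reassoc_of% adjunction_map_homEquiv_counit,
      MonoidalLeftAction.action_exchange])
  μₗ_naturality_right c _ _ f := adjunction_hom_ext adj (by
    simp [adjunction_map_homEquiv_counit, reassoc_of% adjunction_map_homEquiv_counit,
      ← MonoidalLeftAction.actionHomRight_comp])
  μₗ_associativity c c' y := adjunction_hom_ext adj (by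
    simp [adjunction_map_homEquiv_counit, reassoc_of% adjunction_map_homEquiv_counit,
      ← MonoidalLeftAction.actionHomRight_comp])
  μₗ_unitality y := adjunction_hom_ext adj (by
    simp [reassoc_of% adjunction_map_homEquiv_counit])

/-- A lax linear functor between module categories over a rigid monoidal category is linear. -/
lemma isIso_μₗ_of_rigid [RightRigidCategory C] (F : X ⥤ Y) [F.LaxLeftLinear C] (c : C) (x : X) :
    IsIso (LaxLeftLinear.μₗ F c x) :=
  -- Acting by `c` is right adjoint to acting by its right dual, and the structure morphism of `F`
  -- at the dual is the required partner.
  isIso_app_of_unit_counit F (leftActionAdjunction X c cᘁ) (leftActionAdjunction Y c cᘁ)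
    { app := fun x => LaxLeftLinear.μₗ F cᘁ x
      naturality := fun _ _ f => LaxLeftLinear.μₗ_naturality_right F cᘁ f }
    { app := fun x => LaxLeftLinear.μₗ F c x
      naturality := fun _ _ f => LaxLeftLinear.μₗ_naturality_right F c f }
    (fun x => by
      change ((λₗ (F.obj x)).inv ≫ η_ c cᘁ ⊵ₗ F.obj x ≫ (αₗ c cᘁ (F.obj x)).hom) ≫
        c ⊴ₗ LaxLeftLinear.μₗ F cᘁ x ≫ LaxLeftLinear.μₗ F c (cᘁ ⊙ₗ x) =
          F.map ((λₗ x).inv ≫ η_ c cᘁ ⊵ₗ x ≫ (αₗ c cᘁ x).hom)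
      rw [Category.assoc, Category.assoc, ← LaxLeftLinear.μₗ_associativity]
      simp [-LaxLeftLinear.μₗ_associativity])
    (fun x => by
      change cᘁ ⊴ₗ LaxLeftLinear.μₗ F c x ≫ LaxLeftLinear.μₗ F cᘁ (c ⊙ₗ x) ≫
        F.map ((αₗ cᘁ c x).inv ≫ ε_ c cᘁ ⊵ₗ x ≫ (λₗ x).hom) =
          (αₗ cᘁ c (F.obj x)).inv ≫ ε_ c cᘁ ⊵ₗ F.obj x ≫ (λₗ (F.obj x)).hom
      simp) x

/-- The right adjoint of a linear functor between module categories over a rigid monoidal category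
is linear. -/
@[reducible]
noncomputable def rightAdjointLeftLinear [RightRigidCategory C] {L : X ⥤ Y} {R : Y ⥤ X}
    (adj : L ⊣ R) [L.OplaxLeftLinear C] : R.LeftLinear C :=
  letI := rightAdjointLaxLeftLinear (C := C) adj
  leftLinearOfIsIso R (isIso_μₗ_of_rigid R)

end Left

section Right

variable {X : Type x₁} [Category.{y₁} X] [MonoidalRightAction C X]
  {Y : Type x₂} [Category.{y₂} Y] [MonoidalRightAction C Y]

/-- A lax linear functor with invertible structure morphisms is linear. -/
@[reducible]
noncomputable def rightLinearOfIsIso (F : X ⥤ Y) [F.LaxRightLinear C]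
    (h : ∀ (x : X) (c : C), IsIso (LaxRightLinear.μᵣ F x c)) : F.RightLinear C where
  δᵣ x c := inv (LaxRightLinear.μᵣ F x c)
  δᵣ_naturality_left f x := by
    rw [IsIso.eq_inv_comp, ← Category.assoc, IsIso.comp_inv_eq, LaxRightLinear.μᵣ_naturality_left]
  δᵣ_naturality_right c _ _ f := by
    rw [IsIso.eq_inv_comp, ← Category.assoc, IsIso.comp_inv_eq,
      LaxRightLinear.μᵣ_naturality_right]
  δᵣ_associativity x c c' := by
    rw [IsIso.inv_comp_eq, LaxRightLinear.μᵣ_associativity_assoc]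
    simp
  δᵣ_unitality_inv x := by
    rw [← LaxRightLinear.μᵣ_unitality_inv]; simp
  μᵣ_comp_δᵣ x c := by simp
  δᵣ_comp_μᵣ x c := by simp

/-- The right adjoint of an oplax linear functor is lax linear. -/
@[reducible]
def rightAdjointLaxRightLinear {L : X ⥤ Y} {R : Y ⥤ X} (adj : L ⊣ R) [L.OplaxRightLinear C] :
    R.LaxRightLinear C where
  μᵣ y c := adj.homEquiv _ _ (OplaxRightLinear.δᵣ L (R.obj y) c ≫ adj.counit.app y ⊵ᵣ c)
  μᵣ_naturality_left f y := adjunction_hom_ext adj (by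
    simp [adjunction_map_homEquiv_counit, reassoc_of% adjunction_map_homEquiv_counit,
      ← MonoidalRightAction.comp_actionHomLeft])
  μᵣ_naturality_right c _ _ f := adjunction_hom_ext adj (by
    simp [adjunction_map_homEquiv_counit, reassoc_of% adjunction_map_homEquiv_counit,
      MonoidalRightAction.action_exchange])
  μᵣ_associativity y c c' := adjunction_hom_ext adj (by
    simp [adjunction_map_homEquiv_counit, reassoc_of% adjunction_map_homEquiv_counit,
      ← MonoidalRightAction.comp_actionHomLeft])
  μᵣ_unitality y := adjunction_hom_ext adj (by
    simp [reassoc_of% adjunction_map_homEquiv_counit])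

/-- A lax linear functor between module categories over a rigid monoidal category is linear. -/
lemma isIso_μᵣ_of_rigid [LeftRigidCategory C] (F : X ⥤ Y) [F.LaxRightLinear C] (x : X) (c : C) :
    IsIso (LaxRightLinear.μᵣ F x c) :=
  -- For right actions it is the left dual that acts as the left adjoint.
  isIso_app_of_unit_counit F (rightActionAdjunction X (ᘁc : C) c)
    (rightActionAdjunction Y (ᘁc : C) c)
    { app := fun x => LaxRightLinear.μᵣ F x (ᘁc : C)
      naturality := fun _ _ f => LaxRightLinear.μᵣ_naturality_left F f (ᘁc : C) }
    { app := fun x => LaxRightLinear.μᵣ F x c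
      naturality := fun _ _ f => LaxRightLinear.μᵣ_naturality_left F f c }
    (fun x => by
      change ((ρᵣ (F.obj x)).inv ≫ F.obj x ⊴ᵣ η_ (ᘁc : C) c ≫ (αᵣ (F.obj x) (ᘁc : C) c).hom) ≫
        LaxRightLinear.μᵣ F x (ᘁc : C) ⊵ᵣ c ≫ LaxRightLinear.μᵣ F (x ⊙ᵣ (ᘁc : C)) c =
          F.map ((ρᵣ x).inv ≫ x ⊴ᵣ η_ (ᘁc : C) c ≫ (αᵣ x (ᘁc : C) c).hom)
      rw [Category.assoc, Category.assoc, ← LaxRightLinear.μᵣ_associativity]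
      simp [-LaxRightLinear.μᵣ_associativity])
    (fun x => by
      change LaxRightLinear.μᵣ F x c ⊵ᵣ (ᘁc : C) ≫ LaxRightLinear.μᵣ F (x ⊙ᵣ c) (ᘁc : C) ≫
        F.map ((αᵣ x c (ᘁc : C)).inv ≫ x ⊴ᵣ ε_ (ᘁc : C) c ≫ (ρᵣ x).hom) =
          (αᵣ (F.obj x) c (ᘁc : C)).inv ≫ F.obj x ⊴ᵣ ε_ (ᘁc : C) c ≫ (ρᵣ (F.obj x)).hom
      simp) x

/-- The right adjoint of a linear functor between module categories over a rigid monoidal category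
is linear. -/
@[reducible]
noncomputable def rightAdjointRightLinear [LeftRigidCategory C] {L : X ⥤ Y} {R : Y ⥤ X}
    (adj : L ⊣ R) [L.OplaxRightLinear C] : R.RightLinear C :=
  letI := rightAdjointLaxRightLinear (C := C) adj
  rightLinearOfIsIso R (isIso_μᵣ_of_rigid R)

end Right

end RightAdjointLinear

/-! ### Exactness of the action in each variable -/

section ExactAction

universe u v x₂ y₂

variable {C : Type u} [Category.{v} C] [MonoidalCategory C]

instance preservesFiniteLimits_actionLeft [RightRigidCategory C] (N : Type x₂) [Category.{y₂} N]
    [MonoidalLeftAction C N] (c : C) :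
    PreservesFiniteLimits (MonoidalLeftAction.actionLeft N c) :=
  have := (leftActionAdjunction N c cᘁ).rightAdjoint_preservesLimits.{0, 0}
  PreservesLimitsOfSize.preservesFiniteLimits _

instance preservesFiniteColimits_actionLeft [LeftRigidCategory C] (N : Type x₂) [Category.{y₂} N]
    [MonoidalLeftAction C N] (c : C) :
    PreservesFiniteColimits (MonoidalLeftAction.actionLeft N c) :=
  have := (leftActionAdjunction N (ᘁc : C) c).leftAdjoint_preservesColimits.{0, 0}
  PreservesColimitsOfSize.preservesFiniteColimits _

instance preservesFiniteLimits_actionRight [LeftRigidCategory C] (M : Type x₂) [Category.{y₂} M]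
    [MonoidalRightAction C M] (c : C) :
    PreservesFiniteLimits (MonoidalRightAction.actionRight M c) :=
  have := (rightActionAdjunction M (ᘁc : C) c).rightAdjoint_preservesLimits.{0, 0}
  PreservesLimitsOfSize.preservesFiniteLimits _

instance preservesFiniteColimits_actionRight [RightRigidCategory C] (M : Type x₂) [Category.{y₂} M]
    [MonoidalRightAction C M] (c : C) :
    PreservesFiniteColimits (MonoidalRightAction.actionRight M c) :=
  have := (rightActionAdjunction M c cᘁ).leftAdjoint_preservesColimits.{0, 0}
  PreservesColimitsOfSize.preservesFiniteColimits _

/-- The right adjoint, acting by the right dual, preserves epimorphisms. -/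
lemma projective_actionRight [RigidCategory C] {M : Type x₂} [Category.{y₂} M] [Abelian M]
    [MonoidalRightAction C M] {m : M} (hm : Projective m) (c : C) : Projective (m ⊙ᵣ c) :=
  (rightActionAdjunction M c cᘁ).map_projective m hm

/-- The action of a rigid abelian monoidal category with enough projectives is exact in the acting
variable as soon as it is right exact. -/
theorem preservesFiniteLimits_of_leftActionRightExact [Abelian C] [MonoidalPreadditive C]
    [RigidCategory C] [EnoughProjectives C] (N : Type x₂) [Category.{y₂} N] [Abelian N]
    [MonoidalLeftAction C N] (hN : LeftActionRightExact C N)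
    [∀ n : N, (MonoidalLeftAction.actionRight C n).Additive]
    [∀ c : C, (MonoidalLeftAction.actionLeft N c).Additive] (n : N) :
    PreservesFiniteLimits (MonoidalLeftAction.actionRight C n) := by
  have := hN n
  -- Only monomorphisms are at issue. Let `P` be a projective cover of the unit, minimality not
  -- being needed. Then `P ⊗ coker f` is projective, so `P ⊗ f` splits, and up to associativity so
  -- does `P ⊙ (f ⊙ n)`. Hence a map `g : z ⟶ c ⊙ n` killed by `f ⊙ n` satisfies `P ⊙ g = 0`, and
  -- the epimorphism `P ⊙ z ⟶ 1 ⊙ z` then forces `g = 0`.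
  have hmono : ∀ {c c' : C} (f : c ⟶ c') [Mono f], Mono (f ⊵ₗ n) := by
    intro c c' f _
    obtain ⟨P, hP, i, hi⟩ : ∃ P : C, Projective P ∧ ∃ i : P ⟶ 𝟙_ C, Epi i :=
      ⟨Projective.over _, inferInstance, Projective.π _, inferInstance⟩
    have hS : (ShortComplex.mk f (cokernel.π f) (cokernel.condition f)).ShortExact :=
      { exact := ShortComplex.exact_cokernel f }
    have : (MonoidalLeftAction.actionLeft C P).Additive :=
      inferInstanceAs (tensorLeft P).Additive
    have hS' := hS.map_of_exact (MonoidalLeftAction.actionLeft C P)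
    have hp : Projective (P ⊙ᵣ cokernel f) := projective_actionRight hP _
    obtain ⟨r, hr⟩ : ∃ r : P ⊗ c' ⟶ P ⊗ c, P ◁ f ≫ r = 𝟙 _ :=
      let σ := @ShortComplex.ShortExact.splittingOfProjective _ _ _ _ hS' hp inferInstance
      ⟨σ.r, σ.f_r⟩
    have : Mono ((P ◁ f) ⊵ₗ n) := by
      have h : (P ◁ f) ⊵ₗ n ≫ r ⊵ₗ n = 𝟙 _ := by
        rw [← MonoidalLeftAction.comp_actionHomLeft, hr, MonoidalLeftAction.id_actionHomLeft]
      exact (SplitMono.mk _ h).mono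
    have : Mono (P ⊴ₗ f ⊵ₗ n) := by
      have h : P ⊴ₗ f ⊵ₗ n = (αₗ P c n).inv ≫ (P ◁ f) ⊵ₗ n ≫ (αₗ P c' n).hom := by simp
      rw [h]
      infer_instance
    refine Preadditive.mono_of_cancel_zero _ fun {z} g hg => ?_
    have h0 : P ⊴ₗ g = 0 := by
      rw [← cancel_mono (P ⊴ₗ f ⊵ₗ n), ← MonoidalLeftAction.actionHomRight_comp, hg, zero_comp]
      exact (MonoidalLeftAction.actionLeft N P).map_zero _ _
    have : Epi (i ⊵ₗ z) := by
      have := hN z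
      exact inferInstanceAs (Epi ((MonoidalLeftAction.actionRight C z).map i))
    have h1 := MonoidalLeftAction.action_exchange i g
    rw [h0, zero_comp] at h1
    have h2 : 𝟙_ C ⊴ₗ g = 0 := by rw [← cancel_epi (i ⊵ₗ z), ← h1, comp_zero]
    have h3 := MonoidalLeftAction.actionUnitIso_hom_naturality (C := C) g
    rw [h2, zero_comp] at h3
    rw [← cancel_epi (λₗ[C] z).hom, h3, comp_zero]
  refine ((Functor.preservesFiniteLimits_tfae (MonoidalLeftAction.actionRight C n)).out 0 3).1 ?_
  intro S hS
  have h0 := (Functor.preservesFiniteColimits_tfae (MonoidalLeftAction.actionRight C n)).out 3 0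
  have h1 := h0.1 (hN n) S hS
  have := hS.mono_f
  exact ⟨h1.1, hmono S.f⟩

end ExactAction

/-! ### Module objects in a module category, as algebras over a monad -/

section InternalModules

universe w' u v x₂ y₂

section Action

variable {C : Type u} [Category.{v} C] [MonoidalCategory C] [RightRigidCategory C]
  {N : Type x₂} [Category.{y₂} N] [Abelian N] [MonoidalLeftAction C N] (c : C)

/-- Acting by `c` is a right adjoint and so preserves products; no linearity hypothesis on the
action is involved. -/
instance additive_actionLeft : (MonoidalLeftAction.actionLeft N c).Additive :=
  Functor.additive_of_preserves_binary_products _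

variable {x y : N} (f g : x ⟶ y)

@[simp]
lemma actionHomRight_zero : c ⊴ₗ (0 : x ⟶ y) = 0 :=
  (MonoidalLeftAction.actionLeft N c).map_zero x y

@[simp]
lemma actionHomRight_add : c ⊴ₗ (f + g) = c ⊴ₗ f + c ⊴ₗ g :=
  (MonoidalLeftAction.actionLeft N c).map_add

@[simp]
lemma actionHomRight_neg : c ⊴ₗ (-f) = -(c ⊴ₗ f) :=
  (MonoidalLeftAction.actionLeft N c).map_neg

@[simp]
lemma actionHomRight_sub : c ⊴ₗ (f - g) = c ⊴ₗ f - c ⊴ₗ g :=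
  (MonoidalLeftAction.actionLeft N c).map_sub

@[simp]
lemma actionHomRight_nsmul (n : ℕ) : c ⊴ₗ (n • f) = n • (c ⊴ₗ f) :=
  (MonoidalLeftAction.actionLeft N c).map_nsmul

@[simp]
lemma actionHomRight_zsmul (n : ℤ) : c ⊴ₗ (n • f) = n • (c ⊴ₗ f) :=
  (MonoidalLeftAction.actionLeft N c).map_zsmul

omit [RightRigidCategory C] in
lemma actionHomRight_smul (k : Type w') [Field k] [Preadditive C] [Linear k C] [Linear k N]
    [h : LinearLeftAction k C N] (r : k) : c ⊴ₗ (r • f) = r • (c ⊴ₗ f) :=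
  have := h.linear_right c
  (MonoidalLeftAction.actionLeft N c).map_smul _ _

end Action

variable {C : Type u} [Category.{v} C] [MonoidalCategory C]

/-- A module object over an algebra object `A` of `C` in a left `C`-module category. -/
structure ModIn (A : C) [MonObj A] (N : Type x₂) [Category.{y₂} N] [MonoidalLeftAction C N] where
  X : N
  act : A ⊙ₗ X ⟶ X
  one_act : (MonObj.one (X := A)) ⊵ₗ X ≫ act = (λₗ X).hom
  mul_act : (MonObj.mul (X := A)) ⊵ₗ X ≫ act = (αₗ A A X).hom ≫ A ⊴ₗ act ≫ act

namespace ModIn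

variable {A : C} [MonObj A] {N : Type x₂} [Category.{y₂} N] [MonoidalLeftAction C N]

attribute [simp] one_act mul_act

/-- A morphism of module objects. -/
@[ext]
structure Hom (X Y : ModIn A N) where
  hom : X.X ⟶ Y.X
  act_hom : X.act ≫ hom = A ⊴ₗ hom ≫ Y.act

instance : Category (ModIn A N) where
  Hom X Y := Hom X Y
  id X := ⟨𝟙 X.X, by simp⟩
  comp f g := ⟨f.hom ≫ g.hom, by
    rw [← Category.assoc, f.act_hom, Category.assoc, g.act_hom]; simp⟩

@[ext]
lemma hom_ext {X Y : ModIn A N} (f g : X ⟶ Y) (h : f.hom = g.hom) : f = g :=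
  Hom.ext h

@[simp]
lemma id_hom (X : ModIn A N) : Hom.hom (𝟙 X) = 𝟙 X.X := rfl

@[simp]
lemma comp_hom {X Y Z : ModIn A N} (f : X ⟶ Y) (g : Y ⟶ Z) :
    (f ≫ g).hom = f.hom ≫ g.hom := rfl

/-- An isomorphism of module objects from an isomorphism of the underlying objects. -/
@[simps]
def isoMk {X Y : ModIn A N} (e : X.X ≅ Y.X) (h : X.act ≫ e.hom = A ⊴ₗ e.hom ≫ Y.act) : X ≅ Y where
  hom := ⟨e.hom, h⟩
  inv := ⟨e.inv, by rw [← cancel_mono e.hom, Category.assoc, Category.assoc, h]; simp⟩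
  hom_inv_id := hom_ext _ _ e.hom_inv_id
  inv_hom_id := hom_ext _ _ e.inv_hom_id

variable (A N)

/-- The forgetful functor. -/
@[simps]
def forget : ModIn A N ⥤ N where
  obj X := X.X
  map f := f.hom

instance : (forget A N).Faithful where
  map_injective h := hom_ext _ _ h

instance : (forget A N).ReflectsIsomorphisms where
  reflects {X Y} f h := by
    have : IsIso f.hom := h
    exact (isoMk (asIso f.hom) f.act_hom).isIso_hom

/-- The monad on `N` given by the action of an algebra object. -/
def actionMonad : Monad N where
  toFunctor := MonoidalLeftAction.actionLeft N A
  η :=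
    { app X := (λₗ X).inv ≫ (MonObj.one (X := A)) ⊵ₗ X
      naturality X Y f := by
        change f ≫ (λₗ Y).inv ≫ (MonObj.one (X := A)) ⊵ₗ Y =
          ((λₗ X).inv ≫ (MonObj.one (X := A)) ⊵ₗ X) ≫ A ⊴ₗ f
        rw [← MonoidalLeftAction.actionUnitIso_inv_naturality_assoc,
          MonoidalLeftAction.action_exchange, Category.assoc] }
  μ :=
    { app X := (αₗ A A X).inv ≫ (MonObj.mul (X := A)) ⊵ₗ X
      naturality X Y f := by
        change A ⊴ₗ A ⊴ₗ f ≫ (αₗ A A Y).inv ≫ (MonObj.mul (X := A)) ⊵ₗ Y =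
          ((αₗ A A X).inv ≫ (MonObj.mul (X := A)) ⊵ₗ X) ≫ A ⊴ₗ f
        rw [Category.assoc, ← MonoidalLeftAction.action_exchange]
        simp }
  assoc X := by
    change A ⊴ₗ ((αₗ A A X).inv ≫ (MonObj.mul (X := A)) ⊵ₗ X) ≫ (αₗ A A X).inv ≫
        (MonObj.mul (X := A)) ⊵ₗ X =
      ((αₗ A A (A ⊙ₗ X)).inv ≫ (MonObj.mul (X := A)) ⊵ₗ (A ⊙ₗ X)) ≫ (αₗ A A X).inv ≫
        (MonObj.mul (X := A)) ⊵ₗ X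
    have h := congrArg (fun t => t ⊵ₗ X) (MonObj.mul_assoc A)
    simp only [MonoidalLeftAction.comp_actionHomLeft, associator_actionHom',
      MonoidalLeftAction.whiskerLeft_actionHomLeft, Category.assoc, Iso.inv_hom_id_assoc] at h
    rw [← cancel_epi ((αₗ (A ⊗ A) A X).hom ≫ (αₗ A A (A ⊙ₗ X)).hom)]
    simp only [Category.assoc]
    simp [h]
  left_unit X := by
    change ((λₗ (A ⊙ₗ X)).inv ≫ (MonObj.one (X := A)) ⊵ₗ (A ⊙ₗ X)) ≫ (αₗ A A X).inv ≫
      (MonObj.mul (X := A)) ⊵ₗ X = 𝟙 _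
    have h := congrArg (fun t => t ⊵ₗ X) (MonObj.one_mul A)
    simp only [MonoidalLeftAction.comp_actionHomLeft] at h
    simp [h]
  right_unit X := by
    change A ⊴ₗ ((λₗ X).inv ≫ (MonObj.one (X := A)) ⊵ₗ X) ≫ (αₗ A A X).inv ≫
      (MonObj.mul (X := A)) ⊵ₗ X = 𝟙 _
    have h := congrArg (fun t => t ⊵ₗ X) (MonObj.mul_one A)
    simp only [MonoidalLeftAction.comp_actionHomLeft, MonoidalLeftAction.whiskerLeft_actionHomLeft,
      Category.assoc] at h
    rw [← Iso.eq_inv_comp] at h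
    simp [h]

/-- Module objects are the algebras over the monad given by the action. -/
@[simps]
def toAlgebra : ModIn A N ⥤ (actionMonad A N).Algebra where
  obj X :=
    { A := X.X
      a := X.act
      unit := by
        change ((λₗ X.X).inv ≫ (MonObj.one (X := A)) ⊵ₗ X.X) ≫ X.act = 𝟙 _
        simp
      assoc := by
        change ((αₗ A A X.X).inv ≫ (MonObj.mul (X := A)) ⊵ₗ X.X) ≫ X.act = A ⊴ₗ X.act ≫ X.act
        simp }
  map f := { f := f.hom, h := f.act_hom.symm }

instance : (toAlgebra A N).IsEquivalence where
  faithful := ⟨fun h => hom_ext _ _ (congrArg Monad.Algebra.Hom.f h)⟩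
  full := ⟨fun f => ⟨⟨f.f, f.h.symm⟩, rfl⟩⟩
  essSurj := ⟨fun Y => by
    let a : A ⊙ₗ Y.A ⟶ Y.A := Y.a
    have h : ((λₗ Y.A).inv ≫ (MonObj.one (X := A)) ⊵ₗ Y.A) ≫ a = 𝟙 _ := Y.unit
    have h' : ((αₗ A A Y.A).inv ≫ (MonObj.mul (X := A)) ⊵ₗ Y.A) ≫ a = A ⊴ₗ a ≫ a := Y.assoc
    exact ⟨
      { X := Y.A
        act := a
        one_act := by rw [← cancel_epi (λₗ[C] Y.A).inv, ← Category.assoc, h, Iso.inv_hom_id]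
        mul_act := by rw [← h']; simp }, ⟨Iso.refl _⟩⟩⟩

section Colimits

variable [RigidCategory C]

/-- Limits are created over any monad; it is this exactness, due to duals, that makes finite
colimits be created as well. -/
instance : PreservesFiniteColimits (actionMonad A N).toFunctor :=
  inferInstanceAs (PreservesFiniteColimits (MonoidalLeftAction.actionLeft N A))

instance [HasFiniteLimits N] : HasFiniteLimits (ModIn A N) where
  out J _ _ :=
    have : HasLimitsOfShape J (actionMonad A N).Algebra :=
      hasLimitsOfShape_of_hasLimitsOfShape_createsLimitsOfShape (actionMonad A N).forget
    Adjunction.hasLimitsOfShape_of_equivalence (toAlgebra A N)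

instance [HasFiniteColimits N] : HasFiniteColimits (ModIn A N) where
  out J _ _ :=
    have : HasColimitsOfShape J (actionMonad A N).Algebra :=
      hasColimitsOfShape_of_hasColimitsOfShape_createsColimitsOfShape (actionMonad A N).forget
    Adjunction.hasColimitsOfShape_of_equivalence (toAlgebra A N)

instance [HasFiniteLimits N] : PreservesFiniteLimits (forget A N) where
  preservesFiniteLimits J _ _ :=
    inferInstanceAs (PreservesLimitsOfShape J (toAlgebra A N ⋙ (actionMonad A N).forget))

instance [HasFiniteColimits N] : PreservesFiniteColimits (forget A N) where
  preservesFiniteColimits J _ _ :=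
    inferInstanceAs (PreservesColimitsOfShape J (toAlgebra A N ⋙ (actionMonad A N).forget))

end Colimits

section Preadditive

variable [RightRigidCategory C] {A : C} [MonObj A] {N : Type x₂} [Category.{y₂} N] [Abelian N]
  [MonoidalLeftAction C N]

instance : Preadditive (ModIn A N) where
  homGroup X Y :=
    letI : Zero (X ⟶ Y) := ⟨⟨0, by simp⟩⟩
    letI : Add (X ⟶ Y) := ⟨fun f g => ⟨f.hom + g.hom, by simp [f.act_hom, g.act_hom]⟩⟩
    letI : Neg (X ⟶ Y) := ⟨fun f => ⟨-f.hom, by simp [f.act_hom]⟩⟩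
    letI : Sub (X ⟶ Y) := ⟨fun f g => ⟨f.hom - g.hom, by simp [f.act_hom, g.act_hom]⟩⟩
    letI : SMul ℕ (X ⟶ Y) := ⟨fun n f => ⟨n • f.hom, by simp [f.act_hom]⟩⟩
    letI : SMul ℤ (X ⟶ Y) := ⟨fun n f => ⟨n • f.hom, by simp [f.act_hom]⟩⟩
    Function.Injective.addCommGroup (fun f : X ⟶ Y => f.hom) (fun _ _ => hom_ext _ _)
      rfl (fun _ _ => rfl) (fun _ => rfl) (fun _ _ => rfl) (fun _ _ => rfl) (fun _ _ => rfl)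
  add_comp _ _ _ _ _ _ := hom_ext _ _ (Preadditive.add_comp _ _ _ _ _ _)
  comp_add _ _ _ _ _ _ := hom_ext _ _ (Preadditive.comp_add _ _ _ _ _ _)

@[simp]
lemma add_hom {X Y : ModIn A N} (f g : X ⟶ Y) : (f + g).hom = f.hom + g.hom := rfl

@[simp]
lemma sub_hom {X Y : ModIn A N} (f g : X ⟶ Y) : (f - g).hom = f.hom - g.hom := rfl

@[simp]
lemma zero_hom (X Y : ModIn A N) : Hom.hom (0 : X ⟶ Y) = 0 := rfl

instance : (forget A N).Additive where

variable (k : Type w') [Field k] [Preadditive C] [Linear k C] [Linear k N]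
  [LinearLeftAction k C N]

instance : Linear k (ModIn A N) where
  homModule X Y :=
    letI : SMul k (X ⟶ Y) := ⟨fun r f => ⟨r • f.hom, by
      simp [actionHomRight_smul, f.act_hom]⟩⟩
    Function.Injective.module k
      (AddMonoidHom.mk' (fun f : X ⟶ Y => f.hom) (fun _ _ => rfl)) (fun _ _ => hom_ext _ _)
      (fun _ _ => rfl)
  smul_comp _ _ _ _ _ _ := hom_ext _ _ (Linear.smul_comp _ _ _ _ _ _)
  comp_smul _ _ _ _ _ _ := hom_ext _ _ (Linear.comp_smul _ _ _ _ _ _)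

instance : (forget A N).Linear k where

end Preadditive

section Abelian

variable [RigidCategory C] (A : C) [MonObj A] (N : Type x₂) [Category.{y₂} N] [Abelian N]
  [MonoidalLeftAction C N]

/-- The forgetful functor is exact and reflects isomorphisms, so the comparison of coimage and image
can be tested in `N`. -/
noncomputable instance : Abelian (ModIn A N) :=
  have : HasFiniteProducts (ModIn A N) := hasFiniteProducts_of_hasFiniteLimits _
  have : HasKernels (ModIn A N) := inferInstance
  have : HasCokernels (ModIn A N) := inferInstance
  have : ∀ {X Y : ModIn A N} (f : X ⟶ Y), IsIso (Abelian.coimageImageComparison f) := fun f => by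
    have := Abelian.PreservesCoimageImageComparison.iso (forget A N) f
    have h : IsIso ((forget A N).map (Abelian.coimageImageComparison f)) := by
      exact ((MorphismProperty.isomorphisms N).arrow_mk_iso_iff this).2
        (inferInstanceAs (IsIso (Abelian.coimageImageComparison ((forget A N).map f))))
    exact isIso_of_reflects_iso _ (forget A N)
  Abelian.ofCoimageImageComparisonIsIso

end Abelian

section Mod

variable (A : C) [MonObj A]

/-- Mathlib's category of module objects in `C`, in terms of the action of `C` on itself. -/
@[simps]
def ofMod : Mod C A ⥤ ModIn A C where
  obj X :=
    { X := X.X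
      act := ModObj.smul (M := A) (X := X.X)
      one_act := ModObj.one_smul_self A X.X
      mul_act := ModObj.mul_smul_self A X.X }
  map f := ⟨f.hom, IsModHom.smul_hom (A := A) (f := f.hom)⟩

instance : (ofMod A).IsEquivalence where
  faithful := ⟨fun h => Mod.hom_ext _ _ (congrArg Hom.hom h)⟩
  full := ⟨fun f => ⟨Mod.Hom.mk' f.hom f.act_hom, rfl⟩⟩
  essSurj := ⟨fun Y => ⟨
    { X := Y.X
      mod :=
        { smul := Y.act
          one_smul := Y.one_act
          mul_smul := Y.mul_act } }, ⟨Iso.refl _⟩⟩⟩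

end Mod

end ModIn

end InternalModules

/-! ### Cokernels: recognition, reflection, pointwise formation -/

section Cokernels

universe x₁ y₁ x₂ y₂

/-- `p` is a cokernel of `f`. -/
structure IsCoker {D : Type x₁} [Category.{y₁} D] [HasZeroMorphisms D] {X Y Z : D} (f : X ⟶ Y)
    (p : Y ⟶ Z) : Prop where
  w : f ≫ p = 0
  epi : Epi p
  exists_desc : ∀ {W : D} (t : Y ⟶ W), f ≫ t = 0 → ∃ u : Z ⟶ W, p ≫ u = t

namespace IsCoker

variable {D : Type x₁} [Category.{y₁} D]

section

variable [HasZeroMorphisms D] {X Y Z : D} {f : X ⟶ Y} {p : Y ⟶ Z}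

lemma of_isColimit {c : CokernelCofork f} (hc : IsColimit c) : IsCoker f c.π where
  w := c.condition
  epi := ⟨fun _ _ h => Cofork.IsColimit.hom_ext hc h⟩
  exists_desc t ht := ⟨_, (CokernelCofork.IsColimit.desc' hc t ht).2⟩

/-- The colimit property of a cokernel. -/
noncomputable def isColimit (h : IsCoker f p) : IsColimit (CokernelCofork.ofπ p h.w) :=
  have := h.epi
  CokernelCofork.IsColimit.ofπ _ _ (fun t ht => (h.exists_desc t ht).choose)
    (fun t ht => (h.exists_desc t ht).choose_spec)
    (fun t ht m hm => by rw [← cancel_epi p, hm, (h.exists_desc t ht).choose_spec])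

lemma cokernel_π [HasCokernel f] : IsCoker f (cokernel.π f) :=
  of_isColimit (colimit.isColimit (parallelPair f 0))

lemma isIso_of_comp_eq {Z' : D} {p' : Y ⟶ Z'} (h : IsCoker f p) (h' : IsCoker f p') {u : Z ⟶ Z'}
    (hu : p ≫ u = p') : IsIso u := by
  have := h.epi
  have := h'.epi
  obtain ⟨v, hv⟩ := h'.exists_desc p h.w
  exact ⟨v, by rw [← cancel_epi p, reassoc_of% hu, hv, Category.comp_id],
    by rw [← cancel_epi p', reassoc_of% hv, hu, Category.comp_id]⟩

lemma of_iso (h : IsCoker f p) {X' Y' : D} (e : X' ≅ X) (e' : Y' ≅ Y) (f' : X' ⟶ Y')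
    (hf : f' ≫ e'.hom = e.hom ≫ f) : IsCoker f' (e'.hom ≫ p) where
  w := by rw [reassoc_of% hf, h.w, comp_zero]
  epi := have := h.epi; inferInstance
  exists_desc t ht := by
    obtain ⟨u, hu⟩ := h.exists_desc (e'.inv ≫ t) (by
      rw [← cancel_epi e.hom, ← reassoc_of% hf, e'.hom_inv_id_assoc, ht, comp_zero])
    exact ⟨u, by rw [Category.assoc, hu, e'.hom_inv_id_assoc]⟩

lemma map {E : Type x₂} [Category.{y₂} E] [HasZeroMorphisms E] (h : IsCoker f p) (G : D ⥤ E)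
    [G.PreservesZeroMorphisms] [PreservesFiniteColimits G] : IsCoker (G.map f) (G.map p) :=
  of_isColimit (CokernelCofork.mapIsColimit _ h.isColimit G)

end

/-- The comparison map from the cokernel of `f` to `Z` becomes invertible under `U`, which preserves
cokernels and reflects isomorphisms. -/
lemma of_map [Preadditive D] [HasFiniteColimits D] {E : Type x₂} [Category.{y₂} E]
    [HasZeroMorphisms E] (U : D ⥤ E) [U.PreservesZeroMorphisms] [PreservesFiniteColimits U]
    [U.ReflectsIsomorphisms]
    {X Y Z : D} {f : X ⟶ Y} {p : Y ⟶ Z} (hw : f ≫ p = 0) (h : IsCoker (U.map f) (U.map p)) :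
    IsCoker f p := by
  have h1 : IsCoker f (cokernel.π f) := cokernel_π
  have : IsIso (U.map (cokernel.desc f p hw)) :=
    (h1.map U).isIso_of_comp_eq h (by rw [← U.map_comp, cokernel.π_desc])
  have : IsIso (cokernel.desc f p hw) := isIso_of_reflects_iso _ U
  have h2 := h1.epi
  refine ⟨hw, ?_, fun t ht => ⟨inv (cokernel.desc f p hw) ≫ cokernel.desc f t ht, ?_⟩⟩
  · rw [← cokernel.π_desc f p hw]
    infer_instance
  · have h3 := cokernel.π_desc f p hw
    have h4 : p ≫ inv (cokernel.desc f p hw) = cokernel.π f := by rw [IsIso.comp_inv_eq, h3]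
    rw [reassoc_of% h4, cokernel.π_desc]

/-- A split coequalizer of a pair is a cokernel of the difference. -/
lemma of_split [Preadditive D] {X Y Z : D} {f g : X ⟶ Y} {p : Y ⟶ Z} (hw : f ≫ p = g ≫ p)
    (s : Z ⟶ Y) (t : Y ⟶ X) (hs : s ≫ p = 𝟙 _) (hf : t ≫ f = 𝟙 _) (hg : t ≫ g = p ≫ s) :
    IsCoker (f - g) p where
  w := by rw [Preadditive.sub_comp, hw, sub_self]
  epi := (SplitEpi.mk s hs).epi
  exists_desc u hu := by
    rw [Preadditive.sub_comp, sub_eq_zero] at hu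
    exact ⟨s ≫ u, by rw [← reassoc_of% hg, ← hu, reassoc_of% hf]⟩

end IsCoker

section CokernelFunctor

variable {T : Type x₁} [Category.{y₁} T] {D : Type x₂} [Category.{y₂} D] [Abelian D]
  {P Q : T ⥤ D} (η : P ⟶ Q)

/-- The pointwise cokernel of a natural transformation. -/
noncomputable def cokernelFunctor : T ⥤ D where
  obj X := cokernel (η.app X)
  map f := cokernel.map _ _ (P.map f) (Q.map f) (η.naturality f).symm

/-- The projection to the pointwise cokernel. -/
noncomputable def cokernelFunctorπ : Q ⟶ cokernelFunctor η where
  app X := cokernel.π (η.app X)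
  naturality X Y f := by simp [cokernelFunctor]

lemma isCoker_cokernelFunctorπ (X : T) : IsCoker (η.app X) ((cokernelFunctorπ η).app X) :=
  .cokernel_π

instance (X : T) : Epi ((cokernelFunctorπ η).app X) :=
  (isCoker_cokernelFunctorπ η X).epi

instance [Preadditive T] [Q.Additive] : (cokernelFunctor η).Additive where
  map_add {X Y f g} := by
    rw [← cancel_epi ((cokernelFunctorπ η).app X), Preadditive.comp_add]
    simp only [← NatTrans.naturality, Functor.map_add, Preadditive.add_comp]

instance {k : Type*} [Field k] [Preadditive T] [Linear k T] [Linear k D] [Q.Linear k] :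
    (cokernelFunctor η).Linear k where
  map_smul {X Y} f r := by
    rw [← cancel_epi ((cokernelFunctorπ η).app X), Linear.comp_smul]
    simp only [← NatTrans.naturality, Functor.map_smul, Linear.smul_comp]

/-- Cokernels commute with cokernels. A map out of the pointwise cokernel at `Y` that kills the
image of `f` descends first to `Q (coker f)`, because `Q` is right exact. It then passes to the
pointwise cokernel at `coker f`, where the vanishing on `P (coker f)` is tested after the
epimorphism from `P Y`. -/
instance [Abelian T] [P.Additive] [Q.Additive] [PreservesFiniteColimits P]
    [PreservesFiniteColimits Q] : PreservesFiniteColimits (cokernelFunctor η) := by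
  refine ((Functor.preservesFiniteColimits_tfae (cokernelFunctor η)).out 2 3).1 fun X Y f => ?_
  refine preservesColimit_of_preserves_colimit_cocone (cokernelIsCokernel f) ?_
  apply (CokernelCofork.isColimitMapCoconeEquiv _ _).2
  let p := cokernel.π f
  have hf : IsCoker f p := .cokernel_π
  have hP := hf.map P
  have hQ := hf.map Q
  have := hP.epi
  have := hQ.epi
  have h : IsCoker ((cokernelFunctor η).map f) ((cokernelFunctor η).map p) := by
    refine ⟨by rw [← Functor.map_comp, hf.w, Functor.map_zero], ?_, fun {W} t ht => ?_⟩
    · have h1 := (cokernelFunctorπ η).naturality p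
      have : Epi ((cokernelFunctorπ η).app Y ≫ (cokernelFunctor η).map p) := by
        rw [← h1]; exact epi_comp _ _
      exact epi_of_epi ((cokernelFunctorπ η).app Y) _
    · have h1 := (cokernelFunctorπ η).naturality f
      obtain ⟨s, hs⟩ := hQ.exists_desc ((cokernelFunctorπ η).app Y ≫ t) (by
        rw [reassoc_of% h1, ht, comp_zero])
      have h2 : η.app (cokernel f) ≫ s = 0 := by
        have h3 := η.naturality p
        rw [← cancel_epi (P.map p), reassoc_of% h3, hs, comp_zero,
          reassoc_of% (isCoker_cokernelFunctorπ η Y).w, zero_comp]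
      obtain ⟨u, hu⟩ := (isCoker_cokernelFunctorπ η (cokernel f)).exists_desc s h2
      have h4 := (cokernelFunctorπ η).naturality p
      exact ⟨u, by rw [← cancel_epi ((cokernelFunctorπ η).app Y), ← reassoc_of% h4, hu, hs]⟩
  exact h.isColimit

end CokernelFunctor

end Cokernels

section ModColimits

universe u v

open ModIn

variable {C : Type u} [Category.{v} C] [Abelian C] [MonoidalCategory C] [MonoidalPreadditive C]
  [RigidCategory C] (A : Mon C)

/-- The forgetful functor on module objects. -/
abbrev modForget : Mod C A.X ⥤ C := ofMod A.X ⋙ forget A.X C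

instance : HasFiniteColimits (Mod C A.X) where
  out _ _ _ := Adjunction.hasColimitsOfShape_of_equivalence (ofMod A.X)

instance : HasFiniteLimits (Mod C A.X) where
  out _ _ _ := Adjunction.hasLimitsOfShape_of_equivalence (ofMod A.X)

instance : (modForget A).Additive where

instance : PreservesFiniteColimits (modForget A) := comp_preservesFiniteColimits _ _

instance : PreservesFiniteLimits (modForget A) := comp_preservesFiniteLimits _ _

instance : (ofMod A.X).Additive where

end ModColimits

/-! ### The candidate for the universal balanced functor -/

section Universality

open ModIn

universe w' u v x₁ y₁ x₂ y₂

variable {C : Type u} [Category.{v} C] [Abelian C] [MonoidalCategory C] [MonoidalPreadditive C]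
  [RigidCategory C] {A : Mon C}

/-- The action as a morphism from a free module object. -/
def actHom (x : Mod C A.X) : Mod.regular A.X ⊙ᵣ x.X ⟶ x :=
  leftModHom (leftAct x) (by
    change ((α_ A.X A.X x.X).inv ≫ MonObj.mul ▷ x.X) ≫ leftAct x = A.X ◁ leftAct x ≫ leftAct x
    rw [Category.assoc, leftAct_mul, Iso.inv_hom_id_assoc])

omit [Abelian C] [MonoidalPreadditive C] [RigidCategory C] in
lemma actHom_naturality {x x' : Mod C A.X} (f : x ⟶ x') :
    Mod.regular A.X ⊴ᵣ f.hom ≫ actHom x' = actHom x ≫ f :=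
  Mod.hom_ext _ _ (leftAct_hom f).symm

omit [Abelian C] [MonoidalPreadditive C] [RigidCategory C] in
lemma actHom_action (x : Mod C A.X) (c : C) :
    actHom (x ⊙ᵣ c) = (αᵣ (Mod.regular A.X) x.X c).hom ≫ actHom x ⊵ᵣ c := by
  refine Mod.hom_ext _ _ ?_
  change leftAct (leftModTensor x c) = (α_ A.X x.X c).inv ≫ leftAct x ▷ c
  rw [leftModTensor_act]

/-- The multiplication as a morphism of module objects. -/
def mulHom : Mod.regular A.X ⊙ᵣ A.X ⟶ Mod.regular A.X := actHom (Mod.regular A.X)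

/-- The presentation of a module object by free module objects. -/
lemma isCoker_actHom (x : Mod C A.X) :
    IsCoker (mulHom ⊵ᵣ x.X - (αᵣ (Mod.regular A.X) A.X x.X).inv ≫ Mod.regular A.X ⊴ᵣ leftAct x)
      (actHom x) := by
  have h : IsCoker (MonObj.mul (X := A.X) ▷ x.X - (α_ A.X A.X x.X).hom ≫ A.X ◁ leftAct x)
      (leftAct x) := by
    -- The unit of `A` splits the bar presentation. The splitting lives in `C` and is not
    -- `A`-linear, so the cokernel is afterwards reflected along the forgetful functor.
    refine IsCoker.of_split ?_ ((λ_ x.X).inv ≫ MonObj.one (X := A.X) ▷ x.X)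
      ((λ_ (A.X ⊗ x.X)).inv ≫ MonObj.one (X := A.X) ▷ (A.X ⊗ x.X) ≫ (α_ A.X A.X x.X).inv) ?_ ?_ ?_
    · rw [leftAct_mul, Category.assoc]
    · rw [Category.assoc, leftAct_one, Iso.inv_hom_id]
    · have h := congrArg (fun t => t ▷ x.X) (MonObj.one_mul A.X)
      simp only [comp_whiskerRight] at h
      simp [h]
    · have h : (MonObj.one (X := A.X)) ▷ (A.X ⊗ x.X) ≫ A.X ◁ leftAct x =
          𝟙_ C ◁ leftAct x ≫ (MonObj.one (X := A.X)) ▷ x.X := (whisker_exchange _ _).symm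
      rw [Category.assoc, Category.assoc, Iso.inv_hom_id_assoc, h]
      simp
  have hw : (mulHom ⊵ᵣ x.X - (αᵣ (Mod.regular A.X) A.X x.X).inv ≫ Mod.regular A.X ⊴ᵣ leftAct x) ≫
      actHom x = 0 :=
    Mod.hom_ext _ _ h.w
  exact IsCoker.of_map (modForget A) hw h

variable (A) (N : Type x₁) [Category.{y₁} N] [Abelian N] [MonoidalLeftAction C N]

variable {N} in
/-- The module object `x ⊙ n` of `N` for a module object `x` of `C`. -/
@[reducible]
def modBoxObj (x : Mod C A.X) (n : N) : ModIn A.X N where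
  X := x.X ⊙ₗ n
  act := (αₗ A.X x.X n).inv ≫ leftAct x ⊵ₗ n
  one_act := by
    have h := congrArg (fun t => t ⊵ₗ n) (leftAct_one x)
    simp only [MonoidalLeftAction.comp_actionHomLeft] at h
    simp [h]
  mul_act := by
    have h := congrArg (fun t => t ⊵ₗ n) (leftAct_mul x)
    simp only [MonoidalLeftAction.comp_actionHomLeft, associator_actionHom',
      MonoidalLeftAction.whiskerLeft_actionHomLeft, Category.assoc, Iso.inv_hom_id_assoc] at h
    simp [h]

/-- The functor sending a module object `x` of `C` and an object `n` of `N` to the module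
object `x ⊙ n` of `N`. -/
@[reducible]
def modBox : Mod C A.X ⥤ N ⥤ ModIn A.X N where
  obj x :=
    { obj n := modBoxObj A x n
      map {n n'} g := ⟨x.X ⊴ₗ g, by
        have h : leftAct x ⊵ₗ n ≫ x.X ⊴ₗ g = (A.X ⊗ x.X) ⊴ₗ g ≫ leftAct x ⊵ₗ n' :=
          (MonoidalLeftAction.action_exchange _ _).symm
        change ((αₗ A.X x.X n).inv ≫ leftAct x ⊵ₗ n) ≫ x.X ⊴ₗ g =
          A.X ⊴ₗ x.X ⊴ₗ g ≫ (αₗ A.X x.X n').inv ≫ leftAct x ⊵ₗ n'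
        rw [Category.assoc, h]
        simp⟩
      map_id n := ModIn.hom_ext _ _ (MonoidalLeftAction.actionHomRight_id _ _)
      map_comp f g := ModIn.hom_ext _ _ (MonoidalLeftAction.actionHomRight_comp _ _ _) }
  map {x x'} f :=
    { app n := ⟨f.hom ⊵ₗ n, by
        have h := congrArg (fun t => t ⊵ₗ n) (leftAct_hom f)
        simp only [MonoidalLeftAction.comp_actionHomLeft] at h
        change ((αₗ A.X x.X n).inv ≫ leftAct x ⊵ₗ n) ≫ f.hom ⊵ₗ n =
          A.X ⊴ₗ f.hom ⊵ₗ n ≫ (αₗ A.X x'.X n).inv ≫ leftAct x' ⊵ₗ n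
        rw [Category.assoc, h]
        simp⟩
      naturality n n' g := ModIn.hom_ext _ _ (MonoidalLeftAction.action_exchange f.hom g) }
  map_id x := by
    ext n
    exact MonoidalLeftAction.id_actionHomLeft _ _
  map_comp f g := by
    ext n
    exact MonoidalLeftAction.comp_actionHomLeft _ _ _

@[simp]
lemma modBox_obj_obj (x : Mod C A.X) (n : N) : ((modBox A N).obj x).obj n = modBoxObj A x n := rfl

@[simp]
lemma modBox_obj_map (x : Mod C A.X) {n n' : N} (g : n ⟶ n') :
    (((modBox A N).obj x).map g).hom = x.X ⊴ₗ g := rfl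

@[simp]
lemma modBox_map_app {x x' : Mod C A.X} (f : x ⟶ x') (n : N) :
    (((modBox A N).map f).app n).hom = f.hom ⊵ₗ n := rfl

/-- The balancing of `modBox` by the associator of the action. -/
@[reducible]
def modBoxBalancing : Balancing C (modBox A N) where
  iso x c n := isoMk (X := ((modBox A N).obj (x ⊙ᵣ c)).obj n)
    (Y := ((modBox A N).obj x).obj (c ⊙ₗ n)) (αₗ x.X c n) (by
      change ((αₗ A.X (x.X ⊗ c) n).inv ≫ ((α_ A.X x.X c).inv ≫ leftAct x ▷ c) ⊵ₗ n) ≫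
        (αₗ x.X c n).hom = A.X ⊴ₗ (αₗ x.X c n).hom ≫ (αₗ A.X x.X (c ⊙ₗ n)).inv ≫
          leftAct x ⊵ₗ (c ⊙ₗ n)
      simp [associator_inv_actionHom])
  naturality_left {x x'} f c n := ModIn.hom_ext _ _ (by
    change (f.hom ▷ c) ⊵ₗ n ≫ (αₗ x'.X c n).hom = (αₗ x.X c n).hom ≫ f.hom ⊵ₗ (c ⊙ₗ n)
    simp)
  naturality_middle x c c' g n := ModIn.hom_ext _ _ (by
    change (x.X ◁ g) ⊵ₗ n ≫ (αₗ x.X c' n).hom = (αₗ x.X c n).hom ≫ x.X ⊴ₗ g ⊵ₗ n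
    simp)
  naturality_right x c n n' h := ModIn.hom_ext _ _ (by
    change (x.X ⊗ c) ⊴ₗ h ≫ (αₗ x.X c n').hom = (αₗ x.X c n).hom ≫ x.X ⊴ₗ c ⊴ₗ h
    simp)
  pentagon x c c' n := ModIn.hom_ext _ _ (by
    change (αₗ x.X (c ⊗ c') n).hom ≫ x.X ⊴ₗ (αₗ c c' n).hom =
      (α_ x.X c c').inv ⊵ₗ n ≫ (αₗ (x.X ⊗ c) c' n).hom ≫ (αₗ x.X c (c' ⊙ₗ n)).hom
    simp [associator_inv_actionHom])
  triangle x n := ModIn.hom_ext _ _ (by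
    change (αₗ x.X (𝟙_ C) n).hom ≫ x.X ⊴ₗ (λₗ n).hom = (ρ_ x.X).hom ⊵ₗ n
    simp)

@[simp]
lemma modBoxBalancing_hom_hom (x : Mod C A.X) (c : C) (n : N) :
    ((modBoxBalancing A N).iso x c n).hom.hom = (αₗ x.X c n).hom := rfl

@[simp]
lemma modBoxBalancing_inv_hom (x : Mod C A.X) (c : C) (n : N) :
    ((modBoxBalancing A N).iso x c n).inv.hom = (αₗ x.X c n).inv := rfl

variable (k : Type w') [Field k] [Linear k C] [MonoidalLinear k C] [Linear k N]
  [h : LinearLeftAction k C N]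

/-- The balanced functor with values in module objects of `N`. -/
@[simps]
def modBalanced (hN : LeftActionRightExact C N) :
    BalancedFunctor k C (Mod C A.X) N (ModIn A.X N) where
  functor := modBox A N
  bilinear :=
    { additive_left n := ⟨fun {x y f g} => ModIn.hom_ext _ _ (by
        have := h.additive_left n
        exact (MonoidalLeftAction.actionRight C n).map_add (f := f.hom) (g := g.hom))⟩
      linear_left n := ⟨fun {x y} f r => ModIn.hom_ext _ _ (by
        have := h.linear_left n
        exact (MonoidalLeftAction.actionRight C n).map_smul r f.hom)⟩
      additive_right x := ⟨fun {n n' f g} => ModIn.hom_ext _ _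
        (actionHomRight_add x.X f g)⟩
      linear_right x := ⟨fun {n n'} f r => ModIn.hom_ext _ _
        (actionHomRight_smul x.X f k r)⟩ }
  rightExact :=
    { left n := by
        have := hN n
        have : PreservesFiniteColimits ((modBox A N).flip.obj n ⋙ forget A.X N) :=
          inferInstanceAs (PreservesFiniteColimits
            (modForget A ⋙ MonoidalLeftAction.actionRight C n))
        exact ⟨fun J _ _ => preservesColimitsOfShape_of_reflects_of_preserves _ (forget A.X N)⟩
      right x := by
        have : PreservesFiniteColimits ((modBox A N).obj x ⋙ forget A.X N) :=
          inferInstanceAs (PreservesFiniteColimits (MonoidalLeftAction.actionLeft N x.X))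
        exact ⟨fun J _ _ => preservesColimitsOfShape_of_reflects_of_preserves _ (forget A.X N)⟩ }
  balancing := modBoxBalancing A N

end Universality

section BalancedIso

universe w' u v x₁ y₁ x₂ y₂ x₃ y₃

variable {k : Type w'} [Field k] {C : Type u} [Category.{v} C] [MonoidalCategory C]
  {M : Type x₁} [Category.{y₁} M] [Preadditive M] [Linear k M] [MonoidalRightAction C M]
  {N : Type x₂} [Category.{y₂} N] [Preadditive N] [Linear k N] [MonoidalLeftAction C N]
  {D : Type x₃} [Category.{y₃} D] [Preadditive D] [Linear k D]

/-- Constructor for isomorphisms of balanced functors. -/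
@[simps]
def BalancedFunctor.isoMk {F G : BalancedFunctor k C M N D}
    (e : ∀ x n, (F.functor.obj x).obj n ≅ (G.functor.obj x).obj n)
    (hl : ∀ {x x'} (f : x ⟶ x') n,
      (F.functor.map f).app n ≫ (e x' n).hom = (e x n).hom ≫ (G.functor.map f).app n)
    (hr : ∀ x {n n'} (g : n ⟶ n'),
      (F.functor.obj x).map g ≫ (e x n').hom = (e x n).hom ≫ (G.functor.obj x).map g)
    (hb : ∀ x c n, (F.balancing.iso x c n).hom ≫ (e x (c ⊙ₗ n)).hom =
      (e (x ⊙ᵣ c) n).hom ≫ (G.balancing.iso x c n).hom) : F ≅ G where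
  hom :=
    { trans :=
        { app x := { app n := (e x n).hom, naturality _ _ g := hr x g }
          naturality _ _ f := by ext n; exact hl f n }
      compatible := hb }
  inv :=
    { trans :=
        { app x :=
            { app n := (e x n).inv
              naturality _ _ g := by
                rw [Iso.eq_inv_comp, ← Category.assoc, Iso.comp_inv_eq, hr] }
          naturality x x' f := by
            ext n
            rw [NatTrans.comp_app, NatTrans.comp_app, Iso.eq_inv_comp, ← Category.assoc,
              Iso.comp_inv_eq, hl] }
      compatible x c n := by
        rw [Iso.eq_inv_comp, ← Category.assoc, Iso.comp_inv_eq, hb] }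
  hom_inv_id := by ext x n; exact (e x n).hom_inv_id
  inv_hom_id := by ext x n; exact (e x n).inv_hom_id

end BalancedIso

/-! ### The universal property of module objects -/

section Universality

open ModIn

universe w' u v x₁ y₁ x₂ y₂

variable {C : Type u} [Category.{v} C] [Abelian C] [MonoidalCategory C] [MonoidalPreadditive C]
  [RigidCategory C] {A : Mon C} {N : Type x₁} [Category.{y₁} N] [Abelian N]
  [MonoidalLeftAction C N]

/-- The action as a morphism from a free module object. -/
def actIn (X : ModIn A.X N) : ((modBox A N).obj (Mod.regular A.X)).obj X.X ⟶ X :=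
  ⟨X.act, by
    change ((αₗ A.X A.X X.X).inv ≫ MonObj.mul (X := A.X) ⊵ₗ X.X) ≫ X.act = A.X ⊴ₗ X.act ≫ X.act
    simp⟩

lemma actIn_naturality {X Y : ModIn A.X N} (f : X ⟶ Y) :
    ((modBox A N).obj (Mod.regular A.X)).map f.hom ≫ actIn Y = actIn X ≫ f :=
  ModIn.hom_ext _ _ f.act_hom.symm

/-- This links the two presentations: on `x ⊙ n` the algebra acts through `x`, up to the balancing.
-/
lemma actIn_modBoxObj (x : Mod C A.X) (n : N) :
    actIn (modBoxObj A x n) = ((modBoxBalancing A N).iso (Mod.regular A.X) x.X n).inv ≫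
      ((modBox A N).map (actHom x)).app n :=
  ModIn.hom_ext _ _ rfl

/-- The presentation of a module object by free module objects. -/
lemma isCoker_actIn (X : ModIn A.X N) :
    IsCoker (((modBox A N).map mulHom).app X.X -
      ((modBoxBalancing A N).iso (Mod.regular A.X) A.X X.X).hom ≫
        ((modBox A N).obj (Mod.regular A.X)).map X.act) (actIn X) := by
  have h : IsCoker (MonObj.mul (X := A.X) ⊵ₗ X.X - (αₗ A.X A.X X.X).hom ≫ A.X ⊴ₗ X.act)
      X.act := by
    refine IsCoker.of_split ?_ ((λₗ X.X).inv ≫ MonObj.one (X := A.X) ⊵ₗ X.X)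
      ((λₗ (A.X ⊙ₗ X.X)).inv ≫ MonObj.one (X := A.X) ⊵ₗ (A.X ⊙ₗ X.X) ≫ (αₗ A.X A.X X.X).inv)
      ?_ ?_ ?_
    · simp
    · simp
    · have h := congrArg (fun t => t ⊵ₗ X.X) (MonObj.one_mul A.X)
      simp only [MonoidalLeftAction.comp_actionHomLeft] at h
      simp [h]
    · have h : (MonObj.one (X := A.X)) ⊵ₗ (A.X ⊙ₗ X.X) ≫ A.X ⊴ₗ X.act =
          𝟙_ C ⊴ₗ X.act ≫ (MonObj.one (X := A.X)) ⊵ₗ X.X :=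
        (MonoidalLeftAction.action_exchange _ _).symm
      rw [Category.assoc, Category.assoc, Iso.inv_hom_id_assoc, h]
      simp
  exact IsCoker.of_map (forget A.X N) (ModIn.hom_ext _ _ h.w) h

variable {k : Type w'} [Field k] [Linear k C] [MonoidalLinear k C] [Linear k N]
  [LinearLeftAction k C N] {D : Type x₂} [Category.{y₂} D] [Abelian D] [Linear k D]

namespace BalancedFunctor

variable (F : BalancedFunctor k C (Mod C A.X) N D)

/-- The morphism whose cokernel is the value of the functor on module objects induced by a balanced
functor. -/
def presentationApp (X : ModIn A.X N) :
    (F.functor.obj (Mod.regular A.X ⊙ᵣ A.X)).obj X.X ⟶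
      (F.functor.obj (Mod.regular A.X)).obj X.X :=
  (F.functor.map mulHom).app X.X - (F.balancing.iso (Mod.regular A.X) A.X X.X).hom ≫
    (F.functor.obj (Mod.regular A.X)).map X.act

/-- The natural transformation whose cokernel is the functor on module objects induced by a
balanced functor. -/
def presentation : forget A.X N ⋙ F.functor.obj (Mod.regular A.X ⊙ᵣ A.X) ⟶
    forget A.X N ⋙ F.functor.obj (Mod.regular A.X) where
  app := F.presentationApp
  naturality X Y f := by
    have := F.bilinear.additive_right (Mod.regular A.X)
    have h := F.balancing.naturality_right (Mod.regular A.X) A.X f.hom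
    have h' := congrArg (F.functor.obj (Mod.regular A.X)).map f.act_hom
    simp only [Functor.map_comp] at h'
    change (F.functor.obj (Mod.regular A.X ⊙ᵣ A.X)).map f.hom ≫ F.presentationApp Y =
      F.presentationApp X ≫ (F.functor.obj (Mod.regular A.X)).map f.hom
    simp only [presentationApp, Preadditive.comp_sub, Preadditive.sub_comp, NatTrans.naturality,
      Category.assoc, h', reassoc_of% h]

/-- Apply the right exact functor `F (-, n)` to the bar presentation of `x`, and move `x` across the
balancing: `F (A ⊗ x, n) ≅ F (A, x ⊙ n)`. The multiplication terms match by naturality of the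
balancing on the left, the action terms by the pentagon and naturality in the middle. -/
lemma isCoker_presentation (x : Mod C A.X) (n : N) :
    IsCoker (F.presentationApp (modBoxObj A x n))
      ((F.balancing.iso (Mod.regular A.X) x.X n).inv ≫ (F.functor.map (actHom x)).app n) := by
  have := F.bilinear.additive_left n
  have := F.rightExact.left n
  refine ((isCoker_actHom x).map (F.functor.flip.obj n)).of_iso
    (F.balancing.iso (Mod.regular A.X ⊙ᵣ A.X) x.X n).symm
    (F.balancing.iso (Mod.regular A.X) x.X n).symm _ ?_
  change F.presentationApp (modBoxObj A x n) ≫ (F.balancing.iso (Mod.regular A.X) x.X n).inv =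
    (F.balancing.iso (Mod.regular A.X ⊙ᵣ A.X) x.X n).inv ≫ (F.functor.flip.obj n).map _
  rw [Iso.comp_inv_eq, Category.assoc, Iso.eq_inv_comp]
  have h1 := F.balancing.naturality_left (mulHom (A := A)) x.X n
  have h2 := F.balancing.pentagon (Mod.regular A.X) A.X x.X n
  have h3 := F.balancing.naturality_middle (Mod.regular A.X) (leftAct x) n
  have h4 : (F.functor.obj (Mod.regular A.X)).map (αₗ A.X x.X n).hom ≫
      (F.functor.obj (Mod.regular A.X)).map (modBoxObj A x n).act =
        (F.functor.obj (Mod.regular A.X)).map (leftAct x ⊵ₗ n) := by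
    rw [← Functor.map_comp, Iso.hom_inv_id_assoc]
  have h5 : (F.balancing.iso (Mod.regular A.X ⊙ᵣ A.X) x.X n).hom ≫
      (F.balancing.iso (Mod.regular A.X) A.X (x.X ⊙ₗ n)).hom =
      (F.functor.map (αᵣ (Mod.regular A.X) A.X x.X).inv).app n ≫
        (F.balancing.iso (Mod.regular A.X) (A.X ⊗ x.X) n).hom ≫
          (F.functor.obj (Mod.regular A.X)).map (αₗ A.X x.X n).hom := by
    rw [h2, ← Category.assoc, ← NatTrans.comp_app, ← Functor.map_comp, Iso.inv_hom_id]
    simp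
  rw [Functor.map_sub, Functor.map_comp, Preadditive.sub_comp]
  change _ ≫ ((F.functor.map mulHom).app (x.X ⊙ₗ n) -
    (F.balancing.iso (Mod.regular A.X) A.X (x.X ⊙ₗ n)).hom ≫
    (F.functor.obj (Mod.regular A.X)).map (modBoxObj A x n).act) = _
  rw [Preadditive.comp_sub, ← h1, reassoc_of% h5, h4]
  change _ = _ - (((F.functor.map (αᵣ (Mod.regular A.X) A.X x.X).inv).app n) ≫
    ((F.functor.map (Mod.regular A.X ⊴ᵣ leftAct x)).app n)) ≫
      (F.balancing.iso (Mod.regular A.X) x.X n).hom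
  rw [Category.assoc]
  congr 2
  exact h3.symm

/-- The functor on module objects induced by a balanced functor. -/
noncomputable def induced : RightExactLinearFunctor k (ModIn A.X N) D :=
  have := F.bilinear.additive_right
  have := F.bilinear.linear_right
  have := F.rightExact.right
  have (x : Mod C A.X) : PreservesFiniteColimits (forget A.X N ⋙ F.functor.obj x) :=
    comp_preservesFiniteColimits _ _
  ⟨cokernelFunctor F.presentation, inferInstance, inferInstance, inferInstance⟩

/-- The projection onto the value of the induced functor. -/
noncomputable def inducedπ (X : ModIn A.X N) :
    (F.functor.obj (Mod.regular A.X)).obj X.X ⟶ F.induced.obj.obj X :=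
  (cokernelFunctorπ F.presentation).app X

lemma inducedπ_naturality {X Y : ModIn A.X N} (f : X ⟶ Y) :
    (F.functor.obj (Mod.regular A.X)).map f.hom ≫ F.inducedπ Y =
      F.inducedπ X ≫ F.induced.obj.map f :=
  (cokernelFunctorπ F.presentation).naturality f

lemma isCoker_inducedπ (X : ModIn A.X N) : IsCoker (F.presentationApp X) (F.inducedπ X) :=
  isCoker_cokernelFunctorπ F.presentation X

/-- Both objects are cokernels of the same map. The equation pins the isomorphism down, since
`inducedπ` is an epimorphism. -/
lemma exists_inducedIso (x : Mod C A.X) (n : N) :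
    ∃ e : F.induced.obj.obj (modBoxObj A x n) ≅ (F.functor.obj x).obj n,
      F.inducedπ (modBoxObj A x n) ≫ e.hom =
        (F.balancing.iso (Mod.regular A.X) x.X n).inv ≫ (F.functor.map (actHom x)).app n := by
  obtain ⟨u, hu⟩ := (F.isCoker_inducedπ (modBoxObj A x n)).exists_desc _
    (F.isCoker_presentation x n).w
  have : IsIso u := (F.isCoker_inducedπ _).isIso_of_comp_eq (F.isCoker_presentation x n) hu
  exact ⟨asIso u, hu⟩

/-- The value of the induced functor on `x ⊙ n`. -/
noncomputable def inducedIso (x : Mod C A.X) (n : N) :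
    F.induced.obj.obj (modBoxObj A x n) ≅ (F.functor.obj x).obj n :=
  (F.exists_inducedIso x n).choose

lemma inducedπ_comp_inducedIso (x : Mod C A.X) (n : N) :
    F.inducedπ (modBoxObj A x n) ≫ (F.inducedIso x n).hom =
      (F.balancing.iso (Mod.regular A.X) x.X n).inv ≫ (F.functor.map (actHom x)).app n :=
  (F.exists_inducedIso x n).choose_spec

instance (X : ModIn A.X N) : Epi (F.inducedπ X) := (F.isCoker_inducedπ X).epi

/-- Here and in the next lemma, precomposing with the epimorphism `inducedπ` turns the claim into
naturality of the balancing of `F`, in the right and in the middle variable respectively. -/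
lemma inducedIso_naturality_right (x : Mod C A.X) {n n' : N} (g : n ⟶ n') :
    F.induced.obj.map (((modBox A N).obj x).map g) ≫ (F.inducedIso x n').hom =
      (F.inducedIso x n).hom ≫ (F.functor.obj x).map g := by
  rw [← cancel_epi (F.inducedπ (modBoxObj A x n))]
  have h := F.inducedπ_naturality (((modBox A N).obj x).map g)
  have h1 := F.balancing.naturality_right (Mod.regular A.X) x.X g
  have h2 := F.inducedπ_comp_inducedIso x n
  have h3 := F.inducedπ_comp_inducedIso x n'
  rw [← reassoc_of% h, reassoc_of% h2]
  erw [h3]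
  rw [← NatTrans.naturality, ← Category.assoc, ← Category.assoc]
  congr 1
  rw [Iso.eq_inv_comp, ← Category.assoc, Iso.comp_inv_eq]
  exact h1.symm

lemma inducedIso_naturality_left {x x' : Mod C A.X} (f : x ⟶ x') (n : N) :
    F.induced.obj.map (((modBox A N).map f).app n) ≫ (F.inducedIso x' n).hom =
      (F.inducedIso x n).hom ≫ (F.functor.map f).app n := by
  rw [← cancel_epi (F.inducedπ (modBoxObj A x n))]
  have h := F.inducedπ_naturality (((modBox A N).map f).app n)
  have h1 := F.balancing.naturality_middle (Mod.regular A.X) f.hom n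
  have h2 := F.inducedπ_comp_inducedIso x n
  have h3 := F.inducedπ_comp_inducedIso x' n
  have h4 := congrArg (fun t => (F.functor.map t).app n) (actHom_naturality f)
  simp only [Functor.map_comp, NatTrans.comp_app] at h4
  rw [← reassoc_of% h, reassoc_of% h2]
  erw [h3]
  rw [← h4, ← Category.assoc, ← Category.assoc]
  congr 1
  rw [Iso.eq_inv_comp, ← Category.assoc, Iso.comp_inv_eq]
  exact h1.symm

/-- Over `inducedπ` this becomes the pentagon for `A`, `x`, `c`, `n`, combined with naturality of
the balancing along the action map of `x`. -/
lemma inducedIso_balanced (x : Mod C A.X) (c : C) (n : N) :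
    F.induced.obj.map ((modBoxBalancing A N).iso x c n).hom ≫ (F.inducedIso x (c ⊙ₗ n)).hom =
      (F.inducedIso (x ⊙ᵣ c) n).hom ≫ (F.balancing.iso x c n).hom := by
  rw [← cancel_epi (F.inducedπ (modBoxObj A (x ⊙ᵣ c) n))]
  have h := F.inducedπ_naturality ((modBoxBalancing A N).iso x c n).hom
  have h1 := F.balancing.pentagon (Mod.regular A.X) x.X c n
  have h2 := F.inducedπ_comp_inducedIso (x ⊙ᵣ c) n
  have h3 := F.inducedπ_comp_inducedIso x (c ⊙ₗ n)
  have h4 := congrArg (fun t => (F.functor.map t).app n) (actHom_action x c)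
  have h5 := F.balancing.naturality_left (actHom x) c n
  have h6 : (F.functor.obj (Mod.regular A.X)).map (αₗ x.X c n).hom ≫
      (F.balancing.iso (Mod.regular A.X) x.X (c ⊙ₗ n)).inv ≫
        (F.functor.map (actHom x)).app (c ⊙ₗ n) =
      (F.balancing.iso (Mod.regular A.X) (x.X ⊗ c) n).inv ≫
        (F.functor.map ((αᵣ (Mod.regular A.X) x.X c).hom ≫ actHom x ⊵ᵣ c)).app n ≫
          (F.balancing.iso x c n).hom := by
    rw [Iso.eq_inv_comp, reassoc_of% h1, Functor.map_comp, NatTrans.comp_app, Category.assoc, h5]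
    simp
  rw [← reassoc_of% h, reassoc_of% h2, h4]
  erw [h3]
  exact h6

end BalancedFunctor

variable (hN : LeftActionRightExact C N)

/-- The universal property of the category of module objects. -/
instance isEquivalence_restriction_modBalanced :
    ((modBalanced A N k hN).restriction D).IsEquivalence where
  -- A transformation is determined at `X` by its value at `A ⊙ X`, because the right exact functor
  -- keeps the action map an epimorphism.
  faithful := ⟨fun {G G'} e e' h => by
    obtain ⟨G, hG, hG', hG''⟩ := G
    ext X
    have h1 := congrArg (fun t => (t.trans.app (Mod.regular A.X)).app X.X) h
    have h2 := (isCoker_actIn X).map G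
    have := h2.epi
    rw [← cancel_epi (G.map (actIn X))]
    have h3 := e.hom.naturality (actIn X)
    have h4 := e'.hom.naturality (actIn X)
    rw [h3, h4]
    congr 1⟩
  full := ⟨fun {G G'} φ => by
    obtain ⟨G, hG, hG', hG''⟩ := G
    obtain ⟨G', hG₁, hG₁', hG₁''⟩ := G'
    let φ' (x : Mod C A.X) (n : N) : G.obj (modBoxObj A x n) ⟶ G'.obj (modBoxObj A x n) :=
      (φ.trans.app x).app n
    have hl {x x' : Mod C A.X} (f : x ⟶ x') (n : N) :
        G.map (((modBox A N).map f).app n) ≫ φ' x' n =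
          φ' x n ≫ G'.map (((modBox A N).map f).app n) :=
      congrArg (fun t => t.app n) (φ.trans.naturality f)
    have hr (x : Mod C A.X) {n n' : N} (f : n ⟶ n') :
        G.map (((modBox A N).obj x).map f) ≫ φ' x n' =
          φ' x n ≫ G'.map (((modBox A N).obj x).map f) :=
      (φ.trans.app x).naturality f
    have hb (x : Mod C A.X) (c : C) (n : N) :
        G.map ((modBoxBalancing A N).iso x c n).hom ≫ φ' x (c ⊙ₗ n) =
          φ' (x ⊙ᵣ c) n ≫ G'.map ((modBoxBalancing A N).iso x c n).hom :=
      φ.compatible x c n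
    -- Compatibility with the balancing is exactly what lets the transformation at `A ⊙ X` descend
    -- along the presentation of `X`.
    have hX (X : ModIn A.X N) : ∃ e : G.obj X ⟶ G'.obj X,
        G.map (actIn X) ≫ e = φ' (Mod.regular A.X) X.X ≫ G'.map (actIn X) := by
      refine ((isCoker_actIn X).map G).exists_desc _ ?_
      have h1 := congrArg G'.map (isCoker_actIn X).w
      rw [Functor.map_comp, Functor.map_zero] at h1
      have h2 := hb (Mod.regular A.X) A.X X.X
      have h3 := hr (Mod.regular A.X) X.act
      have h4 := hl mulHom X.X
      rw [← comp_zero (f := φ' (Mod.regular A.X ⊙ᵣ A.X) X.X), ← h1]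
      simp only [Functor.map_sub, Functor.map_comp, Preadditive.sub_comp, Preadditive.comp_sub,
        Category.assoc]
      congr 1
      · rw [← Category.assoc, h4, Category.assoc]
      · rw [← reassoc_of% h2, ← reassoc_of% h3]
    choose e he using hX
    have hepi (X : ModIn A.X N) : Epi (G.map (actIn X)) := ((isCoker_actIn X).map G).epi
    refine ⟨⟨{ app := e, naturality := fun X Y f => ?_ }⟩, ?_⟩
    · rw [← cancel_epi (G.map (actIn X)), ← Functor.map_comp_assoc, ← actIn_naturality,
        Functor.map_comp, Category.assoc, he, reassoc_of% he, ← Functor.map_comp,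
        ← actIn_naturality, Functor.map_comp, reassoc_of% hr]
    -- The extension restricts to `φ`: at `x ⊙ n` the action map is, by `actIn_modBoxObj`, a
    -- composite of maps for which `φ` is natural.
    · ext x n
      change e (modBoxObj A x n) = φ' x n
      rw [← cancel_epi (G.map (actIn (modBoxObj A x n))), he, actIn_modBoxObj, Functor.map_comp,
        Functor.map_comp]
      have h1 := hl (actHom x) n
      have h2 := hb (Mod.regular A.X) x.X n
      have h3 : G.map ((modBoxBalancing A N).iso (Mod.regular A.X) x.X n).inv ≫
          φ' (Mod.regular A.X ⊙ᵣ x.X) n = φ' (Mod.regular A.X) (x.X ⊙ₗ n) ≫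
            G'.map ((modBoxBalancing A N).iso (Mod.regular A.X) x.X n).inv := by
        rw [← cancel_epi (G.map ((modBoxBalancing A N).iso (Mod.regular A.X) x.X n).hom),
          reassoc_of% h2, ← Functor.map_comp_assoc, ← Functor.map_comp]
        simp
      rw [Category.assoc, h1, reassoc_of% h3]⟩
  essSurj := ⟨fun F => ⟨F.induced, ⟨BalancedFunctor.isoMk F.inducedIso
    (fun f n => F.inducedIso_naturality_left f n) (fun x _ _ g => F.inducedIso_naturality_right x g)
    F.inducedIso_balanced⟩⟩⟩

end Universality

/-! ### Internal homs and the endomorphism algebra of an object -/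

section InternalHom

universe u v x₁ y₁

variable {C : Type u} [Category.{v} C] [MonoidalCategory C] {M : Type x₁} [Category.{y₁} M]
  [MonoidalRightAction C M]

lemma actionHomRight_whiskerLeft_exchange {m y : M} {a c d : C} (g : m ⊙ᵣ a ⟶ y) (f : c ⟶ d) :
    m ⊴ᵣ (a ◁ f) ≫ (αᵣ m a d).hom ≫ g ⊵ᵣ d = (αᵣ m a c).hom ≫ g ⊵ᵣ c ≫ y ⊴ᵣ f := by
  rw [← MonoidalRightAction.action_exchange, MonoidalRightAction.whiskerRight_actionHomLeft]
  simp

lemma actionHomRight_whiskerLeft_exchange_assoc {m y : M} {a c d : C} (g : m ⊙ᵣ a ⟶ y) (f : c ⟶ d)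
    {z : M} (h : y ⊙ᵣ d ⟶ z) :
    m ⊴ᵣ (a ◁ f) ≫ (αᵣ m a d).hom ≫ g ⊵ᵣ d ≫ h =
      (αᵣ m a c).hom ≫ g ⊵ᵣ c ≫ y ⊴ᵣ f ≫ h := by
  simpa using congrArg (· ≫ h) (actionHomRight_whiskerLeft_exchange g f)

/-- Acting on a fixed object is a linear functor. -/
@[reducible]
def actionLeftRightLinear (m : M) : (MonoidalRightAction.actionLeft C m).RightLinear C where
  μᵣ c c' := (αᵣ m c c').inv
  δᵣ c c' := (αᵣ m c c').hom
  μᵣ_naturality_right c c' c'' f := by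
    change (m ⊙ᵣ c) ⊴ᵣ f ≫ (αᵣ m c c'').inv = (αᵣ m c c').inv ≫ m ⊴ᵣ (c ◁ f)
    simp
  μᵣ_naturality_left {c c'} f d := by
    change (m ⊴ᵣ f) ⊵ᵣ d ≫ (αᵣ m c' d).inv = (αᵣ m c d).inv ≫ m ⊴ᵣ (f ▷ d)
    simp
  μᵣ_associativity c c' c'' := by
    change (αᵣ m c (c' ⊗ c'')).inv ≫ m ⊴ᵣ (α_ c c' c'').inv =
      (αᵣ (m ⊙ᵣ c) c' c'').hom ≫ (αᵣ m c c').inv ⊵ᵣ c'' ≫ (αᵣ m (c ⊗ c') c'').inv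
    simp [actionHom_associator_inv]
  μᵣ_unitality c := by
    change (ρᵣ (m ⊙ᵣ c)).hom = (αᵣ m c (𝟙_ C)).inv ≫ m ⊴ᵣ (ρ_ c).hom
    simp
  δᵣ_naturality_right c c' c'' f := by
    change m ⊴ᵣ (c ◁ f) ≫ (αᵣ m c c'').hom = (αᵣ m c c').hom ≫ (m ⊙ᵣ c) ⊴ᵣ f
    simp
  δᵣ_naturality_left {c c'} f d := by
    change m ⊴ᵣ (f ▷ d) ≫ (αᵣ m c' d).hom = (αᵣ m c d).hom ≫ (m ⊴ᵣ f) ⊵ᵣ d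
    simp
  δᵣ_associativity c c' c'' := by
    change (αᵣ m c (c' ⊗ c'')).hom ≫ (αᵣ (m ⊙ᵣ c) c' c'').hom =
      m ⊴ᵣ (α_ c c' c'').inv ≫ (αᵣ m (c ⊗ c') c'').hom ≫ (αᵣ m c c').hom ⊵ᵣ c''
    simp [actionHom_associator_inv]
  δᵣ_unitality_inv c := by
    change (ρᵣ (m ⊙ᵣ c)).inv = m ⊴ᵣ (ρ_ c).inv ≫ (αᵣ m c (𝟙_ C)).hom
    simp [actionHom_rightUnitor_inv]
  μᵣ_comp_δᵣ c c' := (αᵣ m c c').inv_hom_id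
  δᵣ_comp_μᵣ c c' := (αᵣ m c c').hom_inv_id

namespace InternalHom

variable {m : M} {R : M ⥤ C} (adj : MonoidalRightAction.actionLeft C m ⊣ R)

/-- The evaluation of an internal hom. -/
def ev (x : M) : m ⊙ᵣ R.obj x ⟶ x := adj.counit.app x

/-- The morphism to the internal hom. -/
def curry {c : C} {x : M} (f : m ⊙ᵣ c ⟶ x) : c ⟶ R.obj x := adj.homEquiv c x f

@[simp]
lemma curry_ev {c : C} {x : M} (f : m ⊙ᵣ c ⟶ x) : m ⊴ᵣ curry adj f ≫ ev adj x = f :=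
  adjunction_map_homEquiv_counit adj f

@[simp]
lemma curry_ev_assoc {c : C} {x y : M} (f : m ⊙ᵣ c ⟶ x) (g : x ⟶ y) :
    m ⊴ᵣ curry adj f ≫ ev adj x ≫ g = f ≫ g := by
  rw [← Category.assoc, curry_ev]

lemma hom_ext {c : C} {x : M} {f g : c ⟶ R.obj x}
    (h : m ⊴ᵣ f ≫ ev adj x = m ⊴ᵣ g ≫ ev adj x) : f = g :=
  adjunction_hom_ext adj h

@[simp]
lemma map_ev {x y : M} (f : x ⟶ y) : m ⊴ᵣ R.map f ≫ ev adj y = ev adj x ≫ f :=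
  adj.counit.naturality f

@[simp]
lemma map_ev_assoc {x y z : M} (f : x ⟶ y) (g : y ⟶ z) :
    m ⊴ᵣ R.map f ≫ ev adj y ≫ g = ev adj x ≫ f ≫ g := by
  rw [← Category.assoc, map_ev, Category.assoc]

/-- The comparison morphism for the action on internal homs. -/
def strength (x : M) (c : C) : R.obj x ⊗ c ⟶ R.obj (x ⊙ᵣ c) :=
  curry adj ((αᵣ m (R.obj x) c).hom ≫ ev adj x ⊵ᵣ c)

@[simp]
lemma strength_ev (x : M) (c : C) : m ⊴ᵣ strength adj x c ≫ ev adj (x ⊙ᵣ c) =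
    (αᵣ m (R.obj x) c).hom ≫ ev adj x ⊵ᵣ c :=
  curry_ev adj _

@[simp]
lemma strength_ev_assoc (x : M) (c : C) {y : M} (f : x ⊙ᵣ c ⟶ y) :
    m ⊴ᵣ strength adj x c ≫ ev adj (x ⊙ᵣ c) ≫ f =
      (αᵣ m (R.obj x) c).hom ≫ ev adj x ⊵ᵣ c ≫ f := by
  rw [← Category.assoc, strength_ev, Category.assoc]

lemma strength_naturality_left {x y : M} (f : x ⟶ y) (c : C) :
    R.map f ▷ c ≫ strength adj y c = strength adj x c ≫ R.map (f ⊵ᵣ c) :=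
  hom_ext adj (by simp [← MonoidalRightAction.comp_actionHomLeft])

lemma strength_naturality_right (x : M) {c d : C} (f : c ⟶ d) :
    R.obj x ◁ f ≫ strength adj x d = strength adj x c ≫ R.map (x ⊴ᵣ f) :=
  hom_ext adj (by
    simp [actionHomRight_whiskerLeft_exchange])

lemma strength_associativity (x : M) (c d : C) :
    strength adj x (c ⊗ d) ≫ R.map (αᵣ x c d).hom =
      (α_ (R.obj x) c d).inv ≫ strength adj x c ▷ d ≫ strength adj (x ⊙ᵣ c) d :=
  hom_ext adj (by simp [← MonoidalRightAction.comp_actionHomLeft, actionHom_associator_inv])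

lemma strength_unitality (x : M) :
    strength adj x (𝟙_ C) ≫ R.map (ρᵣ x).hom = (ρ_ (R.obj x)).hom :=
  hom_ext adj (by simp)

/-- `strength` is the lax module structure on `R` as right adjoint of the module functor `m ⊙ -`,
and lax structures are invertible over a rigid category. -/
instance [LeftRigidCategory C] (x : M) (c : C) : IsIso (strength adj x c) :=
  letI := actionLeftRightLinear (C := C) m
  letI := rightAdjointLaxRightLinear (C := C) adj
  isIso_μᵣ_of_rigid R x c

/-- The unit of the endomorphism algebra. -/
def algOne : 𝟙_ C ⟶ R.obj m := curry adj (ρᵣ m).hom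

/-- The action of the endomorphism algebra on an internal hom. -/
def algAct (x : M) : R.obj m ⊗ R.obj x ⟶ R.obj x :=
  curry adj ((αᵣ m (R.obj m) (R.obj x)).hom ≫ ev adj m ⊵ᵣ R.obj x ≫ ev adj x)

@[simp]
lemma algOne_ev : m ⊴ᵣ algOne adj ≫ ev adj m = (ρᵣ m).hom := curry_ev adj _

@[simp]
lemma algAct_ev (x : M) : m ⊴ᵣ algAct adj x ≫ ev adj x =
    (αᵣ m (R.obj m) (R.obj x)).hom ≫ ev adj m ⊵ᵣ R.obj x ≫ ev adj x := curry_ev adj _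

@[simp]
lemma algAct_ev_assoc (x : M) {y : M} (f : x ⟶ y) : m ⊴ᵣ algAct adj x ≫ ev adj x ≫ f =
    (αᵣ m (R.obj m) (R.obj x)).hom ≫ ev adj m ⊵ᵣ R.obj x ≫ ev adj x ≫ f := by
  rw [← Category.assoc, algAct_ev, Category.assoc, Category.assoc]

lemma algOne_algAct (x : M) : algOne adj ▷ R.obj x ≫ algAct adj x = (λ_ (R.obj x)).hom :=
  hom_ext adj (by
    have h := congrArg (fun t => t ⊵ᵣ R.obj x) (algOne_ev adj)
    simp only [MonoidalRightAction.comp_actionHomLeft] at h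
    simp [reassoc_of% h])

lemma algAct_algAct (x : M) : algAct adj m ▷ R.obj x ≫ algAct adj x =
    (α_ _ _ _).hom ≫ R.obj m ◁ algAct adj x ≫ algAct adj x :=
  hom_ext adj (by
    have h := congrArg (fun t => t ⊵ᵣ R.obj x) (algAct_ev adj m)
    simp only [MonoidalRightAction.comp_actionHomLeft] at h
    simp [reassoc_of% h, actionHom_associator', actionHomRight_whiskerLeft_exchange_assoc])

lemma algAct_algOne : R.obj m ◁ algOne adj ≫ algAct adj m = (ρ_ (R.obj m)).hom :=
  hom_ext adj (by
    simp [actionHomRight_whiskerLeft_exchange_assoc])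

lemma algAct_naturality {x y : M} (f : x ⟶ y) :
    algAct adj x ≫ R.map f = R.obj m ◁ R.map f ≫ algAct adj y :=
  hom_ext adj (by
    simp [actionHomRight_whiskerLeft_exchange_assoc])

lemma algAct_strength (x : M) (c : C) :
    (α_ (R.obj m) (R.obj x) c).inv ≫ algAct adj x ▷ c ≫ strength adj x c =
      R.obj m ◁ strength adj x c ≫ algAct adj (x ⊙ᵣ c) :=
  hom_ext adj (by
    have h := congrArg (fun t => t ⊵ᵣ c) (algAct_ev adj x)
    simp only [MonoidalRightAction.comp_actionHomLeft] at h
    simp [h, actionHom_associator_inv, actionHomRight_whiskerLeft_exchange_assoc])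

/-- The internal endomorphism algebra of an object. -/
def endAlgebra : Mon C where
  X := R.obj m
  mon :=
    { one := algOne adj
      mul := algAct adj m
      one_mul := algOne_algAct adj m
      mul_one := algAct_algOne adj
      mul_assoc := algAct_algAct adj m }

/-- The functor sending an object to the internal hom, a module over the endomorphism algebra. -/
def homMod : M ⥤ Mod C (endAlgebra adj).X where
  obj x :=
    { X := R.obj x
      mod :=
        { smul := algAct adj x
          one_smul := algOne_algAct adj x
          mul_smul := algAct_algAct adj x } }
  map f := leftModHom (R.map f) (algAct_naturality adj f)
  map_id x := Mod.hom_ext _ _ (R.map_id x)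
  map_comp f g := Mod.hom_ext _ _ (R.map_comp f g)

/-- The functor to modules over the endomorphism algebra is lax linear. -/
@[reducible]
def homModLaxRightLinear : (homMod adj).LaxRightLinear C where
  μᵣ x c := leftModHom (M := homMod adj |>.obj x |> fun y => y ⊙ᵣ c) (strength adj x c) (by
    change ((α_ _ _ _).inv ≫ algAct adj x ▷ c) ≫ strength adj x c =
      R.obj m ◁ strength adj x c ≫ algAct adj (x ⊙ᵣ c)
    rw [Category.assoc, algAct_strength])
  μᵣ_naturality_right x _ _ f := Mod.hom_ext _ _ (strength_naturality_right adj x f)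
  μᵣ_naturality_left f c := Mod.hom_ext _ _ (strength_naturality_left adj f c)
  μᵣ_associativity x c d := Mod.hom_ext _ _ (strength_associativity adj x c d)
  μᵣ_unitality x := Mod.hom_ext _ _ (strength_unitality adj x).symm

/-- The functor to modules over the endomorphism algebra is linear. -/
@[reducible]
noncomputable def homModRightLinear [LeftRigidCategory C] : (homMod adj).RightLinear C :=
  letI := homModLaxRightLinear adj
  rightLinearOfIsIso (homMod adj) (fun x c => by
    have : IsIso ((ModIn.ofMod _ ⋙ ModIn.forget _ C).map
        (Functor.LaxRightLinear.μᵣ (homMod adj) x c)) :=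
      inferInstanceAs (IsIso (strength adj x c))
    exact isIso_of_reflects_iso _ (ModIn.ofMod _ ⋙ ModIn.forget _ C))

end InternalHom

end InternalHom

/-! ### A finite module category is the category of modules over an endomorphism algebra -/

namespace InternalHom

section Abelian

universe u v x₁ y₁

variable {C : Type u} [Category.{v} C] [Abelian C] [MonoidalCategory C] [MonoidalPreadditive C]
  [RigidCategory C] {M : Type x₁} [Category.{y₁} M] [Abelian M] [MonoidalRightAction C M]
  {m : M} {R : M ⥤ C} (adj : MonoidalRightAction.actionLeft C m ⊣ R) (hm : IsProgenerator m)

-- Any map `m ⟶ x` factors through the evaluation, as seen from its transpose `1 ⟶ R x`, and maps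
-- from a progenerator detect zero maps.
include hm in
lemma epi_ev (x : M) : Epi (ev adj x) := by
  refine Preadditive.epi_of_cancel_zero _ fun {y} f hf => hm.hom_ext fun p => ?_
  have h : p = (ρᵣ m).inv ≫ m ⊴ᵣ curry adj ((ρᵣ m).hom ≫ p) ≫ ev adj x := by simp
  rw [h, Category.assoc, Category.assoc, hf, comp_zero, comp_zero, comp_zero]

-- `m ⊙ R y` is projective, so its evaluation to `y` lifts through `f`. The transpose of the lift is
-- a section of `R f`.
include adj hm in
lemma preservesEpimorphisms_of_isProgenerator : R.PreservesEpimorphisms where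
  preserves {x y} f _ := by
    have := projective_actionRight hm.projective (R.obj y)
    have h : curry adj (Projective.factorThru (ev adj y) f) ≫ R.map f = 𝟙 _ :=
      hom_ext adj (by simp)
    exact (SplitEpi.mk _ h).epi

include adj hm in
lemma preservesFiniteColimits_of_isProgenerator [R.Additive] : PreservesFiniteColimits R := by
  have := adj.rightAdjoint_preservesLimits.{0, 0}
  have : PreservesFiniteLimits R := PreservesLimitsOfSize.preservesFiniteLimits _
  have := preservesEpimorphisms_of_isProgenerator adj hm
  have : R.PreservesHomology := Functor.preservesHomology_of_preservesEpis_and_kernels R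
  exact Functor.preservesFiniteColimits_of_preservesHomology R

include adj hm in
lemma faithful_of_isProgenerator : R.Faithful where
  map_injective {x y} f g h := by
    have := epi_ev adj hm x
    rw [← cancel_epi (ev adj x), ← map_ev, ← map_ev, h]

-- A monadicity argument. For a module `Y`, the functor `R` sends the pair `m ⊙ (R m ⊗ Y) ⇉ m ⊙ Y`
-- to the split bar presentation of `Y`, up to `strength`. As `R` is exact and reflects
-- isomorphisms, the case `Y = R x` exhibits the evaluation at `x` as a cokernel, whence fullness.
-- For general `Y`, the cokernel formed in `M` is the object sent to `Y`.
include hm in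
lemma homMod_isEquivalence [(MonoidalRightAction.actionLeft C m).Additive] :
    (homMod adj).IsEquivalence := by
  have : R.Additive := adj.right_adjoint_additive
  have := preservesFiniteColimits_of_isProgenerator adj hm
  have := faithful_of_isProgenerator adj hm
  have : R.ReflectsIsomorphisms :=
    reflectsIsomorphisms_of_reflectsMonomorphisms_of_reflectsEpimorphisms R
  -- the two maps whose coequalizer is a given module
  let d₁ (Y : Mod C (endAlgebra adj).X) : m ⊙ᵣ (R.obj m ⊗ Y.X) ⟶ m ⊙ᵣ Y.X :=
    (αᵣ m (R.obj m) Y.X).hom ≫ ev adj m ⊵ᵣ Y.X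
  let act (Y : Mod C (endAlgebra adj).X) : R.obj m ⊗ Y.X ⟶ Y.X := leftAct Y
  let unit (c : C) : c ⟶ R.obj (m ⊙ᵣ c) := curry adj (𝟙 _)
  have hunit {c d : C} (f : c ⟶ d) : f ≫ unit d = unit c ≫ R.map (m ⊴ᵣ f) :=
    hom_ext adj (by simp [unit])
  have h₁ (Y : Mod C (endAlgebra adj).X) :
      unit (R.obj m ⊗ Y.X) ≫ R.map (d₁ Y) = strength adj m Y.X :=
    hom_ext adj (by simp [unit, d₁])
  have hd₁ (Y : Mod C (endAlgebra adj).X) : strength adj m (R.obj m ⊗ Y.X) ≫ R.map (d₁ Y) =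
      (α_ _ _ _).inv ≫ algAct adj m ▷ Y.X ≫ strength adj m Y.X :=
    hom_ext adj (by
      have h := congrArg (fun t => t ⊵ᵣ Y.X) (algAct_ev adj m)
      simp only [MonoidalRightAction.comp_actionHomLeft] at h
      simp [d₁, h, actionHom_associator_inv])
  have hact (Y : Mod C (endAlgebra adj).X) : algAct adj m ▷ Y.X ≫ act Y =
      (α_ _ _ _).hom ≫ R.obj m ◁ act Y ≫ act Y := leftAct_mul Y
  have hone (Y : Mod C (endAlgebra adj).X) : algOne adj ▷ Y.X ≫ act Y = (λ_ _).hom :=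
    leftAct_one Y
  have hs (Y : Mod C (endAlgebra adj).X) :
      unit Y.X = (λ_ _).inv ≫ algOne adj ▷ Y.X ≫ strength adj m Y.X :=
    hom_ext adj (by
      have h := congrArg (fun t => t ⊵ᵣ Y.X) (algOne_ev adj)
      simp only [MonoidalRightAction.comp_actionHomLeft] at h
      simp [unit, h, actionHom_leftUnitor_inv])
  have hp (Y : Mod C (endAlgebra adj).X) :
      IsCoker (R.map (d₁ Y) - R.map (m ⊴ᵣ act Y)) (inv (strength adj m Y.X) ≫ act Y) := by
    refine IsCoker.of_split ?_ (unit Y.X)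
      (inv (strength adj m Y.X) ≫ unit (R.obj m ⊗ Y.X)) ?_ ?_ ?_
    · rw [← cancel_epi (strength adj m (R.obj m ⊗ Y.X)), reassoc_of% (hd₁ Y),
        ← reassoc_of% (strength_naturality_right adj m (act Y))]
      simp [hact]
    · simp [hs, hone]
    · rw [Category.assoc, h₁, IsIso.inv_hom_id]
    · rw [Category.assoc, Category.assoc, hunit]
  have hx (x : M) : IsCoker
      ((αᵣ m (R.obj m) (R.obj x)).hom ≫ ev adj m ⊵ᵣ R.obj x - m ⊴ᵣ algAct adj x) (ev adj x) := by
    refine IsCoker.of_map R ?_ ?_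
    · rw [Preadditive.sub_comp, sub_eq_zero, algAct_ev, Category.assoc]
    · have h := hp ((homMod adj).obj x)
      rw [← R.map_sub] at h
      have h' : inv (strength adj m (R.obj x)) ≫ algAct adj x = R.map (ev adj x) := by
        rw [IsIso.inv_comp_eq]
        exact hom_ext adj (by simp)
      rw [← h']
      exact h
  refine { faithful := ⟨fun h => R.map_injective (congrArg Mod.Hom.hom h)⟩, full := ⟨?_⟩,
           essSurj := ⟨fun Y => ?_⟩ }
  · intro x y f
    let h : R.obj x ⟶ R.obj y := f.hom
    have hh : algAct adj x ≫ h = R.obj m ◁ h ≫ algAct adj y := leftAct_hom f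
    -- Linearity of `f` over the endomorphism algebra is the condition for the transpose of `f` to
    -- descend along the evaluation.
    obtain ⟨g, hg⟩ := (hx x).exists_desc (m ⊴ᵣ h ≫ ev adj y) (by
      rw [Preadditive.sub_comp, sub_eq_zero, ← Category.assoc (m ⊴ᵣ algAct adj x),
        ← MonoidalRightAction.actionHomRight_comp, hh]
      simp [actionHomRight_whiskerLeft_exchange_assoc])
    exact ⟨g, Mod.hom_ext _ _ (hom_ext adj ((map_ev adj g).trans hg))⟩
  · let q := cokernel.π (d₁ Y - m ⊴ᵣ act Y)
    have hq : IsCoker (R.map (d₁ Y) - R.map (m ⊴ᵣ act Y)) (R.map q) := by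
      rw [← R.map_sub]
      exact IsCoker.cokernel_π.map R
    obtain ⟨u, hu⟩ := hq.exists_desc _ (hp Y).w
    have : IsIso u := hq.isIso_of_comp_eq (hp Y) hu
    -- Linearity of `u` is checked after the epimorphism `R m ⊗ R q`; tensoring with `R m` preserves
    -- epimorphisms because it is a left adjoint.
    have hue : algAct adj _ ≫ u = R.obj m ◁ u ≫ act Y := by
      have := hq.epi
      have := (tensorLeftAdjunction (ᘁ(R.obj m)) (R.obj m)).leftAdjoint_preservesColimits.{0, 0}
      have : Epi (R.obj m ◁ R.map q) := inferInstanceAs (Epi ((tensorLeft (R.obj m)).map (R.map q)))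
      rw [← cancel_epi (R.obj m ◁ R.map q), ← cancel_epi (R.obj m ◁ strength adj m Y.X),
        ← reassoc_of% (algAct_naturality adj q), ← reassoc_of% (algAct_strength adj m Y.X), hu,
        ← MonoidalCategory.whiskerLeft_comp_assoc (R.obj m) (R.map q), hu]
      simp [hact]
    let e : (homMod adj).obj (cokernel (d₁ Y - m ⊴ᵣ act Y)) ⟶ Y := leftModHom u hue
    have : IsIso ((ModIn.ofMod _ ⋙ ModIn.forget _ C).map e) := inferInstanceAs (IsIso u)
    have := isIso_of_reflects_iso e (ModIn.ofMod _ ⋙ ModIn.forget _ C)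
    exact ⟨_, ⟨asIso e⟩⟩

end Abelian

end InternalHom

/-! ### Changing the first variable along an equivalence -/

section PrecompLeft

universe w' u v x₁ y₁ x₂ y₂ x₃ y₃ x₄ y₄

open Functor

variable {k : Type w'} [Field k] {C : Type u} [Category.{v} C] [MonoidalCategory C]
  {M : Type x₁} [Category.{y₁} M] [Preadditive M] [Linear k M] [MonoidalRightAction C M]
  {M' : Type x₂} [Category.{y₂} M'] [Preadditive M'] [Linear k M'] [MonoidalRightAction C M']
  {N : Type x₃} [Category.{y₃} N] [Preadditive N] [Linear k N] [MonoidalLeftAction C N]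
  {D : Type x₄} [Category.{y₄} D] [Preadditive D] [Linear k D]

namespace BalancedFunctor

/-- The composite of a balanced functor with a module functor in the first variable. -/
@[reducible]
def precompLeft (F : BalancedFunctor k C M' N D) (P : M ⥤ M') [P.Additive] [P.Linear k]
    [PreservesFiniteColimits P] [P.RightLinear C] : BalancedFunctor k C M N D where
  functor := P ⋙ F.functor
  bilinear :=
    { additive_left n := by
        have := F.bilinear.additive_left n
        exact inferInstanceAs (P ⋙ F.functor.flip.obj n).Additive
      linear_left n := by
        have := F.bilinear.linear_left n
        exact inferInstanceAs ((P ⋙ F.functor.flip.obj n).Linear k)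
      additive_right m := F.bilinear.additive_right (P.obj m)
      linear_right m := F.bilinear.linear_right (P.obj m) }
  rightExact :=
    { left n := by
        have := F.rightExact.left n
        exact comp_preservesFiniteColimits P (F.functor.flip.obj n)
      right m := F.rightExact.right (P.obj m) }
  balancing :=
    { iso m c n := (F.functor.mapIso (RightLinear.μᵣIso P m c).symm).app n ≪≫
        F.balancing.iso (P.obj m) c n
      naturality_left {m m'} f c n := by
        have h := congrArg (fun t => (F.functor.map t).app n)
          (OplaxRightLinear.δᵣ_naturality_left P f c)
        have h' := F.balancing.naturality_left (P.map f) c n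
        simp only [Functor.map_comp, NatTrans.comp_app] at h
        simp [reassoc_of% h, h']
      naturality_middle m c c' g n := by
        have h := congrArg (fun t => (F.functor.map t).app n)
          (OplaxRightLinear.δᵣ_naturality_right P m g)
        have h' := F.balancing.naturality_middle (P.obj m) g n
        simp only [Functor.map_comp, NatTrans.comp_app] at h
        simp [reassoc_of% h, h']
      naturality_right m c n n' h := by
        simp [F.balancing.naturality_right (P.obj m) c h]
      pentagon m c c' n := by
        have h := congrArg (fun t => (F.functor.map t).app n)
          (OplaxRightLinear.δᵣ_associativity P m c c')
        have p := F.balancing.pentagon (P.obj m) c c' n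
        have l := F.balancing.naturality_left (OplaxRightLinear.δᵣ P m c) c' n
        simp only [Functor.map_comp, NatTrans.comp_app] at h
        dsimp
        simp only [Category.assoc]
        rw [p, reassoc_of% h, reassoc_of% l]
      triangle m n := by
        have h := congrArg (fun t => (F.functor.map t).app n)
          (OplaxRightLinear.δᵣ_unitality_hom (C := C) P m)
        have t := F.balancing.triangle (P.obj m) n
        simp only [Functor.map_comp, NatTrans.comp_app] at h
        dsimp
        simp only [Category.assoc]
        rw [t, h] }

/-- Precomposition with a module functor in the first variable, as a functor on balanced
functors. -/
@[reducible]
def precompLeftFunctor (N : Type x₃) [Category.{y₃} N] [Preadditive N] [Linear k N]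
    [MonoidalLeftAction C N] (D : Type x₄) [Category.{y₄} D] [Preadditive D] [Linear k D]
    (P : M ⥤ M') [P.Additive] [P.Linear k]
    [PreservesFiniteColimits P] [P.RightLinear C] :
    BalancedFunctor k C M' N D ⥤ BalancedFunctor k C M N D where
  obj F := F.precompLeft P
  map {F G} η :=
    { trans := Functor.whiskerLeft P η.trans
      compatible m c n := by
        have h := η.compatible (P.obj m) c n
        simp [h] }

/-- Compatibility with the balancings need only be checked on objects in the image of an
equivalence. -/
lemma compatible_of_iso {F G : BalancedFunctor k C M N D} (η : F.functor ⟶ G.functor) {x x' : M}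
    (e : x ≅ x') (c : C) (n : N)
    (h : (F.balancing.iso x c n).hom ≫ (η.app x).app (c ⊙ₗ n) =
      (η.app (x ⊙ᵣ c)).app n ≫ (G.balancing.iso x c n).hom) :
    (F.balancing.iso x' c n).hom ≫ (η.app x').app (c ⊙ₗ n) =
      (η.app (x' ⊙ᵣ c)).app n ≫ (G.balancing.iso x' c n).hom := by
  have h1 := F.balancing.naturality_left e.hom c n
  have h2 := G.balancing.naturality_left e.hom c n
  have h3 := congrArg (fun t => t.app n) (η.naturality (e.hom ⊵ᵣ c))
  have h4 := congrArg (fun t => t.app (c ⊙ₗ n)) (η.naturality e.hom)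
  simp only [NatTrans.comp_app] at h3 h4
  have : IsIso (e.hom ⊵ᵣ c) :=
    inferInstanceAs (IsIso ((MonoidalRightAction.actionRight M c).map e.hom))
  rw [← cancel_epi ((F.functor.map (e.hom ⊵ᵣ c)).app n), reassoc_of% h1, h4, reassoc_of% h,
    reassoc_of% h3, h2]

variable (P : M ⥤ M') [P.IsEquivalence] [P.Additive] [P.Linear k]
    [PreservesFiniteColimits P] [P.RightLinear C]

/-- Precomposition with an equivalence of module categories is an equivalence. -/
instance isEquivalence_precompLeftFunctor [LeftRigidCategory C] :
    (precompLeftFunctor (k := k) (C := C) N D P).IsEquivalence where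
  faithful := ⟨fun {F G} η η' h => by
    ext1
    exact ((whiskeringLeft M M' (N ⥤ D)).obj P).map_injective (congrArg Hom.trans h)⟩
  full := ⟨fun {F G} η => by
    obtain ⟨θ, hθ⟩ := ((whiskeringLeft M M' (N ⥤ D)).obj P).map_surjective η.trans
    have hθ' (x : M) : θ.app (P.obj x) = η.trans.app x := congrArg (fun t => t.app x) hθ
    refine ⟨⟨θ, fun x c n => ?_⟩, Hom.ext hθ⟩
    refine compatible_of_iso θ (P.objObjPreimageIso x) c n ?_
    have h := η.compatible (P.objPreimage x) c n
    rw [← hθ', ← hθ'] at h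
    have h2 := congrArg (fun t => t.app n)
      (θ.naturality (OplaxRightLinear.δᵣ P (P.objPreimage x) c))
    simp only [NatTrans.comp_app] at h2
    have h1 : (F.functor.map (OplaxRightLinear.δᵣ P (P.objPreimage x) c)).app n ≫
      (F.balancing.iso (P.obj (P.objPreimage x)) c n).hom ≫
        (θ.app (P.obj (P.objPreimage x))).app (c ⊙ₗ n) =
      (θ.app (P.obj (P.objPreimage x ⊙ᵣ c))).app n ≫
        (G.functor.map (OplaxRightLinear.δᵣ P (P.objPreimage x) c)).app n ≫
      (G.balancing.iso (P.obj (P.objPreimage x)) c n).hom := by simpa using h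
    rw [← reassoc_of% h2] at h1
    rwa [cancel_epi] at h1⟩
  essSurj := ⟨fun F => by
    -- The inverse equivalence carries the module structure of a right adjoint. For that structure
    -- the unit is a module transformation (`hb`), which makes `F.precompLeft Q` a balanced preimage
    -- of `F`.
    let Q : M' ⥤ M := P.inv
    let adj : P ⊣ Q := P.asEquivalence.toAdjunction
    have : IsIso adj.unit := inferInstanceAs (IsIso P.asEquivalence.unit)
    have : IsIso adj.counit := inferInstanceAs (IsIso P.asEquivalence.counit)
    have : Q.IsEquivalence := inferInstanceAs P.inv.IsEquivalence
    have : Q.Additive := adj.right_adjoint_additive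
    have : P.asEquivalence.functor.Linear k := inferInstanceAs (P.Linear k)
    have : Q.Linear k := P.asEquivalence.inverseLinear k
    let : Q.RightLinear C := rightAdjointRightLinear (C := C) adj
    let u (x : M) : x ≅ Q.obj (P.obj x) := asIso (adj.unit.app x)
    have hu {x x' : M} (f : x ⟶ x') : Q.map (P.map f) ≫ (u x').inv = (u x).inv ≫ f := by
      rw [Iso.comp_inv_eq, Category.assoc, Iso.eq_inv_comp]
      exact (adj.unit.naturality f).symm
    have hb (x : M) (c : C) : Q.map (OplaxRightLinear.δᵣ P x c) ≫
        OplaxRightLinear.δᵣ Q (P.obj x) c ≫ (u x).inv ⊵ᵣ c = (u (x ⊙ᵣ c)).inv := by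
      have h : (u (x ⊙ᵣ c)).hom ≫ Q.map (OplaxRightLinear.δᵣ P x c) =
          (u x).hom ⊵ᵣ c ≫ LaxRightLinear.μᵣ Q (P.obj x) c :=
        adjunction_hom_ext adj (by
          have h : P.map (LaxRightLinear.μᵣ Q (P.obj x) c) ≫ adj.counit.app (P.obj x ⊙ᵣ c) =
              OplaxRightLinear.δᵣ P (Q.obj (P.obj x)) c ≫ adj.counit.app (P.obj x) ⊵ᵣ c :=
            adjunction_map_homEquiv_counit adj _
          have h2 := congrArg (fun t => t ⊵ᵣ c) (adj.left_triangle_components x)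
          simp only [MonoidalRightAction.comp_actionHomLeft] at h2
          rw [Functor.map_comp, Functor.map_comp, Category.assoc, Category.assoc,
            h]
          simp [u, h2])
      rw [← cancel_epi (u (x ⊙ᵣ c)).hom, reassoc_of% h]
      simp [← MonoidalRightAction.comp_actionHomLeft]
    refine ⟨F.precompLeft Q, ⟨isoMk (fun x n => (F.functor.mapIso (u x).symm).app n) ?_ ?_ ?_⟩⟩
    · intro x x' f n
      have h := congrArg (fun t => (F.functor.map t).app n) (hu f)
      simpa using h
    · intro x n n' g
      exact ((F.functor.map (u x).inv).naturality g)
    · intro x c n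
      have h := congrArg (fun t => (F.functor.map t).app n) (hb x c)
      have h' := F.balancing.naturality_left (u x).inv c n
      simp only [Functor.map_comp, NatTrans.comp_app] at h
      simp [← h, ← h']⟩

end BalancedFunctor

end PrecompLeft

/-! ### Formal properties of universal balanced functors -/

section Universal

universe w' u v x₁ y₁ x₂ y₂ x₃ y₃ x₄ y₄ x₅ y₅

variable {k : Type w'} [Field k]

namespace RightExactLinearFunctor

variable {T : Type x₃} [Category.{y₃} T] [Preadditive T] [Linear k T]
  {T' : Type x₄} [Category.{y₄} T'] [Preadditive T'] [Linear k T']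
  {D : Type x₅} [Category.{y₅} D] [Preadditive D] [Linear k D]

/-- A right exact linear functor as an object of the category of such functors. -/
@[simps]
def mk (G : T ⥤ D) [hG : G.Additive] [hG' : G.Linear k] [hG'' : PreservesFiniteColimits G] :
    RightExactLinearFunctor k T D := ⟨G, hG, hG', hG''⟩

instance (G : RightExactLinearFunctor k T D) : G.obj.Additive := G.property.1

instance (G : RightExactLinearFunctor k T D) : G.obj.Linear k := G.property.2.1

instance (G : RightExactLinearFunctor k T D) : PreservesFiniteColimits G.obj := G.property.2.2

/-- The composite of right exact linear functors. -/
@[reducible]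
def comp (G : RightExactLinearFunctor k T T') (H : RightExactLinearFunctor k T' D) :
    RightExactLinearFunctor k T D :=
  ⟨G.obj ⋙ H.obj, inferInstance, inferInstance, comp_preservesFiniteColimits _ _⟩

/-- An isomorphism of underlying functors is an isomorphism of right exact linear functors. -/
def isoMk {G H : RightExactLinearFunctor k T D} (e : G.obj ≅ H.obj) : G ≅ H :=
  (ObjectProperty.fullyFaithfulι _).preimageIso e

/-- The isomorphism of underlying functors. -/
def isoObj {G H : RightExactLinearFunctor k T D} (e : G ≅ H) : G.obj ≅ H.obj :=
  (ObjectProperty.ι _).mapIso e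

variable (D) in
/-- Composition with a right exact linear functor on the left. -/
@[reducible]
def compLeft (G : RightExactLinearFunctor k T T') :
    RightExactLinearFunctor k T' D ⥤ RightExactLinearFunctor k T D where
  obj H := G.comp H
  map η := ⟨Functor.whiskerLeft G.obj η.hom⟩

instance isEquivalence_compLeft (G : RightExactLinearFunctor k T T') [G.obj.IsEquivalence] :
    (compLeft D G).IsEquivalence where
  faithful := ⟨fun {H H'} η η' h => by
    ext1
    exact ((Functor.whiskeringLeft T T' D).obj G.obj).map_injective
      (congrArg (fun t => t.hom) h)⟩
  full := ⟨fun {H H'} η => by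
    obtain ⟨θ, hθ⟩ := ((Functor.whiskeringLeft T T' D).obj G.obj).map_surjective η.hom
    exact ⟨⟨θ⟩, InducedCategory.Hom.ext hθ⟩⟩
  essSurj := ⟨fun H => by
    have : G.obj.asEquivalence.functor.Additive := inferInstanceAs G.obj.Additive
    have : G.obj.asEquivalence.functor.Linear k := inferInstanceAs (G.obj.Linear k)
    have : G.obj.inv.Additive := inferInstanceAs G.obj.asEquivalence.inverse.Additive
    have : G.obj.inv.Linear k := G.obj.asEquivalence.inverseLinear k
    exact ⟨comp (mk G.obj.inv) H,
      ⟨isoMk (Functor.isoWhiskerRight G.obj.asEquivalence.unitIso.symm H.obj)⟩⟩⟩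

end RightExactLinearFunctor

variable {C : Type u} [Category.{v} C] [MonoidalCategory C]
  {M : Type x₁} [Category.{y₁} M] [Preadditive M] [Linear k M] [MonoidalRightAction C M]
  {N : Type x₂} [Category.{y₂} N] [Preadditive N] [Linear k N] [MonoidalLeftAction C N]

namespace BalancedFunctor

section

variable {T : Type x₃} [Category.{y₃} T] [Preadditive T] [Linear k T]
  {T' : Type x₄} [Category.{y₄} T'] [Preadditive T'] [Linear k T']
  {D : Type x₅} [Category.{y₅} D] [Preadditive D] [Linear k D]

/-- Composition with a right exact linear functor, as a functor on balanced functors. -/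
@[reducible]
def postcompFunctor (G : RightExactLinearFunctor k T T') :
    BalancedFunctor k C M N T ⥤ BalancedFunctor k C M N T' where
  obj F := F.postcomp G
  map {F F'} η :=
    { trans := Functor.whiskerRight η.trans ((Functor.whiskeringRight N T T').obj G.obj)
      compatible m c n := by
        have h := congrArg G.obj.map (η.compatible m c n)
        rwa [Functor.map_comp, Functor.map_comp] at h }

/-- Composition of balanced functors with right exact linear functors is associative. -/
def postcompComp (F : BalancedFunctor k C M N T) (G : RightExactLinearFunctor k T T')
    (H : RightExactLinearFunctor k T' D) : (F.postcomp G).postcomp H ≅ F.postcomp (G.comp H) :=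
  isoMk (fun _ _ => Iso.refl _)
    (fun _ _ => (Category.comp_id _).trans (Category.id_comp _).symm)
    (fun _ {_ _} _ => (Category.comp_id _).trans (Category.id_comp _).symm)
    (fun _ _ _ => (Category.comp_id _).trans (Category.id_comp _).symm)

/-- The composite of a balanced functor with an identity functor. -/
def postcompId (F : BalancedFunctor k C M N T) :
    F.postcomp (RightExactLinearFunctor.mk (𝟭 T)) ≅ F :=
  isoMk (fun _ _ => Iso.refl _)
    (fun _ _ => (Category.comp_id _).trans (Category.id_comp _).symm)
    (fun _ {_ _} _ => (Category.comp_id _).trans (Category.id_comp _).symm)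
    (fun _ _ _ => (Category.comp_id _).trans (Category.id_comp _).symm)

/-- The restriction functor along the composite of a balanced functor and a right exact linear
functor. -/
def restrictionPostcomp (F : BalancedFunctor k C M N T) (G : RightExactLinearFunctor k T T') :
    (F.postcomp G).restriction D ≅ G.compLeft D ⋙ F.restriction D :=
  NatIso.ofComponents (fun H => postcompComp F G H) (fun _ => by
    ext x n
    exact (Category.comp_id _).trans (Category.id_comp _).symm)

/-- The restriction functors along isomorphic balanced functors are isomorphic. -/
def restrictionCongr {F F' : BalancedFunctor k C M N T} (e : F ≅ F') :
    F.restriction D ≅ F'.restriction D :=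
  NatIso.ofComponents (fun H => (postcompFunctor H).mapIso e) (fun η => by
    ext x n
    exact (η.hom.naturality ((e.hom.trans.app x).app n)).symm)

lemma isEquivalence_restriction_postcomp (F : BalancedFunctor k C M N T)
    (G : RightExactLinearFunctor k T T') [G.obj.IsEquivalence] [(F.restriction D).IsEquivalence] :
    ((F.postcomp G).restriction D).IsEquivalence :=
  Functor.isEquivalence_of_iso (restrictionPostcomp F G).symm

lemma isEquivalence_restriction_of_iso {F F' : BalancedFunctor k C M N T} (e : F ≅ F')
    [(F.restriction D).IsEquivalence] : (F'.restriction D).IsEquivalence :=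
  Functor.isEquivalence_of_iso (restrictionCongr e)

/-- Universal balanced functors are unique up to equivalence. -/
theorem exists_equivalence (F : BalancedFunctor k C M N T) (F' : BalancedFunctor k C M N T')
    [(F.restriction T).IsEquivalence] [(F.restriction T').IsEquivalence]
    [(F'.restriction T).IsEquivalence] [(F'.restriction T').IsEquivalence] :
    ∃ E : RightExactLinearFunctor k T T', E.obj.IsEquivalence ∧ Nonempty (F.postcomp E ≅ F') := by
  let E := (F.restriction T').objPreimage F'
  let E' := (F'.restriction T).objPreimage F
  let e : F.postcomp E ≅ F' := (F.restriction T').objObjPreimageIso F'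
  let e' : F'.postcomp E' ≅ F := (F'.restriction T).objObjPreimageIso F
  -- The composite and the identity restrict to isomorphic balanced functors, and restriction along
  -- `F` is fully faithful.
  let a : E.comp E' ≅ RightExactLinearFunctor.mk (𝟭 T) :=
    (F.restriction T).preimageIso ((postcompComp F E E').symm ≪≫ (postcompFunctor E').mapIso e ≪≫
      e' ≪≫ (postcompId F).symm)
  let a' : E'.comp E ≅ RightExactLinearFunctor.mk (𝟭 T') :=
    (F'.restriction T').preimageIso ((postcompComp F' E' E).symm ≪≫
      (postcompFunctor E).mapIso e' ≪≫ e ≪≫ (postcompId F').symm)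
  exact ⟨E, (CategoryTheory.Equivalence.mk E.obj E'.obj (RightExactLinearFunctor.isoObj a.symm)
    (RightExactLinearFunctor.isoObj a')).isEquivalence_functor, ⟨e⟩⟩

/-- A balanced functor which is universal for its own target and the target of a universal balanced
functor is universal. -/
theorem isEquivalence_restriction_of_universal (F : BalancedFunctor k C M N T)
    (F' : BalancedFunctor k C M N T')
    [(F.restriction T).IsEquivalence] [(F.restriction T').IsEquivalence]
    [(F'.restriction T).IsEquivalence] [(F'.restriction T').IsEquivalence]
    [(F'.restriction D).IsEquivalence] : (F.restriction D).IsEquivalence := by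
  obtain ⟨E, _, ⟨e⟩⟩ := exists_equivalence F' F
  have := isEquivalence_restriction_postcomp (D := D) F' E
  exact isEquivalence_restriction_of_iso e

end

section

variable {M' : Type x₃} [Category.{y₃} M'] [Preadditive M'] [Linear k M'] [MonoidalRightAction C M']
  {T : Type x₄} [Category.{y₄} T] [Preadditive T] [Linear k T]
  {D : Type x₅} [Category.{y₅} D] [Preadditive D] [Linear k D] [LeftRigidCategory C]

lemma isEquivalence_restriction_precompLeft (F : BalancedFunctor k C M' N T)
    [(F.restriction D).IsEquivalence] (P : M ⥤ M') [P.IsEquivalence] [P.Additive] [P.Linear k]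
    [PreservesFiniteColimits P] [P.RightLinear C] :
    ((F.precompLeft P).restriction D).IsEquivalence :=
  Functor.isEquivalence_of_iso (F := F.restriction D ⋙ precompLeftFunctor (k := k) (C := C) N D P)
    (NatIso.ofComponents (fun H => isoMk (fun _ _ => Iso.refl _)
    (fun _ _ => (Category.comp_id _).trans (Category.id_comp _).symm)
    (fun _ {_ _} _ => (Category.comp_id _).trans (Category.id_comp _).symm)
    (fun _ _ _ => (Category.comp_id _).trans
      ((H.obj.map_comp _ _).symm.trans (Category.id_comp _).symm)))
      (fun _ => by
        ext x n
        exact (Category.comp_id _).trans (Category.id_comp _).symm))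

end

end BalancedFunctor

end Universal

/-! ### Change of universe: small models and local smallness -/

section Transport

universe w' u v x₁ y₁ s s'

/-- A category equivalent to a linear abelian category is linear abelian. -/
theorem exists_abelian_of_equivalence (k : Type w') [Field k] {X : Type u} [Category.{v} X]
    [Abelian X] [Linear k X] {S : Type x₁} [Category.{y₁} S] (F : S ⥤ X) [F.IsEquivalence] :
    ∃ (_ : Abelian S) (_ : Linear k S), F.Additive ∧ F.Linear k := by
  let hF := Functor.FullyFaithful.ofFullyFaithful F
  let p : Preadditive S := Preadditive.ofFullyFaithful hF
  have : HasFiniteProducts S := ⟨fun n =>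
    Adjunction.hasLimitsOfShape_of_equivalence F⟩
  have hadd : F.Additive := hF.additive_ofFullyFaithful
  let a : Abelian S := abelianOfEquivalence F
  let l : Linear k S :=
    { homModule x y :=
        letI : SMul k (x ⟶ y) := ⟨fun r f => hF.preimage (r • F.map f)⟩
        Function.Injective.module k
          (AddMonoidHom.mk' (fun f : x ⟶ y => F.map f) (fun _ _ => F.map_add))
          F.map_injective (fun _ _ => hF.map_preimage _)
      smul_comp x y z r f g := F.map_injective (by
        change F.map (hF.preimage (r • F.map f) ≫ g) = F.map (hF.preimage (r • F.map (f ≫ g)))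
        simp)
      comp_smul x y z f r g := F.map_injective (by
        change F.map (f ≫ hF.preimage (r • F.map g)) = F.map (hF.preimage (r • F.map (f ≫ g)))
        simp) }
  exact ⟨a, l, hadd, ⟨fun f r => hF.map_preimage _⟩⟩

attribute [local instance] uliftCategory in
/-- An essentially small linear abelian category has a model in a given universe. -/
theorem exists_small_model (k : Type w') [Field k] (X : Type u) [Category.{v} X] [Abelian X]
    [Linear k X] [EssentiallySmall.{y₁} X] :
    ∃ (S : Type (max s y₁)) (_ : Category.{max s' y₁} S) (_ : Abelian S) (_ : Linear k S)
      (G : X ⥤ S), G.IsEquivalence ∧ G.Additive ∧ G.Linear k := by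
  let e : X ≌ ULiftHom.{s'} (ULift.{s} (SmallModel.{y₁} X)) :=
    (equivSmallModel X).trans (ULiftHomULiftCategory.equiv.{s', s} _)
  obtain ⟨a, l, h, h'⟩ := exists_abelian_of_equivalence k e.inverse
  have : e.symm.functor.Additive := h
  have : e.symm.functor.Linear k := h'
  exact ⟨ULiftHom.{s'} (ULift.{s} (SmallModel.{y₁} X)), _, a, l, e.functor, inferInstance,
    inferInstanceAs e.symm.inverse.Additive, e.symm.inverseLinear k⟩

end Transport

section LocallySmall

universe w' u v x₁ y₁

variable (k : Type w') [Field k]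

lemma small_hom_of_small [Small.{v} k] (X : Type x₁) [Category.{y₁} X] [Preadditive X] [Linear k X]
    (h : ∀ x y : X, Module.Finite k (x ⟶ y)) : LocallySmall.{v} X where
  hom_small x y := by
    have := h x y
    exact small_map (Module.finBasis k (x ⟶ y)).equivFun.toEquiv

variable {C : Type u} [Category.{v} C] [Preadditive C] [Linear k C] [MonoidalCategory C]

variable (C) in
/-- A module category is locally small relative to the universe of the acting category. -/
theorem locallySmall_of_action (N : Type x₁) [Category.{y₁} N] [Preadditive N] [Linear k N]
    [MonoidalLeftAction C N] [h : LinearLeftAction k C N]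
    (hN : ∀ x y : N, Module.Finite k (x ⟶ y)) : LocallySmall.{v} N := by
  -- If the unit object vanishes, every object of `N` is zero. Otherwise scalars embed `k` into the
  -- endomorphisms of the unit, so `k` is `v`-small, and with it every finite dimensional morphism
  -- space.
  by_cases h1 : 𝟙 (𝟙_ C) = 0
  · have h0 (n : N) : 𝟙 n = 0 := by
      have := h.additive_left n
      have h2 : 𝟙 ((𝟙_ C : C) ⊙ₗ n) = 0 := by
        have h3 := (MonoidalLeftAction.actionRight C n).map_zero (𝟙_ C) (𝟙_ C)
        rwa [← h1, (MonoidalLeftAction.actionRight C n).map_id] at h3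
      rw [← cancel_epi ((λₗ n).hom : (𝟙_ C : C) ⊙ₗ n ⟶ n),
        ← Category.id_comp ((λₗ n).hom : (𝟙_ C : C) ⊙ₗ n ⟶ n), h2]
      simp
    exact ⟨fun x y => by
      have : Subsingleton (x ⟶ y) := ⟨fun f g => by
        rw [← Category.id_comp f, ← Category.id_comp g, h0, zero_comp, zero_comp]⟩
      infer_instance⟩
  · have : Small.{v} k := small_of_injective (β := (𝟙_ C ⟶ 𝟙_ C)) (f := fun r => r • 𝟙 (𝟙_ C))
      (fun r s hrs => smul_left_injective k h1 hrs)
    exact small_hom_of_small k N hN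

end LocallySmall

/-! ### Free module objects -/

section Model

universe w' u v x₁ y₁ x₂ y₂ x₃ y₃ s s'

open ModIn

variable {C : Type u} [Category.{v} C] [Abelian C] [MonoidalCategory C] [MonoidalPreadditive C]
  [RigidCategory C]

/-- Free module objects are left adjoint to the forgetful functor. -/
def freeAdjunction (A : Mon C) (N : Type x₁) [Category.{y₁} N] [Abelian N]
    [MonoidalLeftAction C N] : (modBox A N).obj (Mod.regular A.X) ⊣ forget A.X N :=
  Adjunction.mkOfHomEquiv
    { homEquiv n X :=
        { toFun f := (λₗ n).inv ≫ MonObj.one (X := A.X) ⊵ₗ n ≫ f.hom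
          invFun g := ((modBox A N).obj (Mod.regular A.X)).map g ≫ actIn X
          left_inv f := ModIn.hom_ext _ _ (by
            have key (g : A.X ⊙ₗ n ⟶ X.X)
                (hg : A.X ⊴ₗ g ≫ X.act = ((αₗ A.X A.X n).inv ≫ MonObj.mul (X := A.X) ⊵ₗ n) ≫ g) :
                A.X ⊴ₗ ((λₗ n).inv ≫ MonObj.one (X := A.X) ⊵ₗ n ≫ g) ≫ X.act = g := by
              have h := congrArg (fun t => t ⊵ₗ n) (MonObj.mul_one A.X)
              simp only [MonoidalLeftAction.comp_actionHomLeft] at h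
              rw [MonoidalLeftAction.actionHomRight_comp, MonoidalLeftAction.actionHomRight_comp,
                Category.assoc, Category.assoc, hg, ← cancel_epi
                  (A.X ⊴ₗ ((λₗ n).hom : (𝟙_ C : C) ⊙ₗ n ⟶ n))]
              simp only [MonoidalLeftAction.whiskerLeft_actionHomLeft] at h
              simp only [Category.assoc] at h
              rw [← cancel_epi (αₗ A.X (𝟙_ C) n).hom]
              simp [reassoc_of% h]
            exact key f.hom f.act_hom.symm)
          right_inv g := by
            have key (g : n ⟶ X.X) :
                (λₗ n).inv ≫ MonObj.one (X := A.X) ⊵ₗ n ≫ A.X ⊴ₗ g ≫ X.act = g := by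
              rw [← MonoidalLeftAction.action_exchange_assoc]
              simp
            exact key g }
      homEquiv_naturality_left_symm {n n' X} f g := by
        have key (g : n' ⟶ X.X) : ((modBox A N).obj (Mod.regular A.X)).map (f ≫ g) ≫ actIn X =
            ((modBox A N).obj (Mod.regular A.X)).map f ≫
              ((modBox A N).obj (Mod.regular A.X)).map g ≫ actIn X := by
          rw [Functor.map_comp, Category.assoc]
        exact key g
      homEquiv_naturality_right {n X Y} f g := by
        have key (f : A.X ⊙ₗ n ⟶ X.X) (g : X.X ⟶ Y.X) :
            (λₗ n).inv ≫ MonObj.one (X := A.X) ⊵ₗ n ≫ f ≫ g =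
              ((λₗ n).inv ≫ MonObj.one (X := A.X) ⊵ₗ n ≫ f) ≫ g := by
          simp only [Category.assoc]
        exact key f.hom g.hom }

end Model

/-! ### Existence of the balanced tensor product and its model -/

section Main

universe w' u v x₁ y₁ x₂ y₂ x₃ y₃ x₄ y₄ s s'

open ModIn

variable {k : Type w'} [Field k]

lemma linear_of_adjunction {X : Type x₁} [Category.{y₁} X] [Preadditive X] [Linear k X]
    {Y : Type x₂} [Category.{y₂} Y] [Preadditive Y] [Linear k Y] {L : X ⥤ Y} {R : Y ⥤ X}
    (adj : L ⊣ R) [L.Additive] [L.Linear k] [R.Additive] : R.Linear k where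
  map_smul f r := adjunction_hom_ext adj (by
    rw [L.map_smul]
    simp)

variable {C : Type u} [Category.{v} C] [Abelian C] [Linear k C] [MonoidalCategory C]
  [MonoidalPreadditive C] [MonoidalLinear k C] [RigidCategory C]

section

variable {M : Type x₁} [Category.{y₁} M] [Abelian M] [Linear k M] [MonoidalRightAction C M]
  [h : LinearRightAction k C M]

variable (k) in
lemma isLeftAdjoint_actionLeft [FiniteLinear k C] [FiniteLinear k M]
    (hM : RightActionRightExact C M) (m : M) :
    (MonoidalRightAction.actionLeft C m).IsLeftAdjoint := by
  have := h.additive_right m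
  have := h.linear_right m
  have := hM m
  exact isLeftAdjoint_of_rightExact (k := k) (FiniteLinear.finite_hom) _

variable (k C M) in
/-- Every finite module category is the category of modules over an algebra. -/
theorem exists_mod_equivalence [FiniteLinear k C] [FiniteLinear k M]
    (hM : RightActionRightExact C M) :
    ∃ (A : Mon C) (P : M ⥤ Mod C A.X) (_ : P.RightLinear C),
      P.IsEquivalence ∧ P.Additive ∧ P.Linear k := by
  obtain ⟨m, hm⟩ := exists_isProgenerator k M
  have := isLeftAdjoint_actionLeft k hM m
  let adj := Adjunction.ofIsLeftAdjoint (MonoidalRightAction.actionLeft C m)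
  have := h.additive_right m
  have := h.linear_right m
  have : (MonoidalRightAction.actionLeft C m).rightAdjoint.Additive := adj.right_adjoint_additive
  have : (MonoidalRightAction.actionLeft C m).rightAdjoint.Linear k := linear_of_adjunction adj
  exact ⟨InternalHom.endAlgebra adj, InternalHom.homMod adj, InternalHom.homModRightLinear adj,
    InternalHom.homMod_isEquivalence adj hm,
    ⟨Mod.hom_ext _ _ (Functor.map_add _)⟩, ⟨fun f r => Mod.hom_ext _ _ (Functor.map_smul _ r f)⟩⟩

end

section

variable {M : Type x₁} [Category.{y₁} M] [Abelian M] [Linear k M] [MonoidalRightAction C M]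
  {N : Type x₂} [Category.{y₂} N] [Abelian N] [Linear k N] [MonoidalLeftAction C N]
  [LinearLeftAction k C N]

variable (k) in
lemma finiteLinear_modIn [FiniteLinear k N] (A : Mon C) : FiniteLinear k (ModIn A.X N) :=
  FiniteLinear.of_faithful_of_adjunction (forget A.X N) k (freeAdjunction A N)

variable (k) in
lemma locallySmall_modIn [FiniteLinear k N] (A : Mon C) : LocallySmall.{v} (ModIn A.X N) := by
  have := locallySmall_of_action k C N FiniteLinear.finite_hom
  exact locallySmall_of_faithful (forget A.X N)

/-- The balanced functor with values in module objects associated to a description of a module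
category as a category of modules. -/
@[reducible]
def modelBalanced (hN : LeftActionRightExact C N) {A : Mon C} (P : M ⥤ Mod C A.X)
    [P.IsEquivalence] [P.Additive] [P.Linear k] [P.RightLinear C] :
    BalancedFunctor k C M N (ModIn A.X N) :=
  (modBalanced A N k hN).precompLeft P

variable (hN : LeftActionRightExact C N) {A : Mon C} (P : M ⥤ Mod C A.X)
    [P.IsEquivalence] [P.Additive] [P.Linear k] [P.RightLinear C]

instance isEquivalence_restriction_modelBalanced {D : Type x₃} [Category.{y₃} D] [Abelian D]
    [Linear k D] : ((modelBalanced (k := k) hN P).restriction D).IsEquivalence :=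
  BalancedFunctor.isEquivalence_restriction_precompLeft _ P

-- The model lives in the universes of `N`, whereas a balanced tensor product is tested only against
-- categories in its own universes; an equivalent category there is therefore needed.
variable (k N A) in
lemma exists_small_modIn [FiniteLinear k N] :
    ∃ (T : Type (max s v)) (_ : Category.{max s' v} T) (_ : Abelian T) (_ : Linear k T)
      (G : RightExactLinearFunctor k (ModIn A.X N) T), G.obj.IsEquivalence := by
  have := locallySmall_modIn k (N := N) A
  have := finiteLinear_modIn k (N := N) A
  have : EssentiallySmall.{v} (ModIn A.X N) := FiniteLinear.essentiallySmall k _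
  obtain ⟨T, _, _, _, G, _, _, _⟩ := exists_small_model.{w', _, _, v, s, s'} k (ModIn A.X N)
  exact ⟨T, _, _, _, RightExactLinearFunctor.mk G, ‹_›⟩

include hN P in
/-- The balanced tensor product exists. -/
theorem exists_isBalancedTensorProduct_of_equivalence [FiniteLinear k N] :
    ∃ (T : Type (max s v)) (_ : Category.{max s' v} T) (_ : Abelian T) (_ : Linear k T)
      (box : BalancedFunctor k C M N T), IsBalancedTensorProduct box := by
  obtain ⟨T, _, _, _, G, _⟩ := exists_small_modIn.{w', _, _, _, _, s, s'} k N A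
  exact ⟨T, _, _, _, (modelBalanced hN P).postcomp G,
    fun D _ _ _ => BalancedFunctor.isEquivalence_restriction_postcomp _ _⟩

section

variable {T : Type (max s v)} [Category.{max s' v} T] [Abelian T] [Linear k T]
  {box : BalancedFunctor k C M N T} (hbox : IsBalancedTensorProduct box)

include hN P hbox in
/-- The universal property of a balanced tensor product extends to all universes. -/
theorem isEquivalence_restriction_of_isBalancedTensorProduct [FiniteLinear k N]
    (D : Type x₃) [Category.{y₃} D] [Abelian D] [Linear k D] :
    (box.restriction D).IsEquivalence := by
  -- `box` and the small model are each universal for both targets, hence equivalent, and the model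
  -- is universal for categories in all universes.
  obtain ⟨T', _, _, _, G, _⟩ := exists_small_modIn.{w', _, _, _, _, s, s'} k N A
  have (D : Type x₃) [Category.{y₃} D] [Abelian D] [Linear k D] :
      (((modelBalanced hN P).postcomp G).restriction D).IsEquivalence :=
    BalancedFunctor.isEquivalence_restriction_postcomp _ _
  have (D : Type (max s v)) [Category.{max s' v} D] [Abelian D] [Linear k D] :
      (((modelBalanced hN P).postcomp G).restriction D).IsEquivalence :=
    BalancedFunctor.isEquivalence_restriction_postcomp _ _
  have := hbox T
  have := hbox T'
  exact BalancedFunctor.isEquivalence_restriction_of_universal box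
    ((modelBalanced hN P).postcomp G)

include hbox in
/-- A balanced tensor product is the category of module objects. -/
theorem exists_equivalence_modIn [FiniteLinear k N] :
    ∃ E : RightExactLinearFunctor k T (ModIn A.X N), E.obj.IsEquivalence ∧
      Nonempty (box.postcomp E ≅ modelBalanced hN P) := by
  have := isEquivalence_restriction_of_isBalancedTensorProduct hN P hbox T
  have := isEquivalence_restriction_of_isBalancedTensorProduct hN P hbox (ModIn A.X N)
  exact BalancedFunctor.exists_equivalence _ _

end

end

end Main

/-! ### Exactness of the universal functor and finiteness of its target -/

section Exactness

universe w' u v x₁ y₁ x₂ y₂ x₃ y₃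

open ModIn

variable {k : Type w'} [Field k]

/-- The isomorphism of functors underlying an isomorphism of balanced functors. -/
def BalancedFunctor.isoFunctor {C : Type u} [Category.{v} C] [MonoidalCategory C]
    {M : Type x₁} [Category.{y₁} M] [Preadditive M] [Linear k M] [MonoidalRightAction C M]
    {N : Type x₂} [Category.{y₂} N] [Preadditive N] [Linear k N] [MonoidalLeftAction C N]
    {T : Type x₃} [Category.{y₃} T] [Preadditive T] [Linear k T]
    {F G : BalancedFunctor k C M N T} (e : F ≅ G) : F.functor ≅ G.functor where
  hom := e.hom.trans
  inv := e.inv.trans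
  hom_inv_id := congrArg Hom.trans e.hom_inv_id
  inv_hom_id := congrArg Hom.trans e.inv_hom_id

variable {C : Type u} [Category.{v} C] [Abelian C] [Linear k C] [MonoidalCategory C]
  [MonoidalPreadditive C] [MonoidalLinear k C] [RigidCategory C] [EnoughProjectives C]
  {M : Type x₁} [Category.{y₁} M] [Abelian M] [Linear k M] [MonoidalRightAction C M]
  {N : Type x₂} [Category.{y₂} N] [Abelian N] [Linear k N] [MonoidalLeftAction C N]
  [h : LinearLeftAction k C N] (hN : LeftActionRightExact C N) {A : Mon C} (P : M ⥤ Mod C A.X)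
  [P.IsEquivalence] [P.Additive] [P.Linear k] [P.RightLinear C]
  {T : Type x₃} [Category.{y₃} T] [Abelian T] [Linear k T]

/-- The forgetful functor to `N` reflects limits. Over it the functor is the action of `C` on a
fixed `n` in one variable, left exact by `preservesFiniteLimits_of_leftActionRightExact`, and the
action by a fixed object of `C` in the other, left exact by rigidity. -/
lemma isLeftExact₂_modelBalanced : IsLeftExact₂ (modelBalanced (k := k) hN P).functor where
  left n := by
    have := h.additive_left
    have := preservesFiniteLimits_of_leftActionRightExact N hN n
    have : PreservesFiniteLimits ((modBox A N).flip.obj n ⋙ forget A.X N) :=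
      inferInstanceAs (PreservesFiniteLimits (modForget A ⋙ MonoidalLeftAction.actionRight C n))
    have : PreservesFiniteLimits ((modBox A N).flip.obj n) :=
      ⟨fun J _ _ => preservesLimitsOfShape_of_reflects_of_preserves _ (forget A.X N)⟩
    exact comp_preservesFiniteLimits P ((modBox A N).flip.obj n)
  right x := by
    have : PreservesFiniteLimits ((modBox A N).obj (P.obj x) ⋙ forget A.X N) :=
      inferInstanceAs (PreservesFiniteLimits (MonoidalLeftAction.actionLeft N (P.obj x).X))
    exact ⟨fun J _ _ => preservesLimitsOfShape_of_reflects_of_preserves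
      ((modBox A N).obj (P.obj x)) (forget A.X N)⟩

include hN P in
lemma isLeftExact₂_of_equivalence (box : BalancedFunctor k C M N T)
    (E : RightExactLinearFunctor k T (ModIn A.X N)) [E.obj.IsEquivalence]
    (e : box.postcomp E ≅ modelBalanced hN P) : IsLeftExact₂ box.functor where
  left n := by
    have := (isLeftExact₂_modelBalanced (k := k) hN P).left n
    let i : box.functor.flip.obj n ⋙ E.obj ≅ (modelBalanced (k := k) hN P).functor.flip.obj n :=
      ((flipFunctor _ _ _).mapIso (BalancedFunctor.isoFunctor e)).app n
    have : PreservesFiniteLimits (box.functor.flip.obj n ⋙ E.obj) :=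
      ⟨fun J _ _ => preservesLimitsOfShape_of_natIso i.symm⟩
    exact ⟨fun J _ _ => preservesLimitsOfShape_of_reflects_of_preserves _ E.obj⟩
  right x := by
    have := (isLeftExact₂_modelBalanced (k := k) hN P).right x
    let i : box.functor.obj x ⋙ E.obj ≅ (modelBalanced (k := k) hN P).functor.obj x :=
      (BalancedFunctor.isoFunctor e).app x
    have : PreservesFiniteLimits (box.functor.obj x ⋙ E.obj) :=
      ⟨fun J _ _ => preservesLimitsOfShape_of_natIso i.symm⟩
    exact ⟨fun J _ _ => preservesLimitsOfShape_of_reflects_of_preserves _ E.obj⟩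

/-- `T` is exact and faithful over `N` through the model, with free module objects as left adjoint.
-/
lemma finiteLinear_of_equivalence [FiniteLinear k N]
    (E : RightExactLinearFunctor k T (ModIn A.X N)) [E.obj.IsEquivalence] : FiniteLinear k T :=
  have : PreservesFiniteColimits (E.obj ⋙ forget A.X N) := comp_preservesFiniteColimits _ _
  FiniteLinear.of_faithful_of_adjunction (E.obj ⋙ forget A.X N) k
    ((freeAdjunction A N).comp E.obj.asEquivalence.symm.toAdjunction)

end Exactness

/-! ### The balanced functors `(x, n) ↦ x ⊙ S n` -/

section ActBalanced

universe w' u v x₁ y₁ x₂ y₂ x₃ y₃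

open Functor

variable {C : Type u} [Category.{v} C] [MonoidalCategory C]
  {N : Type x₂} [Category.{y₂} N] [MonoidalLeftAction C N] (S : N ⥤ C)
  (M : Type x₁) [Category.{y₁} M] [MonoidalRightAction C M]

/-- The functor `(x, n) ↦ x ⊙ S n`. -/
@[reducible]
def actFunctor : M ⥤ N ⥤ M where
  obj x :=
    { obj n := x ⊙ᵣ S.obj n
      map g := x ⊴ᵣ S.map g
      map_comp f g := by simp }
  map f :=
    { app n := f ⊵ᵣ S.obj n
      naturality _ _ g := MonoidalRightAction.action_exchange f (S.map g) }
  map_id x := by ext n; simp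
  map_comp f g := by ext n; simp

/-- The balancing of `(x, n) ↦ x ⊙ S n`. -/
@[reducible]
def actBalancing [S.LeftLinear C] :
    Balancing C (actFunctor S M) where
  iso x c n := (αᵣ x c (S.obj n)).symm ≪≫
    (MonoidalRightAction.actionLeft C x).mapIso (LeftLinear.μₗIso S c n)
  naturality_left {x x'} f c n := by
    change (f ⊵ᵣ c) ⊵ᵣ S.obj n ≫ (αᵣ x' c (S.obj n)).inv ≫ x' ⊴ᵣ LaxLeftLinear.μₗ S c n =
      ((αᵣ x c (S.obj n)).inv ≫ x ⊴ᵣ LaxLeftLinear.μₗ S c n) ≫ f ⊵ᵣ S.obj (c ⊙ₗ n)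
    rw [Category.assoc, MonoidalRightAction.action_exchange]
    simp
  naturality_middle x c c' g n := by
    have h := congrArg (fun t => x ⊴ᵣ t) (LaxLeftLinear.μₗ_naturality_left S g n)
    change (x ⊴ᵣ g) ⊵ᵣ S.obj n ≫ (αᵣ x c' (S.obj n)).inv ≫ x ⊴ᵣ LaxLeftLinear.μₗ S c' n =
      ((αᵣ x c (S.obj n)).inv ≫ x ⊴ᵣ LaxLeftLinear.μₗ S c n) ≫ x ⊴ᵣ S.map (g ⊵ₗ n)
    simp only [MonoidalRightAction.actionHomRight_comp] at h
    rw [Category.assoc, ← h]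
    simp
  naturality_right x c n n' g := by
    have h := congrArg (fun t => x ⊴ᵣ t) (LaxLeftLinear.μₗ_naturality_right S c g)
    change (x ⊙ᵣ c) ⊴ᵣ S.map g ≫ (αᵣ x c (S.obj n')).inv ≫ x ⊴ᵣ LaxLeftLinear.μₗ S c n' =
      ((αᵣ x c (S.obj n)).inv ≫ x ⊴ᵣ LaxLeftLinear.μₗ S c n) ≫ x ⊴ᵣ S.map (c ⊴ₗ g)
    simp only [MonoidalRightAction.actionHomRight_comp] at h
    rw [Category.assoc, ← h]
    simp
  pentagon x c c' n := by
    have h := congrArg (fun t => x ⊴ᵣ t) (LaxLeftLinear.μₗ_associativity S c c' n)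
    simp only [MonoidalRightAction.actionHomRight_comp] at h
    change ((αᵣ x (c ⊗ c') (S.obj n)).inv ≫ x ⊴ᵣ LaxLeftLinear.μₗ S (c ⊗ c') n) ≫
        x ⊴ᵣ S.map (αₗ c c' n).hom =
      (αᵣ x c c').hom ⊵ᵣ S.obj n ≫
        ((αᵣ (x ⊙ᵣ c) c' (S.obj n)).inv ≫ (x ⊙ᵣ c) ⊴ᵣ LaxLeftLinear.μₗ S c' n) ≫
          (αᵣ x c (S.obj (c' ⊙ₗ n))).inv ≫ x ⊴ᵣ LaxLeftLinear.μₗ S c (c' ⊙ₗ n)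
    rw [Category.assoc, h]
    simp [actionHom_associator']
  triangle x n := by
    have h := congrArg (fun t => x ⊴ᵣ t) (LaxLeftLinear.μₗ_unitality (C := C) S n)
    simp only [MonoidalRightAction.actionHomRight_comp] at h
    change ((αᵣ x (𝟙_ C) (S.obj n)).inv ≫ x ⊴ᵣ LaxLeftLinear.μₗ S (𝟙_ C) n) ≫
      x ⊴ᵣ S.map (λₗ n).hom =
      (ρᵣ x).hom ⊵ᵣ S.obj n
    rw [Category.assoc, ← h]
    simp

end ActBalanced

section ActBalanced

universe w' u v x₁ y₁ x₂ y₂ x₃ y₃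

open Functor

variable {k : Type w'} [Field k]
  {C : Type u} [Category.{v} C] [Abelian C] [Linear k C] [MonoidalCategory C]
  [MonoidalPreadditive C] [MonoidalLinear k C] [RigidCategory C]
  {M : Type x₁} [Category.{y₁} M] [Abelian M] [Linear k M] [MonoidalRightAction C M]
  [h : LinearRightAction k C M]
  {N : Type x₂} [Category.{y₂} N] [Abelian N] [Linear k N] [MonoidalLeftAction C N]
  (S : N ⥤ C) [S.LeftLinear C] [S.Additive] [S.Linear k] [PreservesFiniteColimits S]

variable (k M) in
/-- The balanced functor `(x, n) ↦ x ⊙ S n`. -/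
@[reducible]
def actBalanced (hM : RightActionRightExact C M) : BalancedFunctor k C M N M where
  functor := actFunctor S M
  bilinear :=
    { additive_left n := h.additive_left (S.obj n)
      linear_left n := h.linear_left (S.obj n)
      additive_right x := by
        have := h.additive_right x
        exact inferInstanceAs (S ⋙ MonoidalRightAction.actionLeft C x).Additive
      linear_right x := by
        have := h.linear_right x
        exact inferInstanceAs ((S ⋙ MonoidalRightAction.actionLeft C x).Linear k) }
  rightExact :=
    { left n := inferInstanceAs
        (PreservesFiniteColimits (MonoidalRightAction.actionRight M (S.obj n)))
      right x := by
        have := hM x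
        exact comp_preservesFiniteColimits S (MonoidalRightAction.actionLeft C x) }
  balancing := actBalancing S M

end ActBalanced

/-! ### Internal homs of left module categories -/

section LeftInternalHom

universe u v x₁ y₁ x₂ y₂ x₃ y₃

open Functor

variable {C : Type u} [Category.{v} C] [MonoidalCategory C] {N : Type x₁} [Category.{y₁} N]
  [MonoidalLeftAction C N]

/-- Acting on a fixed object is a linear functor. -/
@[reducible]
def actionRightLeftLinear (n : N) : (MonoidalLeftAction.actionRight C n).LeftLinear C where
  μₗ c c' := (αₗ c c' n).inv
  δₗ c c' := (αₗ c c' n).hom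
  μₗ_naturality_right c c' c'' f := by
    change c ⊴ₗ (f ⊵ₗ n) ≫ (αₗ c c'' n).inv = (αₗ c c' n).inv ≫ (c ◁ f) ⊵ₗ n
    simp
  μₗ_naturality_left {c c'} f d := by
    change f ⊵ₗ (d ⊙ₗ n) ≫ (αₗ c' d n).inv = (αₗ c d n).inv ≫ (f ▷ d) ⊵ₗ n
    simp
  μₗ_associativity c c' c'' := by
    change (αₗ (c ⊗ c') c'' n).inv ≫ (α_ c c' c'').hom ⊵ₗ n =
      (αₗ c c' (c'' ⊙ₗ n)).hom ≫ c ⊴ₗ (αₗ c' c'' n).inv ≫ (αₗ c (c' ⊗ c'') n).inv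
    simp [associator_actionHom']
  μₗ_unitality c := by
    change (λₗ (c ⊙ₗ n)).hom = (αₗ (𝟙_ C) c n).inv ≫ (λ_ c).hom ⊵ₗ n
    simp
  δₗ_naturality_right c c' c'' f := by
    change (c ◁ f) ⊵ₗ n ≫ (αₗ c c'' n).hom = (αₗ c c' n).hom ≫ c ⊴ₗ (f ⊵ₗ n)
    simp
  δₗ_naturality_left {c c'} f d := by
    change (f ▷ d) ⊵ₗ n ≫ (αₗ c' d n).hom = (αₗ c d n).hom ≫ f ⊵ₗ (d ⊙ₗ n)
    simp
  δₗ_associativity c c' c'' := by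
    change (αₗ (c ⊗ c') c'' n).hom ≫ (αₗ c c' (c'' ⊙ₗ n)).hom =
      (α_ c c' c'').hom ⊵ₗ n ≫ (αₗ c (c' ⊗ c'') n).hom ≫ c ⊴ₗ (αₗ c' c'' n).hom
    simp [associator_actionHom']
  δₗ_unitality_inv c := by
    change (λₗ (c ⊙ₗ n)).inv = (λ_ c).inv ⊵ₗ n ≫ (αₗ (𝟙_ C) c n).hom
    simp [leftUnitor_inv_actionHom]
  μₗ_comp_δₗ c c' := (αₗ c c' n).inv_hom_id
  δₗ_comp_μₗ c c' := (αₗ c c' n).hom_inv_id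

namespace LeftInternalHom

variable {n : N} {R : N ⥤ C} (adj : MonoidalLeftAction.actionRight C n ⊣ R)

/-- The evaluation of an internal hom. -/
def ev (y : N) : R.obj y ⊙ₗ n ⟶ y := adj.counit.app y

/-- The morphism to the internal hom. -/
def curry {c : C} {y : N} (f : c ⊙ₗ n ⟶ y) : c ⟶ R.obj y := adj.homEquiv c y f

@[simp]
lemma curry_ev {c : C} {y : N} (f : c ⊙ₗ n ⟶ y) : curry adj f ⊵ₗ n ≫ ev adj y = f :=
  adjunction_map_homEquiv_counit adj f

@[simp]
lemma curry_ev_assoc {c : C} {y z : N} (f : c ⊙ₗ n ⟶ y) (g : y ⟶ z) :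
    curry adj f ⊵ₗ n ≫ ev adj y ≫ g = f ≫ g := by
  rw [← Category.assoc, curry_ev]

lemma hom_ext {c : C} {y : N} {f g : c ⟶ R.obj y}
    (h : f ⊵ₗ n ≫ ev adj y = g ⊵ₗ n ≫ ev adj y) : f = g :=
  adjunction_hom_ext adj h

@[simp]
lemma map_ev {x y : N} (f : x ⟶ y) : R.map f ⊵ₗ n ≫ ev adj y = ev adj x ≫ f :=
  adj.counit.naturality f

end LeftInternalHom

/-- The composite of linear functors is linear. -/
@[reducible]
def compLeftLinear {N' : Type x₂} [Category.{y₂} N'] [MonoidalLeftAction C N'] {N'' : Type x₃}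
    [Category.{y₃} N''] [MonoidalLeftAction C N''] (F : N ⥤ N') [F.LeftLinear C] (G : N' ⥤ N'')
    [G.LeftLinear C] : (F ⋙ G).LeftLinear C where
  μₗ c n := LaxLeftLinear.μₗ G c (F.obj n) ≫ G.map (LaxLeftLinear.μₗ F c n)
  δₗ c n := G.map (OplaxLeftLinear.δₗ F c n) ≫ OplaxLeftLinear.δₗ G c (F.obj n)
  μₗ_naturality_right c n n' f := by
    have h := congrArg G.map (LaxLeftLinear.μₗ_naturality_right F c f)
    simp only [Functor.map_comp] at h
    simp [h]
  μₗ_naturality_left {c c'} f n := by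
    have h := congrArg G.map (LaxLeftLinear.μₗ_naturality_left F f n)
    simp only [Functor.map_comp] at h
    simp [h]
  μₗ_associativity c c' n := by
    have h := congrArg G.map (LaxLeftLinear.μₗ_associativity F c c' n)
    simp only [Functor.map_comp] at h
    simp [h]
  μₗ_unitality n := by
    have h := congrArg G.map (LaxLeftLinear.μₗ_unitality (C := C) F n)
    simp only [Functor.map_comp] at h
    change (λₗ (G.obj (F.obj n))).hom = (LaxLeftLinear.μₗ G (𝟙_ C) (F.obj n) ≫
      G.map (LaxLeftLinear.μₗ F (𝟙_ C) n)) ≫ G.map (F.map (λₗ n).hom)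
    rw [Category.assoc, ← h, ← LaxLeftLinear.μₗ_unitality]
  δₗ_naturality_right c n n' f := by
    have h := congrArg G.map (OplaxLeftLinear.δₗ_naturality_right F c f)
    simp only [Functor.map_comp] at h
    simp [reassoc_of% h]
  δₗ_naturality_left {c c'} f n := by
    have h := congrArg G.map (OplaxLeftLinear.δₗ_naturality_left F f n)
    simp only [Functor.map_comp] at h
    simp [reassoc_of% h]
  δₗ_associativity c c' n := by
    have h := congrArg G.map (OplaxLeftLinear.δₗ_associativity F c c' n)
    simp only [Functor.map_comp] at h
    simp [reassoc_of% h]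
  δₗ_unitality_inv n := by
    simp
  μₗ_comp_δₗ c n := by simp [← Functor.map_comp_assoc]
  δₗ_comp_μₗ c n := by simp [← Functor.map_comp]

end LeftInternalHom

section LeftInternalHom

universe u v x₁ y₁

variable {C : Type u} [Category.{v} C] [Abelian C] [MonoidalCategory C] [MonoidalPreadditive C]
  [RigidCategory C] {N : Type x₁} [Category.{y₁} N] [Abelian N] [MonoidalLeftAction C N]
  {n : N}

lemma projective_actionLeft (hn : Projective n) (c : C) : Projective (c ⊙ₗ n) :=
  (leftActionAdjunction N (ᘁc : C) c).map_projective n hn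

namespace LeftInternalHom

variable {R : N ⥤ C} (adj : MonoidalLeftAction.actionRight C n ⊣ R)

-- As for right module categories: `R y ⊙ n` is projective, so the evaluation lifts through an
-- epimorphism and transposes to a section.
include adj in
lemma preservesFiniteColimits_of_projective [R.Additive] (hn : Projective n) :
    PreservesFiniteColimits R := by
  have := adj.rightAdjoint_preservesLimits.{0, 0}
  have : PreservesFiniteLimits R := PreservesLimitsOfSize.preservesFiniteLimits _
  have : R.PreservesEpimorphisms :=
    { preserves {x y} f _ := by
        have := projective_actionLeft hn (R.obj y)
        have h : curry adj (Projective.factorThru (ev adj y) f) ≫ R.map f = 𝟙 _ :=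
          hom_ext adj (by simp)
        exact (SplitEpi.mk _ h).epi }
  have : R.PreservesHomology := Functor.preservesHomology_of_preservesEpis_and_kernels R
  exact Functor.preservesFiniteColimits_of_preservesHomology R

include adj in
lemma faithful_of_isProgenerator (hn : IsProgenerator n) : R.Faithful where
  map_injective {x y} f g h := by
    refine hn.hom_ext fun p => ?_
    have h1 : p = (λₗ n).inv ≫ curry adj ((λₗ n).hom ≫ p) ⊵ₗ n ≫ ev adj x := by simp
    rw [h1]
    simp only [Category.assoc]
    rw [← map_ev, ← map_ev, h]

end LeftInternalHom

end LeftInternalHom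

/-! ### Linear functors on underlying objects -/

section Comparison

universe u v x₁ y₁ x₂ y₂

open Functor

variable {C : Type u} [Category.{v} C] [MonoidalCategory C]

section

variable {M : Type x₁} [Category.{y₁} M] [MonoidalRightAction C M] {A : Mon C}
  (P : M ⥤ Mod C A.X) [P.RightLinear C]

/-- The comparison isomorphism of a linear functor to the category of modules. -/
def modDelta (x : M) (c : C) : (P.obj (x ⊙ᵣ c)).X ≅ (P.obj x).X ⊗ c :=
  (Mod.forget A.X).mapIso (RightLinear.μᵣIso P x c).symm

/-- These lemmas read the axioms of module functors on underlying objects of `C`, where they can be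
used for rewriting. -/
lemma modDelta_naturality_left {x x' : M} (f : x ⟶ x') (c : C) :
    (P.map (f ⊵ᵣ c)).hom ≫ (modDelta P x' c).hom = (modDelta P x c).hom ≫ (P.map f).hom ▷ c :=
  congrArg Mod.Hom.hom (OplaxRightLinear.δᵣ_naturality_left P f c)

lemma modDelta_naturality_right (x : M) {c c' : C} (f : c ⟶ c') :
    (P.map (x ⊴ᵣ f)).hom ≫ (modDelta P x c').hom = (modDelta P x c).hom ≫ (P.obj x).X ◁ f :=
  congrArg Mod.Hom.hom (OplaxRightLinear.δᵣ_naturality_right P x f)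

lemma modDelta_associativity (x : M) (c c' : C) :
    (P.map (αᵣ x c c').inv).hom ≫ (modDelta P x (c ⊗ c')).hom =
      (modDelta P (x ⊙ᵣ c) c').hom ≫ (modDelta P x c).hom ▷ c' ≫ (α_ (P.obj x).X c c').hom := by
  have h : (modDelta P x (c ⊗ c')).hom ≫ (α_ (P.obj x).X c c').inv =
      (P.map (αᵣ x c c').hom).hom ≫ (modDelta P (x ⊙ᵣ c) c').hom ≫ (modDelta P x c).hom ▷ c' :=
    congrArg Mod.Hom.hom (OplaxRightLinear.δᵣ_associativity P x c c')
  have h' : (P.map (αᵣ x c c').inv).hom ≫ (P.map (αᵣ x c c').hom).hom = 𝟙 _ :=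
    congrArg Mod.Hom.hom (((P.map_comp _ _).symm.trans
      (congrArg P.map (αᵣ x c c').inv_hom_id)).trans (P.map_id _))
  rw [← cancel_mono (α_ (P.obj x).X c c').inv, Category.assoc, h, reassoc_of% h']
  simp

end

variable {N : Type x₂} [Category.{y₂} N] [MonoidalLeftAction C N] (S : N ⥤ C) [S.LeftLinear C]

/-- The comparison isomorphism of a linear functor to the acting category. -/
def tensorMu (c : C) (n : N) : c ⊗ S.obj n ≅ S.obj (c ⊙ₗ n) := LeftLinear.μₗIso S c n

lemma tensorMu_naturality_left {c c' : C} (f : c ⟶ c') (n : N) :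
    f ▷ S.obj n ≫ (tensorMu S c' n).hom = (tensorMu S c n).hom ≫ S.map (f ⊵ₗ n) :=
  LaxLeftLinear.μₗ_naturality_left S f n

lemma tensorMu_naturality_right (c : C) {n n' : N} (g : n ⟶ n') :
    c ◁ S.map g ≫ (tensorMu S c n').hom = (tensorMu S c n).hom ≫ S.map (c ⊴ₗ g) :=
  LaxLeftLinear.μₗ_naturality_right S c g

lemma tensorMu_associativity (c c' : C) (n : N) :
    (tensorMu S (c ⊗ c') n).hom ≫ S.map (αₗ c c' n).hom =
      (α_ c c' (S.obj n)).hom ≫ c ◁ (tensorMu S c' n).hom ≫ (tensorMu S c (c' ⊙ₗ n)).hom :=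
  LaxLeftLinear.μₗ_associativity S c c' n

end Comparison

/-! ### The functors induced by `(x, n) ↦ x ⊙ S n` -/

section Induced

universe w' u v x₁ y₁ x₂ y₂ x₃ y₃ x₄ y₄ x₅ y₅ u₆ v₆

open ModIn Functor

variable {k : Type w'} [Field k] {C : Type u} [Category.{v} C] [Abelian C] [Linear k C]
  [MonoidalCategory C] [MonoidalPreadditive C] [MonoidalLinear k C] [RigidCategory C]
  {M : Type x₁} [Category.{y₁} M] [Abelian M] [Linear k M] [MonoidalRightAction C M]
  [LinearRightAction k C M] (hM : RightActionRightExact C M)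
  {N : Type x₂} [Category.{y₂} N] [Abelian N] [Linear k N] [MonoidalLeftAction C N]
  [LinearLeftAction k C N] (hN : LeftActionRightExact C N) {A : Mon C} (P : M ⥤ Mod C A.X)
  [P.IsEquivalence] [P.Additive] [P.Linear k] [P.RightLinear C]
  {T : Type x₃} [Category.{y₃} T] [Abelian T] [Linear k T]
  (S : N ⥤ C) [S.LeftLinear C] [S.Additive] [S.Linear k] [PreservesFiniteColimits S]

instance : (modForget A).Linear k where

/-- The comparison between acting by `S n` and applying `S` to an action. -/
def actModelIso : (actBalanced k M S hM).postcomp (.comp (.mk P) (.mk (modForget A))) ≅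
    (modelBalanced hN P).postcomp (.comp (.mk (forget A.X N)) (.mk S)) :=
  BalancedFunctor.isoMk
    -- `P (x ⊙ S n) ≅ P x ⊗ S n ≅ S (P x ⊙ n)`, from the module structures of `P` and of `S`.
    (fun x n => modDelta P x (S.obj n) ≪≫ tensorMu S (P.obj x).X n)
    (fun {x x'} f n => by
      change (P.map (f ⊵ᵣ S.obj n)).hom ≫ (modDelta P x' (S.obj n)).hom ≫
        (tensorMu S (P.obj x').X n).hom = ((modDelta P x (S.obj n)).hom ≫
          (tensorMu S (P.obj x).X n).hom) ≫ S.map ((P.map f).hom ⊵ₗ n)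
      rw [reassoc_of% modDelta_naturality_left P f (S.obj n), tensorMu_naturality_left,
        Category.assoc])
    (fun x {n n'} g => by
      change (P.map (x ⊴ᵣ S.map g)).hom ≫ (modDelta P x (S.obj n')).hom ≫
        (tensorMu S (P.obj x).X n').hom = ((modDelta P x (S.obj n)).hom ≫
          (tensorMu S (P.obj x).X n).hom) ≫ S.map ((P.obj x).X ⊴ₗ g)
      rw [reassoc_of% modDelta_naturality_right P x (S.map g), tensorMu_naturality_right,
        Category.assoc])
    (fun x c n => by
      have h : (P.map ((αᵣ x c (S.obj n)).inv ≫ x ⊴ᵣ (tensorMu S c n).hom)).hom =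
          (P.map (αᵣ x c (S.obj n)).inv).hom ≫ (P.map (x ⊴ᵣ (tensorMu S c n).hom)).hom :=
        congrArg Mod.Hom.hom (P.map_comp _ _)
      change (P.map ((αᵣ x c (S.obj n)).inv ≫ x ⊴ᵣ (tensorMu S c n).hom)).hom ≫
        (modDelta P x (S.obj (c ⊙ₗ n))).hom ≫ (tensorMu S (P.obj x).X (c ⊙ₗ n)).hom =
        ((modDelta P (x ⊙ᵣ c) (S.obj n)).hom ≫ (tensorMu S (P.obj (x ⊙ᵣ c)).X n).hom) ≫
            S.map ((modDelta P x c).hom ⊵ₗ n ≫ (αₗ (P.obj x).X c n).hom)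
      rw [h, Category.assoc, reassoc_of% modDelta_naturality_right P x (tensorMu S c n).hom,
        reassoc_of% modDelta_associativity P x c (S.obj n), Functor.map_comp, Category.assoc,
        ← reassoc_of% tensorMu_naturality_left S (modDelta P x c).hom n, tensorMu_associativity])

end Induced

section Induced

universe w' u v x₁ y₁ x₂ y₂ x₃ y₃

open ModIn Functor BalancedFunctor

variable {k : Type w'} [Field k] {C : Type u} [Category.{v} C] [Abelian C] [Linear k C]
  [MonoidalCategory C] [MonoidalPreadditive C] [MonoidalLinear k C] [RigidCategory C]
  {M : Type x₁} [Category.{y₁} M] [Abelian M] [Linear k M] [MonoidalRightAction C M]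
  [LinearRightAction k C M] {hM : RightActionRightExact C M}
  {N : Type x₂} [Category.{y₂} N] [Abelian N] [Linear k N] [MonoidalLeftAction C N]
  [LinearLeftAction k C N] {hN : LeftActionRightExact C N} {A : Mon C} {P : M ⥤ Mod C A.X}
  [P.IsEquivalence] [P.Additive] [P.Linear k] [P.RightLinear C]
  {T : Type x₃} [Category.{y₃} T] [Abelian T] [Linear k T]
  {S : N ⥤ C} [S.LeftLinear C] [S.Additive] [S.Linear k] [PreservesFiniteColimits S]
  {box : BalancedFunctor k C M N T} [(box.restriction C).IsEquivalence]
  {E : RightExactLinearFunctor k T (ModIn A.X N)} [E.obj.IsEquivalence]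
  (e : box.postcomp E ≅ modelBalanced hN P)
  {W : RightExactLinearFunctor k T M} (i : box.postcomp W ≅ actBalanced k M S hM)

/-- The comparison between the functor induced by `(x, n) ↦ x ⊙ S n` and the functor `S` on
underlying objects. -/
noncomputable def inducedModelIso : W.obj ⋙ P ⋙ modForget A ≅ E.obj ⋙ forget A.X N ⋙ S :=
  RightExactLinearFunctor.isoObj (G := W.comp (.comp (.mk P) (.mk (modForget A))))
    (H := E.comp (.comp (.mk (forget A.X N)) (.mk S)))
    -- Both sides are right exact linear functors from `T` to `C`, so comparing their restrictions
    -- along `box` suffices.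
    ((box.restriction C).preimageIso
      ((postcompComp box W (.comp (.mk P) (.mk (modForget A)))).symm ≪≫
        (postcompFunctor (.comp (.mk P) (.mk (modForget A)))).mapIso i ≪≫
        actModelIso hM hN P S ≪≫
        (postcompFunctor (.comp (.mk (forget A.X N)) (.mk S))).mapIso e.symm ≪≫
        postcompComp box E (.comp (.mk (forget A.X N)) (.mk S))))

-- `P` followed by the forgetful functor is left exact and reflects isomorphisms. So left exactness
-- of `W` can be read off from `inducedModelIso`, whose other side is `S` after left exact functors.
include e i in
lemma preservesFiniteLimits_induced [PreservesFiniteLimits S] : PreservesFiniteLimits W.obj := by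
  have : PreservesFiniteLimits (forget A.X N ⋙ S) := comp_preservesFiniteLimits _ _
  have : PreservesFiniteLimits (E.obj ⋙ forget A.X N ⋙ S) := comp_preservesFiniteLimits _ _
  have : PreservesFiniteLimits (W.obj ⋙ P ⋙ modForget A) :=
    ⟨fun J _ _ => preservesLimitsOfShape_of_natIso (inducedModelIso e i).symm⟩
  have : PreservesFiniteLimits (P ⋙ modForget A) := comp_preservesFiniteLimits _ _
  exact ⟨fun J _ _ => preservesLimitsOfShape_of_reflects_of_preserves _ (P ⋙ modForget A)⟩

include e i in
lemma faithful_induced [S.Faithful] : W.obj.Faithful := by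
  have : (W.obj ⋙ P ⋙ modForget A).Faithful := Faithful.of_iso (inducedModelIso e i).symm
  exact Faithful.of_comp W.obj (P ⋙ modForget A)

end Induced

/-! ### Functors induced by a pair of module functors -/

section Functoriality

universe w' u v x₁ y₁ x₂ y₂ x₃ y₃ x₄ y₄ x₅ y₅ u₆ v₆

open ModIn Functor BalancedFunctor

variable {k : Type w'} [Field k] {C : Type u} [Category.{v} C] [Abelian C] [Linear k C]
  [MonoidalCategory C] [MonoidalPreadditive C] [MonoidalLinear k C] [RigidCategory C]
  {M : Type x₁} [Category.{y₁} M] [Abelian M] [Linear k M] [MonoidalRightAction C M]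
  [LinearRightAction k C M] (hM : RightActionRightExact C M)
  {N : Type x₂} [Category.{y₂} N] [Abelian N] [Linear k N] [MonoidalLeftAction C N]
  {M' : Type x₃} [Category.{y₃} M'] [Abelian M'] [Linear k M'] [MonoidalRightAction C M']
  [LinearRightAction k C M'] (hM' : RightActionRightExact C M')
  {N' : Type x₄} [Category.{y₄} N'] [Abelian N'] [Linear k N'] [MonoidalLeftAction C N']
  (F₀ : M ⥤ M') [F₀.Additive] [F₀.Linear k] [PreservesFiniteColimits F₀] [F₀.RightLinear C]
  (F₁ : N ⥤ N') [F₁.Additive] [F₁.Linear k] [PreservesFiniteColimits F₁] [F₁.LeftLinear C]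
  (S : N' ⥤ C) [S.LeftLinear C] [S.Additive] [S.Linear k] [PreservesFiniteColimits S]
  [PreservesFiniteColimits (F₁ ⋙ S)]

/-- Compatibility of the action of `S n` with module functors. -/
def precompActIso : letI := compLeftLinear (C := C) F₁ S
    (actBalanced k M' S hM').precomp F₀ F₁ ≅ (actBalanced k M (F₁ ⋙ S) hM).postcomp (.mk F₀) :=
  letI := compLeftLinear (C := C) F₁ S
  isoMk (fun x n => (RightLinear.μᵣIso F₀ x (S.obj (F₁.obj n))))
    (fun {x x'} f n => LaxRightLinear.μᵣ_naturality_left F₀ f (S.obj (F₁.obj n)))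
    (fun x {n n'} g => LaxRightLinear.μᵣ_naturality_right F₀ x (S.map (F₁.map g)))
    (fun x c n => by
      have h1 := LaxRightLinear.μᵣ_associativity F₀ x c (S.obj (F₁.obj n))
      have h2 : F₀.obj x ⊴ᵣ (tensorMu S c (F₁.obj n)).hom ≫
          LaxRightLinear.μᵣ F₀ x (S.obj (c ⊙ₗ F₁.obj n)) =
            LaxRightLinear.μᵣ F₀ x (c ⊗ S.obj (F₁.obj n)) ≫
              F₀.map (x ⊴ᵣ (tensorMu S c (F₁.obj n)).hom) :=
        LaxRightLinear.μᵣ_naturality_right F₀ x ((tensorMu S c (F₁.obj n)).hom)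
      have h3 := LaxRightLinear.μᵣ_naturality_right F₀ x (S.map (LaxLeftLinear.μₗ F₁ c n))
      change (OplaxRightLinear.δᵣ F₀ x c ⊵ᵣ S.obj (F₁.obj n) ≫
        ((αᵣ (F₀.obj x) c (S.obj (F₁.obj n))).inv ≫
          F₀.obj x ⊴ᵣ (tensorMu S c (F₁.obj n)).hom) ≫
            F₀.obj x ⊴ᵣ S.map (LaxLeftLinear.μₗ F₁ c n)) ≫
              LaxRightLinear.μᵣ F₀ x (S.obj (F₁.obj (c ⊙ₗ n))) =
        LaxRightLinear.μᵣ F₀ (x ⊙ᵣ c) (S.obj (F₁.obj n)) ≫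
          F₀.map ((αᵣ x c (S.obj (F₁.obj n))).inv ≫ x ⊴ᵣ ((tensorMu S c (F₁.obj n)).hom ≫
            S.map (LaxLeftLinear.μₗ F₁ c n)))
      have h4 : LaxRightLinear.μᵣ F₀ (x ⊙ᵣ c) (S.obj (F₁.obj n)) ≫
          F₀.map (αᵣ x c (S.obj (F₁.obj n))).inv =
            OplaxRightLinear.δᵣ F₀ x c ⊵ᵣ S.obj (F₁.obj n) ≫
              (αᵣ (F₀.obj x) c (S.obj (F₁.obj n))).inv ≫
                LaxRightLinear.μᵣ F₀ x (c ⊗ S.obj (F₁.obj n)) := by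
        rw [← cancel_mono (F₀.map (αᵣ x c (S.obj (F₁.obj n))).hom), Category.assoc, Category.assoc,
          Category.assoc, h1]
        simp [← Functor.map_comp, ← MonoidalRightAction.comp_actionHomLeft_assoc]
      rw [Functor.map_comp, reassoc_of% h4, MonoidalRightAction.actionHomRight_comp,
        Functor.map_comp, ← reassoc_of% h2]
      simp only [Category.assoc]
      congr 3)

variable {hM} {hM'} {T : Type x₅} [Category.{y₅} T] [Abelian T] [Linear k T]
  {box : BalancedFunctor k C M N T} [(box.restriction M').IsEquivalence]
  {T' : Type u₆} [Category.{v₆} T'] [Abelian T'] [Linear k T']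
  {box' : BalancedFunctor k C M' N' T'} {G : RightExactLinearFunctor k T T'}
  (g : box.postcomp G ≅ box'.precomp F₀ F₁)
  {W' : RightExactLinearFunctor k T' M'} (i' : box'.postcomp W' ≅ actBalanced k M' S hM')
  {W : RightExactLinearFunctor k T M}
  (i : letI := compLeftLinear (C := C) F₁ S; box.postcomp W ≅ actBalanced k M (F₁ ⋙ S) hM)

/-- Precomposition with a pair of module functors preserves isomorphisms. -/
def precompMapIso {D : Type x₅} [Category.{y₅} D] [Preadditive D] [Linear k D]
    {B B' : BalancedFunctor k C M' N' D} (e : B ≅ B') : B.precomp F₀ F₁ ≅ B'.precomp F₀ F₁ :=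
  isoMk (fun x n => ((isoFunctor e).app (F₀.obj x)).app (F₁.obj n))
    (fun f n => congrArg (fun t => t.app (F₁.obj n)) (e.hom.trans.naturality (F₀.map f)))
    (fun x {n n'} g => (e.hom.trans.app (F₀.obj x)).naturality (F₁.map g))
    (fun x c n => by
      have h := e.hom.compatible (F₀.obj x) c (F₁.obj n)
      have h' := congrArg (fun t => t.app (F₁.obj n))
        (e.hom.trans.naturality (OplaxRightLinear.δᵣ F₀ x c))
      have h'' := (e.hom.trans.app (F₀.obj x)).naturality (LaxLeftLinear.μₗ F₁ c n)
      change ((B.functor.map (OplaxRightLinear.δᵣ F₀ x c)).app (F₁.obj n) ≫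
        (B.balancing.iso (F₀.obj x) c (F₁.obj n)).hom ≫
          (B.functor.obj (F₀.obj x)).map (LaxLeftLinear.μₗ F₁ c n)) ≫
            (e.hom.trans.app (F₀.obj x)).app (F₁.obj (c ⊙ₗ n)) =
        (e.hom.trans.app (F₀.obj (x ⊙ᵣ c))).app (F₁.obj n) ≫
          (B'.functor.map (OplaxRightLinear.δᵣ F₀ x c)).app (F₁.obj n) ≫
            (B'.balancing.iso (F₀.obj x) c (F₁.obj n)).hom ≫
              (B'.functor.obj (F₀.obj x)).map (LaxLeftLinear.μₗ F₁ c n)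
      simp only [NatTrans.comp_app] at h'
      rw [Category.assoc, Category.assoc, h'', reassoc_of% h, reassoc_of% h'])

/-- Precomposition is compatible with postcomposition. -/
def precompPostcomp {D : Type x₅} [Category.{y₅} D] [Preadditive D] [Linear k D]
    (B : BalancedFunctor k C M' N' T') (G : RightExactLinearFunctor k T' D) :
    (B.precomp F₀ F₁).postcomp G ≅ (B.postcomp G).precomp F₀ F₁ :=
  isoMk (fun _ _ => Iso.refl _)
    (fun _ _ => (Category.comp_id _).trans (Category.id_comp _).symm)
    (fun _ {_ _} _ => (Category.comp_id _).trans (Category.id_comp _).symm)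
    (fun _ _ _ => (Category.comp_id _).trans
      (((G.obj.map_comp _ _).trans (congrArg _ (G.obj.map_comp _ _))).trans
        (Category.id_comp _).symm))

/-- The functors induced by module functors are compatible with the functors induced by
`(x, n) ↦ x ⊙ S n`. -/
noncomputable def inducedSquareIso : G.obj ⋙ W'.obj ≅ W.obj ⋙ F₀ :=
  letI := compLeftLinear (C := C) F₁ S
  RightExactLinearFunctor.isoObj (G := G.comp W') (H := W.comp (.mk F₀))
    -- Restricted along `box`, both sides are `(x, n) ↦ F₀ x ⊙ S (F₁ n)` up to the module structure
    -- of `F₀`.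
    ((box.restriction M').preimageIso
      ((postcompComp box G W').symm ≪≫ (postcompFunctor W').mapIso g ≪≫
        precompPostcomp F₀ F₁ box' W' ≪≫ precompMapIso F₀ F₁ i' ≪≫
        precompActIso hM hM' F₀ F₁ S ≪≫ (postcompFunctor (.mk F₀)).mapIso i.symm ≪≫
        postcompComp box W (.mk F₀)))

-- `W'` is left exact and, being faithful, reflects isomorphisms. So `G` is left exact as soon as `G
-- ⋙ W'` is, and this is `W ⋙ F₀` by `inducedSquareIso`.
include g i' i in
lemma preservesFiniteLimits_of_induced [PreservesFiniteLimits F₀] [PreservesFiniteLimits W.obj]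
    [PreservesFiniteLimits W'.obj] [W'.obj.Faithful] : PreservesFiniteLimits G.obj := by
  have : W'.obj.ReflectsIsomorphisms :=
    reflectsIsomorphisms_of_reflectsMonomorphisms_of_reflectsEpimorphisms W'.obj
  have : PreservesFiniteLimits (W.obj ⋙ F₀) := comp_preservesFiniteLimits _ _
  have : PreservesFiniteLimits (G.obj ⋙ W'.obj) :=
    ⟨fun J _ _ => preservesLimitsOfShape_of_natIso (inducedSquareIso F₀ F₁ S g i' i).symm⟩
  exact ⟨fun J _ _ => preservesLimitsOfShape_of_reflects_of_preserves _ W'.obj⟩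

end Functoriality

/-! ### Module objects in a category of right modules are bimodules -/

section Bimodules

universe w' u v x₁ y₁ x₂ y₂

open Functor

variable {C : Type u} [Category.{v} C] [MonoidalCategory C] {A B : Mon C}

/-- The forgetful functor on right module objects. -/
def RightMod.forget (B : Mon C) : RightMod B ⥤ C where
  obj N := N.X
  map f := f.hom

variable {N : Type x₂} [Category.{y₂} N] [MonoidalLeftAction C N] (Q : N ⥤ RightMod B)
  [Q.LeftLinear C]

/-- The comparison isomorphism of a linear functor to the category of right modules. -/
def rightModMu (c : C) (n : N) : c ⊗ (Q.obj n).X ≅ (Q.obj (c ⊙ₗ n)).X :=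
  (RightMod.forget B).mapIso (LeftLinear.μₗIso Q c n)

lemma rightModMu_act (c : C) (n : N) :
    (rightModMu Q c n).hom ▷ B.X ≫ (Q.obj (c ⊙ₗ n)).act =
      (α_ c (Q.obj n).X B.X).hom ≫ c ◁ (Q.obj n).act ≫ (rightModMu Q c n).hom :=
  (LaxLeftLinear.μₗ Q c n).act_hom.symm.trans (Category.assoc _ _ _)

lemma rightModMu_naturality_left {c c' : C} (f : c ⟶ c') (n : N) :
    f ▷ (Q.obj n).X ≫ (rightModMu Q c' n).hom = (rightModMu Q c n).hom ≫ (Q.map (f ⊵ₗ n)).hom :=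
  congrArg RightMod.Hom.hom (LaxLeftLinear.μₗ_naturality_left Q f n)

lemma rightModMu_naturality_right (c : C) {n n' : N} (g : n ⟶ n') :
    c ◁ (Q.map g).hom ≫ (rightModMu Q c n').hom = (rightModMu Q c n).hom ≫ (Q.map (c ⊴ₗ g)).hom :=
  congrArg RightMod.Hom.hom (LaxLeftLinear.μₗ_naturality_right Q c g)

lemma rightModMu_associativity (c c' : C) (n : N) :
    (rightModMu Q (c ⊗ c') n).hom ≫ (Q.map (αₗ c c' n).hom).hom =
      (α_ c c' (Q.obj n).X).hom ≫ c ◁ (rightModMu Q c' n).hom ≫ (rightModMu Q c (c' ⊙ₗ n)).hom :=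
  congrArg RightMod.Hom.hom (LaxLeftLinear.μₗ_associativity Q c c' n)

lemma rightModMu_unitality (n : N) :
    (rightModMu Q (𝟙_ C) n).hom ≫ (Q.map (λₗ[C] n).hom).hom = (λ_ (Q.obj n).X).hom :=
  (congrArg RightMod.Hom.hom (LaxLeftLinear.μₗ_unitality (C := C) Q n)).symm

lemma map_comp_hom {n n' n'' : N} (f : n ⟶ n') (g : n' ⟶ n'') :
    (Q.map (f ≫ g)).hom = (Q.map f).hom ≫ (Q.map g).hom :=
  congrArg RightMod.Hom.hom (Q.map_comp f g)

/-- The bimodule object associated to a module object. -/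
def modInBimodObj (X : ModIn A.X N) : Bimod A B where
  X := (Q.obj X.X).X
  actLeft := (rightModMu Q A.X X.X).hom ≫ (Q.map X.act).hom
  one_actLeft := by
    rw [reassoc_of% rightModMu_naturality_left Q, ← map_comp_hom, X.one_act, rightModMu_unitality]
  left_assoc := by
    rw [reassoc_of% rightModMu_naturality_left Q, ← map_comp_hom, X.mul_act, map_comp_hom,
      reassoc_of% rightModMu_associativity Q, map_comp_hom,
      ← reassoc_of% rightModMu_naturality_right Q]
    simp only [MonoidalCategory.whiskerLeft_comp, Category.assoc]
  actRight := (Q.obj X.X).act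
  actRight_one := (Q.obj X.X).act_one
  right_assoc := (Q.obj X.X).act_mul
  middle_assoc := by
    have h := (Q.map X.act).act_hom
    rw [comp_whiskerRight, Category.assoc, ← h, reassoc_of% rightModMu_act Q]

/-- The functor from module objects to bimodule objects. -/
def modInBimod : ModIn A.X N ⥤ Bimod A B where
  obj X := modInBimodObj Q X
  map {X Y} f :=
    { hom := (Q.map f.hom).hom
      left_act_hom := by
        change ((rightModMu Q A.X X.X).hom ≫ (Q.map X.act).hom) ≫ (Q.map f.hom).hom =
          A.X ◁ (Q.map f.hom).hom ≫ (rightModMu Q A.X Y.X).hom ≫ (Q.map Y.act).hom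
        rw [Category.assoc, ← map_comp_hom, f.act_hom, map_comp_hom,
          reassoc_of% rightModMu_naturality_right Q]
      right_act_hom := (Q.map f.hom).act_hom }
  map_id X := Bimod.hom_ext _ _ (congrArg RightMod.Hom.hom (Q.map_id X.X))
  map_comp f g := Bimod.hom_ext _ _ (map_comp_hom Q f.hom g.hom)

/-- A left `A`-action commuting with a right `B`-action is an `A`-action by morphisms of right
`B`-modules, hence an `A`-action in `N`. -/
instance [Q.IsEquivalence] : (modInBimod (A := A) Q).IsEquivalence where
  faithful := ⟨fun {X Y} f g h => ModIn.hom_ext _ _ (Q.map_injective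
    (RightMod.hom_ext _ _ (congrArg Bimod.Hom.hom h)))⟩
  full := ⟨fun {X Y} f => by
    let f' : Q.obj X.X ⟶ Q.obj Y.X := ⟨f.hom, f.right_act_hom⟩
    obtain ⟨g, hg⟩ := Q.map_surjective f'
    have hg' : (Q.map g).hom = f.hom := congrArg RightMod.Hom.hom hg
    have hf : ((rightModMu Q A.X X.X).hom ≫ (Q.map X.act).hom) ≫ (Q.map g).hom =
          A.X ◁ (Q.map g).hom ≫ (rightModMu Q A.X Y.X).hom ≫ (Q.map Y.act).hom := by
      rw [hg']
      exact f.left_act_hom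
    refine ⟨⟨g, Q.map_injective (RightMod.hom_ext _ _ ?_)⟩, Bimod.hom_ext _ _ hg'⟩
    rw [reassoc_of% rightModMu_naturality_right Q, Category.assoc, cancel_epi] at hf
    rw [map_comp_hom, map_comp_hom, hf]⟩
  essSurj := ⟨fun Y => by
    let Y' : RightMod B := ⟨Y.X, Y.actRight, Y.actRight_one, Y.right_assoc⟩
    let n := Q.objPreimage Y'
    let e : Q.obj n ≅ Y' := Q.objObjPreimageIso Y'
    let eX : (Q.obj n).X ≅ Y.X := (RightMod.forget B).mapIso e
    have he : (Q.obj n).act ≫ eX.hom = eX.hom ▷ B.X ≫ Y.actRight := e.hom.act_hom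
    have he' : eX.inv ▷ B.X ≫ (Q.obj n).act = Y.actRight ≫ eX.inv := e.inv.act_hom.symm
    -- The left action of `Y`, transported to the chosen preimage; `middle_assoc` is what makes it a
    -- morphism of right `B`-modules, so that it comes from `N`.
    let a' : A.X ⊙ₗ Q.obj n ⟶ Q.obj n :=
      ⟨A.X ◁ eX.hom ≫ Y.actLeft ≫ eX.inv, by
        change ((α_ A.X (Q.obj n).X B.X).hom ≫ A.X ◁ (Q.obj n).act) ≫ A.X ◁ eX.hom ≫ Y.actLeft ≫
          eX.inv = (A.X ◁ eX.hom ≫ Y.actLeft ≫ eX.inv) ▷ B.X ≫ (Q.obj n).act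
        have h := congrArg (fun t => A.X ◁ t) he
        simp only [MonoidalCategory.whiskerLeft_comp] at h
        simp only [comp_whiskerRight, Category.assoc]
        rw [he', reassoc_of% h, reassoc_of% Y.middle_assoc]
        simp⟩
    obtain ⟨a, ha⟩ := Q.map_surjective (OplaxLeftLinear.δₗ Q A.X n ≫ a')
    have ha' : (rightModMu Q A.X n).hom ≫ (Q.map a).hom = A.X ◁ eX.hom ≫ Y.actLeft ≫ eX.inv := by
      rw [ha]
      exact congrArg RightMod.Hom.hom (LeftLinear.μₗ_comp_δₗ_assoc Q A.X n a')
    let X : ModIn A.X N :=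
      { X := n
        act := a
        one_act := Q.map_injective (RightMod.hom_ext _ _ (by
          rw [← cancel_epi (rightModMu Q (𝟙_ C) n).hom, map_comp_hom,
            ← reassoc_of% rightModMu_naturality_left Q, ha', rightModMu_unitality,
            ← whisker_exchange_assoc, reassoc_of% Y.one_actLeft]
          simp))
        mul_act := Q.map_injective (RightMod.hom_ext _ _ (by
          rw [← cancel_epi (rightModMu Q (A.X ⊗ A.X) n).hom, map_comp_hom,
            ← reassoc_of% rightModMu_naturality_left Q, ha', map_comp_hom,
            reassoc_of% rightModMu_associativity Q, map_comp_hom,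
            ← reassoc_of% rightModMu_naturality_right Q, ha', ← whisker_exchange_assoc,
            reassoc_of% Y.left_assoc]
          have h := congrArg (fun t => A.X ◁ t) ha'
          simp only [MonoidalCategory.whiskerLeft_comp] at h
          rw [reassoc_of% h]
          simp)) }
    exact ⟨X, ⟨Bimod.isoOfIso (P := (modInBimod Q).obj X) (Q := Y) eX (by
      change ((rightModMu Q A.X n).hom ≫ (Q.map a).hom) ≫ eX.hom = A.X ◁ eX.hom ≫ Y.actLeft
      rw [ha']
      simp) he⟩⟩⟩

/-- The bimodule object associated to a module object of the form `x ⊙ n`. -/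
def modInBimodBoxIso (x : Mod C A.X) (n : N) :
    ((tensorBimod A B).obj x).obj (Q.obj n) ≅ (modInBimod Q).obj (((modBox A N).obj x).obj n) :=
  Bimod.isoOfIso (P := ((tensorBimod A B).obj x).obj (Q.obj n))
    (Q := (modInBimod Q).obj (((modBox A N).obj x).obj n)) (rightModMu Q x.X n)
    (by
      change ((α_ A.X x.X (Q.obj n).X).inv ≫ leftAct x ▷ (Q.obj n).X) ≫ (rightModMu Q x.X n).hom =
        A.X ◁ (rightModMu Q x.X n).hom ≫ (rightModMu Q A.X (x.X ⊙ₗ n)).hom ≫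
          (Q.map ((αₗ A.X x.X n).inv ≫ leftAct x ⊵ₗ n)).hom
      have h := rightModMu_associativity Q A.X x.X n
      have h' : (Q.map (αₗ A.X x.X n).hom).hom ≫ (Q.map (αₗ A.X x.X n).inv).hom = 𝟙 _ := by
        rw [← map_comp_hom, Iso.hom_inv_id]
        exact congrArg RightMod.Hom.hom (Q.map_id _)
      rw [Category.assoc, rightModMu_naturality_left, map_comp_hom, Iso.inv_comp_eq,
        ← reassoc_of% h, reassoc_of% h'])
    (by
      change ((α_ x.X (Q.obj n).X B.X).hom ≫ x.X ◁ (Q.obj n).act) ≫ (rightModMu Q x.X n).hom =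
        (rightModMu Q x.X n).hom ▷ B.X ≫ (Q.obj (x.X ⊙ₗ n)).act
      rw [rightModMu_act, Category.assoc])

variable {M : Type x₁} [Category.{y₁} M] [MonoidalRightAction C M] (P : M ⥤ Mod C A.X)
  [P.RightLinear C]

/-- The functor `(x, n) ↦ x ⊙ n` corresponds to the tensor product of module objects. -/
def modInBimodIso :
    P ⋙ modBox A N ⋙ (whiskeringRight _ _ _).obj (modInBimod Q) ≅
      P ⋙ tensorBimod A B ⋙ (whiskeringLeft N (RightMod B) (Bimod A B)).obj Q :=
  NatIso.ofComponents
    (fun m => NatIso.ofComponents (fun n => (modInBimodBoxIso Q (P.obj m) n).symm)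
      (fun {n n'} g => by
        rw [Iso.symm_hom, Iso.symm_hom, Iso.comp_inv_eq, Category.assoc, Iso.eq_inv_comp]
        exact Bimod.hom_ext _ _ (rightModMu_naturality_right Q (P.obj m).X g).symm))
    (fun {m m'} f => by
      ext n : 2
      change _ ≫ (modInBimodBoxIso Q (P.obj m') n).inv = (modInBimodBoxIso Q (P.obj m) n).inv ≫ _
      rw [Iso.comp_inv_eq, Category.assoc, Iso.eq_inv_comp]
      exact Bimod.hom_ext _ _ (rightModMu_naturality_left Q (P.map f).hom n).symm)

/-- The balancing of `(x, n) ↦ x ⊙ n` corresponds to the associator. -/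
lemma compatible_modInBimodIso (β : Balancing C (P ⋙ modBox A N))
    (hβ : ∀ m c n, (β.iso m c n).hom = ((modBox A N).map (OplaxRightLinear.δᵣ P m c)).app n ≫
      ((modBoxBalancing A N).iso (P.obj m) c n).hom) :
    (β.postcomp (modInBimod Q)).Compatible ((tensorBimodBalancing A B).precomp P Q)
      (modInBimodIso Q P).hom := by
  intro m c n
  change (modInBimod Q).map (β.iso m c n).hom ≫ (modInBimodBoxIso Q (P.obj m) (c ⊙ₗ n)).inv =
    (modInBimodBoxIso Q (P.obj (m ⊙ᵣ c)) n).inv ≫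
      ((tensorBimod A B).map (OplaxRightLinear.δᵣ P m c)).app (Q.obj n) ≫
      ((tensorBimodBalancing A B).iso (P.obj m) c (Q.obj n)).hom ≫
      ((tensorBimod A B).obj (P.obj m)).map (LaxLeftLinear.μₗ Q c n)
  rw [Iso.comp_inv_eq, Category.assoc, Iso.eq_inv_comp, hβ]
  refine Bimod.hom_ext _ _ ?_
  change (rightModMu Q (P.obj (m ⊙ᵣ c)).X n).hom ≫
    (Q.map ((OplaxRightLinear.δᵣ P m c).hom ⊵ₗ n ≫ (αₗ (P.obj m).X c n).hom)).hom =
    ((OplaxRightLinear.δᵣ P m c).hom ▷ (Q.obj n).X ≫ (α_ (P.obj m).X c (Q.obj n).X).hom ≫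
      (P.obj m).X ◁ (rightModMu Q c n).hom) ≫ (rightModMu Q (P.obj m).X (c ⊙ₗ n)).hom
  have key (x y : C) (f : x ⟶ y ⊗ c) : (rightModMu Q x n).hom ≫
      (Q.map (f ⊵ₗ n ≫ (αₗ y c n).hom)).hom =
      (f ▷ (Q.obj n).X ≫ (α_ y c (Q.obj n).X).hom ≫ y ◁ (rightModMu Q c n).hom) ≫
        (rightModMu Q y (c ⊙ₗ n)).hom := by
    rw [map_comp_hom, ← reassoc_of% rightModMu_naturality_left Q, rightModMu_associativity]
    simp only [Category.assoc]
  exact key _ _ _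

end Bimodules

section BimoduleEquivalence

universe w' u v x₁ y₁ x₂ y₂ x₃ y₃ s s'

lemma Balancing.Compatible.comp {C : Type u} [Category.{v} C] [MonoidalCategory C]
    {M : Type x₁} [Category.{y₁} M] [MonoidalRightAction C M]
    {N : Type x₂} [Category.{y₂} N] [MonoidalLeftAction C N] {D : Type x₃} [Category.{y₃} D]
    {F G H : M ⥤ N ⥤ D} {β : Balancing C F} {γ : Balancing C G} {δ : Balancing C H} {η : F ⟶ G}
    {θ : G ⟶ H} (h : β.Compatible γ η) (h' : γ.Compatible δ θ) : β.Compatible δ (η ≫ θ) := by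
  intro m c n
  have h := h m c n
  have h' := h' m c n
  simp only [NatTrans.comp_app, Category.assoc]
  rw [← h', reassoc_of% h]

variable {k : Type w'} [Field k] {C : Type u} [Category.{v} C] [Abelian C] [Linear k C]
  [MonoidalCategory C] [MonoidalPreadditive C] [MonoidalLinear k C] [RigidCategory C]
  {A B : Mon C}
  {M : Type x₁} [Category.{y₁} M] [Abelian M] [Linear k M] [MonoidalRightAction C M]
  {N : Type x₂} [Category.{y₂} N] [Abelian N] [Linear k N] [MonoidalLeftAction C N]
  [LinearLeftAction k C N] (hN : LeftActionRightExact C N)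
  (P : M ⥤ Mod C A.X) [P.IsEquivalence] [P.Additive] [P.Linear k] [P.RightLinear C]
  (Q : N ⥤ RightMod B) [Q.IsEquivalence] [Q.Additive] [Q.Linear k] [Q.LeftLinear C]

instance : (modInBimod (A := A) Q).Additive where
  map_add {_ _ f g} := Bimod.hom_ext _ _
    (congrArg RightMod.Hom.hom (Q.map_add (f := f.hom) (g := g.hom)))

instance : (modInBimod (A := A) Q).Linear k where
  map_smul {_ _} f r := Bimod.hom_ext _ _ (congrArg RightMod.Hom.hom (Q.map_smul r f.hom))

include hN in
/-- A balanced tensor product of categories of modules is the category of bimodules. -/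
theorem exists_equivalence_bimod [FiniteLinear k N]
    {T : Type (max s v)} [Category.{max s' v} T] [Abelian T] [Linear k T]
    {box : BalancedFunctor k C M N T} (hbox : IsBalancedTensorProduct box) :
    ∃ E : T ⥤ Bimod A B, E.IsEquivalence ∧ E.Additive ∧ E.Linear k ∧
      ∃ θ : box.functor ⋙ (Functor.whiskeringRight N T (Bimod A B)).obj E ≅
          P ⋙ tensorBimod A B ⋙ (Functor.whiskeringLeft N (RightMod B) (Bimod A B)).obj Q,
        (box.balancing.postcomp E).Compatible
          ((tensorBimodBalancing A B).precomp P Q) θ.hom := by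
  obtain ⟨E, _, ⟨i⟩⟩ := exists_equivalence_modIn hN P hbox
  refine ⟨E.obj ⋙ modInBimod Q, inferInstance, inferInstance, inferInstance,
    Functor.isoWhiskerRight (BalancedFunctor.isoFunctor i)
      ((Functor.whiskeringRight N _ _).obj (modInBimod Q)) ≪≫ modInBimodIso Q P, ?_⟩
  refine Balancing.Compatible.comp (γ := (modelBalanced hN P).balancing.postcomp (modInBimod Q))
    (fun m c n => ?_) (compatible_modInBimodIso Q P _ (fun _ _ _ => rfl))
  have h := congrArg (modInBimod Q).map (i.hom.compatible m c n)
  simp only [Functor.map_comp] at h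
  exact h

end BimoduleEquivalence

/-! ### Existence of enriched homs -/

section EnrichedHom

universe w' u v x₁ y₁ x₂ y₂

open Functor

section

variable {X : Type u} [Category.{v} X] {Y : Type x₁} [Category.{y₁} Y] {Z : Type x₂}
  [Category.{y₂} Z] (F : X ⥤ Y ⥤ Z) (G : X → Z ⥤ Y) (adj : ∀ x, F.obj x ⊣ G x)

/-- Pointwise right adjoints of a functor of two variables form a functor of two variables. -/
def rightAdjoint₂ : Xᵒᵖ ⥤ Z ⥤ Y where
  obj x := G x.unop
  map {x y} f := conjugateEquiv (adj x.unop) (adj y.unop) (F.map f.unop)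
  map_id x := by simp
  map_comp f g := by simp [conjugateEquiv_comp]

/-- Pointwise right adjoints of a functor of two variables form a parametrized adjunction. -/
def parametrizedAdjunction : F ⊣₂ rightAdjoint₂ F G adj where
  adj := adj
  unit_whiskerRight_map {x y} f := by
    ext z
    exact unit_conjugateEquiv (adj y) (adj x) (F.map f) z |>.symm

lemma exists_parametrizedAdjunction (F : X ⥤ Y ⥤ Z) (h : ∀ x, (F.obj x).IsLeftAdjoint) :
    ∃ G, Nonempty (F ⊣₂ G) :=
  ⟨_, ⟨parametrizedAdjunction F _ fun x => Adjunction.ofIsLeftAdjoint (F.obj x)⟩⟩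

end

variable {k : Type w'} [Field k] {C : Type u} [Category.{v} C] [Abelian C] [Linear k C]
  [MonoidalCategory C] [FiniteLinear k C]

variable (k) in
lemma isLeftAdjoint_actionRight {N : Type x₁} [Category.{y₁} N] [Abelian N] [Linear k N]
    [MonoidalLeftAction C N] [h : LinearLeftAction k C N] [FiniteLinear k N]
    (hN : LeftActionRightExact C N) (n : N) :
    (MonoidalLeftAction.actionRight C n).IsLeftAdjoint := by
  have := h.additive_left n
  have := h.linear_left n
  have := hN n
  exact isLeftAdjoint_of_rightExact (k := k) (FiniteLinear.finite_hom) _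

end EnrichedHom

/-! ### From tensors of enriched homs to morphisms of the tensor product -/

section HomFormula

universe w' u v x₁ y₁ x₂ y₂ x₃ y₃

open Functor

section

variable {C : Type u} [Category.{v} C] [MonoidalCategory C]
  {M : Type x₁} [Category.{y₁} M] [MonoidalRightAction C M]

namespace InternalHom

variable {x : M} {R : M ⥤ C} (adj : MonoidalRightAction.actionLeft C x ⊣ R)

/-- The morphism `x ⟶ x' ⊙ c` corresponding to a morphism `𝟙 ⟶ R x' ⊗ c`. -/
def tensorUncurry {x' : M} {c : C} (f : 𝟙_ C ⟶ R.obj x' ⊗ c) : x ⟶ x' ⊙ᵣ c :=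
  (ρᵣ[C] x).inv ≫ x ⊴ᵣ f ≫ (αᵣ x (R.obj x') c).hom ≫ ev adj x' ⊵ᵣ c

/-- `Hom(1, R x' ⊗ c) ≅ Hom(1, R (x' ⊙ c)) ≅ Hom(x ⊙ 1, x' ⊙ c)`, by invertibility of `strength` and
the adjunction. -/
lemma tensorUncurry_bijective [LeftRigidCategory C] (x' : M) (c : C) :
    Function.Bijective (tensorUncurry adj (x' := x') (c := c)) := by
  constructor
  · intro f g h
    simp only [tensorUncurry, cancel_epi] at h
    rw [← cancel_mono (strength adj x' c)]
    exact hom_ext adj (by simpa using h)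
  · intro f
    refine ⟨curry adj ((ρᵣ x).hom ≫ f) ≫ inv (strength adj x' c), ?_⟩
    simp [tensorUncurry, ← strength_ev, ← MonoidalRightAction.actionHomRight_comp_assoc]

end InternalHom

/-- Dinaturality of the evaluation in the parameter of the adjunction. -/
lemma actionHomRight_enrichedHom_ev {H : Mᵒᵖ ⥤ M ⥤ C} (hH : RightEnrichedHom C M H)
    {x y : M} (f : x ⟶ y) (x' : M) : x ⊴ᵣ (H.map f.op).app x' ≫ InternalHom.ev (hH.adj x) x' =
      f ⊵ᵣ (H.obj (op y)).obj x' ≫ InternalHom.ev (hH.adj y) x' :=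
  (congrArg (fun t => t.app x') (hH.whiskerLeft_map_counit f)).symm

lemma tensorUncurry_naturality {H : Mᵒᵖ ⥤ M ⥤ C} (hH : RightEnrichedHom C M H) {x y : M}
    (f : x ⟶ y) {x' y' : M} (f' : y' ⟶ x') {c c' : C} (s : c ⟶ c')
    (u : 𝟙_ C ⟶ (H.obj (op y)).obj y' ⊗ c) :
    InternalHom.tensorUncurry (hH.adj x) (u ≫ (prodMap H f.op f' ⊗ₘ s)) =
      f ≫ InternalHom.tensorUncurry (hH.adj y) u ≫ f' ⊵ᵣ c ≫ x' ⊴ᵣ s := by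
  have h1 := actionHomRight_enrichedHom_ev hH f y'
  have h2 := InternalHom.map_ev (hH.adj x) f'
  have h3 : x ⊴ᵣ prodMap H f.op f' ≫ InternalHom.ev (hH.adj x) x' =
      f ⊵ᵣ (H.obj (op y)).obj y' ≫ InternalHom.ev (hH.adj y) y' ≫ f' := by
    rw [prodMap, MonoidalRightAction.actionHomRight_comp, Category.assoc, h2, reassoc_of% h1]
  have h4 := congrArg (fun t => t ⊵ᵣ c) h3
  simp only [MonoidalRightAction.comp_actionHomLeft] at h4
  simp only [InternalHom.tensorUncurry, MonoidalCategory.tensorHom_def,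
    MonoidalRightAction.actionHomRight_comp, Category.assoc]
  rw [actionHomRight_whiskerLeft_exchange]
  have h5 : f ≫ (ρᵣ[C] y).inv = (ρᵣ[C] x).inv ≫ f ⊵ᵣ 𝟙_ C := by
    rw [Iso.comp_inv_eq]
    simp
  rw [reassoc_of% h5, ← MonoidalRightAction.action_exchange_assoc f u]
  simp [reassoc_of% h4]

end

section

variable {C : Type u} [Category.{v} C] [MonoidalCategory C]
  {M : Type x₁} [Category.{y₁} M] [MonoidalRightAction C M]
  {N : Type x₂} [Category.{y₂} N] [MonoidalLeftAction C N]
  {T : Type x₃} [Category.{y₃} T] {F : M ⥤ N ⥤ T} (β : Balancing C F)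

lemma actionHomLeft_enrichedHom_ev {K : Nᵒᵖ ⥤ N ⥤ C} (hK : LeftEnrichedHom C N K)
    {x y : N} (f : x ⟶ y) (x' : N) : (K.map f.op).app x' ⊵ₗ x ≫ LeftInternalHom.ev (hK.adj x) x' =
      (K.obj (op y)).obj x' ⊴ₗ f ≫ LeftInternalHom.ev (hK.adj y) x' :=
  (congrArg (fun t => t.app x') (hK.whiskerLeft_map_counit f)).symm

namespace Balancing

section

variable {y : N} {S : N ⥤ C} (adj : MonoidalLeftAction.actionRight C y ⊣ S)

/-- The evaluation `F (x ⊙ S y', y) ⟶ F (x, y')`. -/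
def evalMap (x : M) (y' : N) : (F.obj (x ⊙ᵣ S.obj y')).obj y ⟶ (F.obj x).obj y' :=
  (β.iso x (S.obj y') y).hom ≫ (F.obj x).map (LeftInternalHom.ev adj y')

/-- The morphism `F (x, y) ⟶ F (x', y')` corresponding to a morphism `x ⟶ x' ⊙ S y'`. -/
def homOfAct {x x' : M} {y' : N} (f : x ⟶ x' ⊙ᵣ S.obj y') :
    (F.obj x).obj y ⟶ (F.obj x').obj y' :=
  (F.map f).app y ≫ β.evalMap adj x' y'

lemma evalMap_naturality_left {x x' : M} (f : x ⟶ x') (y' : N) :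
    (F.map (f ⊵ᵣ S.obj y')).app y ≫ β.evalMap adj x' y' =
      β.evalMap adj x y' ≫ (F.map f).app y' := by
  rw [evalMap, reassoc_of% β.naturality_left f (S.obj y') y, evalMap, Category.assoc,
    NatTrans.naturality]

lemma evalMap_naturality_right (x : M) {n n' : N} (g : n ⟶ n') :
    (F.map (x ⊴ᵣ S.map g)).app y ≫ β.evalMap adj x n' =
      β.evalMap adj x n ≫ (F.obj x).map g := by
  rw [evalMap, reassoc_of% β.naturality_middle x (S.map g) y, ← Functor.map_comp,
    LeftInternalHom.map_ev, evalMap, Category.assoc, Functor.map_comp]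

end

lemma homOfAct_naturality {K : Nᵒᵖ ⥤ N ⥤ C} (hK : LeftEnrichedHom C N K)
    {x₁ x₂ x₁' x₂' : M} {y₁ y₂ y₁' y₂' : N} (f : x₂ ⟶ x₁) (f' : x₁' ⟶ x₂') (g : y₂ ⟶ y₁)
    (g' : y₁' ⟶ y₂') (v : x₁ ⟶ x₁' ⊙ᵣ (K.obj (op y₁)).obj y₁') :
    β.homOfAct (hK.adj y₂) (f ≫ v ≫ f' ⊵ᵣ _ ≫ x₂' ⊴ᵣ prodMap K g.op g') =
      prodMap F f g ≫ β.homOfAct (hK.adj y₁) v ≫ prodMap F f' g' := by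
  have h1 := actionHomLeft_enrichedHom_ev hK g y₁'
  have h2 := β.naturality_middle x₂' ((K.map g.op).app y₁') y₂
  have h3 := β.evalMap_naturality_left (hK.adj y₁) f' y₁'
  have h4 := β.evalMap_naturality_right (hK.adj y₂) x₂' g'
  have h5 := β.naturality_right x₂' ((K.obj (op y₁)).obj y₁') g
  have h6 : (F.map (x₂' ⊴ᵣ (K.map g.op).app y₁')).app y₂ ≫ β.evalMap (hK.adj y₂) x₂' y₁' =
      (F.obj _).map g ≫ β.evalMap (hK.adj y₁) x₂' y₁' := by
    rw [evalMap, reassoc_of% h2, ← Functor.map_comp, h1, evalMap, reassoc_of% h5,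
      Functor.map_comp]
  simp only [homOfAct, prodMap, Functor.map_comp, NatTrans.comp_app,
    MonoidalRightAction.actionHomRight_comp, Category.assoc]
  rw [h4, reassoc_of% h6, ← reassoc_of% h3]
  simp only [NatTrans.naturality_assoc]

end Balancing

end

end HomFormula

/-! ### The adjunction between `x ↦ x ⊠ y` and the functor induced by `Hom(y, -)` -/

section HomOfAct

universe w' u v x₁ y₁ x₂ y₂ x₃ y₃

open Functor

section

variable {C : Type u} [Category.{v} C] [MonoidalCategory C]
  {N : Type x₂} [Category.{y₂} N] [MonoidalLeftAction C N]

/-- This discharges the hypothesis `hS` below, which asks that the module structure of `S` be the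
one determined by the evaluation. -/
lemma rightAdjointLeftLinear_mu_ev [RightRigidCategory C] {y : N} {S : N ⥤ C}
    (adj : MonoidalLeftAction.actionRight C y ⊣ S) (c : C) (n : N) :
    letI := actionRightLeftLinear (C := C) y
    letI := rightAdjointLeftLinear (C := C) adj
    (tensorMu S c n).hom ⊵ₗ y ≫ LeftInternalHom.ev adj (c ⊙ₗ n) =
      (αₗ c (S.obj n) y).hom ≫ c ⊴ₗ LeftInternalHom.ev adj n :=
  LeftInternalHom.curry_ev adj ((αₗ c (S.obj n) y).hom ≫ c ⊴ₗ LeftInternalHom.ev adj n)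

end

variable {k : Type w'} [Field k] {C : Type u} [Category.{v} C] [Abelian C] [Linear k C]
  [MonoidalCategory C] [MonoidalPreadditive C] [MonoidalLinear k C] [RigidCategory C]
  {M : Type x₁} [Category.{y₁} M] [Abelian M] [Linear k M] [MonoidalRightAction C M]
  [LinearRightAction k C M] {hM : RightActionRightExact C M}
  {N : Type x₂} [Category.{y₂} N] [Abelian N] [Linear k N] [MonoidalLeftAction C N]
  {T : Type x₃} [Category.{y₃} T] [Abelian T] [Linear k T]
  {box : BalancedFunctor k C M N T}
  {y : N} {S : N ⥤ C} [S.LeftLinear C] [S.Additive] [S.Linear k] [PreservesFiniteColimits S]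
  (adj : MonoidalLeftAction.actionRight C y ⊣ S)
  (hS : ∀ (c : C) (n : N), (tensorMu S c n).hom ⊵ₗ y ≫ LeftInternalHom.ev adj (c ⊙ₗ n) =
      (αₗ c (S.obj n) y).hom ≫ c ⊴ₗ LeftInternalHom.ev adj n)
  {W : RightExactLinearFunctor k T M} (i : box.postcomp W ≅ actBalanced k M S hM)

/-- The functor `x ↦ x ⊠ y`. -/
@[reducible]
def BalancedFunctor.leftFunctor (box : BalancedFunctor k C M N T) (y : N) :
    RightExactLinearFunctor k M T :=
  have := box.bilinear.additive_left y
  have := box.bilinear.linear_left y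
  have := box.rightExact.left y
  .mk (box.functor.flip.obj y)

/-- The component of the isomorphism `i` at `(x, n)`. -/
def actIsoApp (x : M) (n : N) : W.obj.obj ((box.functor.obj x).obj n) ≅ x ⊙ᵣ S.obj n :=
  ((BalancedFunctor.isoFunctor i).app x).app n

lemma actIsoApp_naturality_left {x x' : M} (f : x ⟶ x') (n : N) :
    W.obj.map ((box.functor.map f).app n) ≫ (actIsoApp i x' n).hom =
      (actIsoApp i x n).hom ≫ f ⊵ᵣ S.obj n :=
  congrArg (fun t => t.app n) (i.hom.trans.naturality f)

lemma actIsoApp_naturality_right (x : M) {n n' : N} (g : n ⟶ n') :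
    W.obj.map ((box.functor.obj x).map g) ≫ (actIsoApp i x n').hom =
      (actIsoApp i x n).hom ≫ x ⊴ᵣ S.map g :=
  (i.hom.trans.app x).naturality g

lemma actIsoApp_balancing (x : M) (c : C) (n : N) :
    W.obj.map (box.balancing.iso x c n).hom ≫ (actIsoApp i x (c ⊙ₗ n)).hom =
      (actIsoApp i (x ⊙ᵣ c) n).hom ≫ (αᵣ x c (S.obj n)).inv ≫ x ⊴ᵣ (tensorMu S c n).hom :=
  i.hom.compatible x c n

-- Evaluation is balanced, by the pentagon and `hS`; this is what allows it to extend from objects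
-- `x ⊠ n` to all of `T`.
include hS in
lemma evalMap_balancing (x : M) (c : C) (n : N) :
    box.balancing.evalMap adj (x ⊙ᵣ c) n ≫ (box.balancing.iso x c n).hom =
      (box.functor.map ((αᵣ x c (S.obj n)).inv ≫ x ⊴ᵣ (tensorMu S c n).hom)).app y ≫
        box.balancing.evalMap adj x (c ⊙ₗ n) := by
  have h1 := box.balancing.pentagon x c (S.obj n) y
  have h2 := box.balancing.naturality_middle x (tensorMu S c n).hom y
  have h3 := box.balancing.naturality_right x c (LeftInternalHom.ev adj n)
  have h4 : (box.functor.map (αᵣ x c (S.obj n)).inv).app y ≫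
      (box.functor.map (αᵣ x c (S.obj n)).hom).app y = 𝟙 _ := by
    rw [← NatTrans.comp_app, ← Functor.map_comp, Iso.inv_hom_id]
    simp
  simp only [Balancing.evalMap, Functor.map_comp, NatTrans.comp_app, Category.assoc]
  rw [reassoc_of% h2, ← Functor.map_comp, hS, Functor.map_comp, reassoc_of% h1, reassoc_of% h4,
    h3]

include hS in
/-- The counit of the adjunction between `x ↦ x ⊠ y` and `W`. -/
lemma exists_counit [(box.restriction T).IsEquivalence] :
    ∃ ε : W.obj ⋙ box.functor.flip.obj y ⟶ 𝟭 T, ∀ x n,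
      ε.app ((box.functor.obj x).obj n) =
        (box.functor.map (actIsoApp i x n).hom).app y ≫ box.balancing.evalMap adj x n := by
  -- The counit is prescribed on the objects `x ⊠ n` as evaluation, and fullness of restriction
  -- along `box` extends it.
  let φ : box.postcomp (W.comp (box.leftFunctor y)) ⟶ box.postcomp (.mk (𝟭 T)) :=
    { trans :=
        { app x :=
            { app n := (box.functor.map (actIsoApp i x n).hom).app y ≫
                box.balancing.evalMap adj x n
              naturality n n' g := by
                have h1 := congrArg (fun t => (box.functor.map t).app y)
                  (actIsoApp_naturality_right i x g)
                have h2 := box.balancing.evalMap_naturality_right adj x g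
                simp only [Functor.map_comp, NatTrans.comp_app] at h1
                change (box.functor.map (W.obj.map ((box.functor.obj x).map g))).app y ≫ _ ≫ _ =
                  (_ ≫ _) ≫ (box.functor.obj x).map g
                rw [reassoc_of% h1, h2, Category.assoc] }
          naturality x x' f := by
            ext n
            have h1 := congrArg (fun t => (box.functor.map t).app y)
              (actIsoApp_naturality_left i f n)
            have h2 := box.balancing.evalMap_naturality_left adj f n
            simp only [Functor.map_comp, NatTrans.comp_app] at h1
            change (box.functor.map (W.obj.map ((box.functor.map f).app n))).app y ≫ _ ≫ _ =
              (_ ≫ _) ≫ (box.functor.map f).app n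
            rw [reassoc_of% h1, h2, Category.assoc] }
      compatible x c n := by
        have h1 := congrArg (fun t => (box.functor.map t).app y) (actIsoApp_balancing i x c n)
        have h2 := evalMap_balancing adj hS (box := box) x c n
        simp only [Functor.map_comp, NatTrans.comp_app] at h1 h2
        change (box.functor.map (W.obj.map (box.balancing.iso x c n).hom)).app y ≫ _ ≫ _ =
          (_ ≫ _) ≫ (box.balancing.iso x c n).hom
        rw [reassoc_of% h1, Category.assoc, h2]
        simp only [Category.assoc] }
  obtain ⟨ε, hε⟩ := (box.restriction T).map_surjective φ
  exact ⟨ε.hom, fun x n => congrArg (fun t => (t.trans.app x).app n) hε⟩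

/-- The unit of the adjunction between `x ↦ x ⊠ y` and `W`. -/
def actUnit (x : M) : x ⟶ x ⊙ᵣ S.obj y :=
  (ρᵣ[C] x).inv ≫ x ⊴ᵣ LeftInternalHom.curry adj (λₗ[C] y).hom

lemma actUnit_naturality {x x' : M} (f : x ⟶ x') :
    f ≫ actUnit adj x' = actUnit adj x ≫ f ⊵ᵣ S.obj y := by
  have h : f ≫ (ρᵣ[C] x').inv = (ρᵣ[C] x).inv ≫ f ⊵ᵣ 𝟙_ C := by
    rw [Iso.comp_inv_eq]
    simp
  rw [actUnit, reassoc_of% h, actUnit, Category.assoc, MonoidalRightAction.action_exchange]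

/-- One triangle identity of the adjunction, coming from the triangle axiom of the balancing. -/
lemma homOfAct_actUnit (x : M) : box.balancing.homOfAct adj (actUnit adj x) = 𝟙 _ := by
  have h1 := box.balancing.naturality_middle x (LeftInternalHom.curry adj (λₗ[C] y).hom) y
  have h2 := box.balancing.triangle x y
  have h3 : (box.functor.map (ρᵣ[C] x).inv).app y ≫ (box.functor.map (ρᵣ[C] x).hom).app y =
      𝟙 _ := by
    rw [← NatTrans.comp_app, ← Functor.map_comp, Iso.inv_hom_id]
    simp
  simp only [Balancing.homOfAct, Balancing.evalMap, actUnit, Functor.map_comp, NatTrans.comp_app,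
    Category.assoc]
  rw [reassoc_of% h1, ← Functor.map_comp, LeftInternalHom.curry_ev, h2, h3]

-- The other triangle identity, at objects `x ⊠ n` only, which is all that is needed. The balancing
-- moves `S n` out of the way and leaves the triangle identity for `S` itself (`h3`).
include hS in
lemma actUnit_evalMap (x : M) (n : N) :
    actUnit adj (x ⊙ᵣ S.obj n) ≫ (actIsoApp i (x ⊙ᵣ S.obj n) y).inv ≫
      W.obj.map (box.balancing.evalMap adj x n) ≫ (actIsoApp i x n).hom = 𝟙 _ := by
  have h1 := actIsoApp_balancing i x (S.obj n) y
  have h2 := actIsoApp_naturality_right i x (LeftInternalHom.ev adj n)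
  have h3 : (ρ_ (S.obj n)).inv ≫ S.obj n ◁ LeftInternalHom.curry adj (λₗ[C] y).hom ≫
      (tensorMu S (S.obj n) y).hom ≫ S.map (LeftInternalHom.ev adj n) = 𝟙 _ := by
    refine LeftInternalHom.hom_ext adj ?_
    simp only [MonoidalLeftAction.comp_actionHomLeft, Category.assoc, LeftInternalHom.map_ev]
    rw [reassoc_of% hS]
    have h4 : (S.obj n ◁ LeftInternalHom.curry adj (λₗ[C] y).hom) ⊵ₗ y ≫
        (αₗ (S.obj n) (S.obj y) y).hom = (αₗ (S.obj n) (𝟙_ C) y).hom ≫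
          S.obj n ⊴ₗ LeftInternalHom.curry adj (λₗ[C] y).hom ⊵ₗ y := by simp
    rw [reassoc_of% h4, ← MonoidalLeftAction.actionHomRight_comp_assoc, LeftInternalHom.curry_ev]
    have h5 : (ρ_ (S.obj n)).inv ⊵ₗ y ≫ (αₗ (S.obj n) (𝟙_ C) y).hom ≫ S.obj n ⊴ₗ (λₗ[C] y).hom =
        𝟙 _ := by
      rw [← MonoidalLeftAction.rightUnitor_actionHom, ← MonoidalLeftAction.comp_actionHomLeft,
        Iso.inv_hom_id, MonoidalLeftAction.id_actionHomLeft]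
    rw [reassoc_of% h5, MonoidalLeftAction.id_actionHomLeft, Category.id_comp]
  simp only [Balancing.evalMap, Functor.map_comp, Category.assoc]
  rw [h2, reassoc_of% h1, Iso.inv_hom_id_assoc, actUnit]
  have h5 : (x ⊙ᵣ S.obj n) ⊴ᵣ LeftInternalHom.curry adj (λₗ[C] y).hom ≫
      (αᵣ x (S.obj n) (S.obj y)).inv = (αᵣ x (S.obj n) (𝟙_ C)).inv ≫
        x ⊴ᵣ (S.obj n ◁ LeftInternalHom.curry adj (λₗ[C] y).hom) := by simp
  have h6 : (ρᵣ[C] (x ⊙ᵣ S.obj n)).inv ≫ (αᵣ x (S.obj n) (𝟙_ C)).inv =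
      x ⊴ᵣ (ρ_ (S.obj n)).inv := by
    simp [actionHom_rightUnitor_inv]
  rw [Category.assoc, reassoc_of% h5, reassoc_of% h6]
  simp only [← MonoidalRightAction.actionHomRight_comp]
  rw [h3, MonoidalRightAction.actionHomRight_id]

include hS i in
/-- Evaluation identifies morphisms `x ⟶ x' ⊙ S n` with morphisms `x ⊠ y ⟶ x' ⊠ n`. -/
theorem homOfAct_bijective [(box.restriction T).IsEquivalence] (x x' : M) (n : N) :
    Function.Bijective (box.balancing.homOfAct adj (x := x) (x' := x') (y' := n)) := by
  obtain ⟨ε, hε⟩ := exists_counit adj hS i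
  -- The inverse is transposition: apply `W` and precompose with the unit.
  let g (t : (box.functor.obj x).obj y ⟶ (box.functor.obj x').obj n) : x ⟶ x' ⊙ᵣ S.obj n :=
    actUnit adj x ≫ (actIsoApp i x y).inv ≫ W.obj.map t ≫ (actIsoApp i x' n).hom
  refine Function.bijective_iff_has_inverse.2 ⟨g, fun f => ?_, fun t => ?_⟩
  · have h1 := actIsoApp_naturality_left i f y
    have h2 : (actIsoApp i x y).inv ≫ W.obj.map ((box.functor.map f).app y) =
        f ⊵ᵣ S.obj y ≫ (actIsoApp i (x' ⊙ᵣ S.obj n) y).inv := by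
      rw [Iso.inv_comp_eq, ← reassoc_of% h1, Iso.hom_inv_id, Category.comp_id]
    simp only [g, Balancing.homOfAct, Functor.map_comp, Category.assoc]
    rw [reassoc_of% h2, ← reassoc_of% actUnit_naturality adj f, actUnit_evalMap adj hS i,
      Category.comp_id]
  · have h1 : (box.functor.map (W.obj.map t)).app y ≫ ε.app ((box.functor.obj x').obj n) =
        ε.app ((box.functor.obj x).obj y) ≫ t := ε.naturality t
    rw [hε, hε] at h1
    have h2 : (box.functor.map (actIsoApp i x y).inv).app y ≫
        (box.functor.map (actIsoApp i x y).hom).app y = 𝟙 _ := by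
      rw [← NatTrans.comp_app, ← Functor.map_comp, Iso.inv_hom_id]
      simp
    have h3 := homOfAct_actUnit (box := box) adj x
    simp only [Balancing.homOfAct] at h3
    simp only [g, Balancing.homOfAct, Functor.map_comp, NatTrans.comp_app, Category.assoc]
    rw [h1, Category.assoc, reassoc_of% h2, reassoc_of% h3]

end HomOfAct

/-! ### The hom formula, by projective presentations in the second variable -/

section HomFormula

universe w' u v x₁ y₁ x₂ y₂ x₃ y₃ s s'

open Functor

lemma exists_projective_presentation {X : Type u} [Category.{v} X] [Abelian X]
    [EnoughProjectives X] (x : X) :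
    ∃ (Q Q' : X) (d : Q' ⟶ Q) (p : Q ⟶ x), Projective Q ∧ Projective Q' ∧ IsCoker d p :=
  ⟨_, _, Projective.π (kernel (Projective.π x)) ≫ kernel.ι (Projective.π x), Projective.π x,
    inferInstance, inferInstance,
    { w := by simp
      epi := inferInstance
      exists_desc t ht := by
        have ht' : kernel.ι (Projective.π x) ≫ t = 0 := by
          rw [← cancel_epi (Projective.π (kernel (Projective.π x))), comp_zero, ← ht,
            Category.assoc]
        exact ⟨Abelian.epiDesc (Projective.π x) t ht', Abelian.comp_epiDesc _ _ _⟩ }⟩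

variable {k : Type w'} [Field k] {C : Type u} [Category.{v} C] [Abelian C] [Linear k C]
  [MonoidalCategory C] [MonoidalPreadditive C] [MonoidalLinear k C] [RigidCategory C]
  {M : Type x₁} [Category.{y₁} M] [Abelian M] [Linear k M] [MonoidalRightAction C M]
  [hlin : LinearRightAction k C M] {hM : RightActionRightExact C M}
  {N : Type x₂} [Category.{y₂} N] [Abelian N] [Linear k N] [MonoidalLeftAction C N]
  [hlin' : LinearLeftAction k C N]
  {T : Type x₃} [Category.{y₃} T] [Abelian T] [Linear k T]
  (box : BalancedFunctor k C M N T)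
  {H : Mᵒᵖ ⥤ M ⥤ C} (hH : RightEnrichedHom C M H)
  {K : Nᵒᵖ ⥤ N ⥤ C} (hK : LeftEnrichedHom C N K)

include hlin' hK in
/-- The enriched hom of `N` turns cokernels into kernels. -/
lemma existsUnique_enrichedHom_lift {Q Q' y : N} {d : Q' ⟶ Q} {p : Q ⟶ y} (hp : IsCoker d p)
    (y' : N) {c : C} (s : c ⟶ (K.obj (op Q)).obj y') (hs : s ≫ (K.map d.op).app y' = 0) :
    ∃! t : c ⟶ (K.obj (op y)).obj y', t ≫ (K.map p.op).app y' = s := by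
  have := hlin'.additive_right c
  -- By adjunction, lifting `s` means descending its transpose along `c ⊙ p`, and acting by `c`
  -- preserves the cokernel.
  have hc := hp.map (MonoidalLeftAction.actionLeft N c)
  have key {z z' : N} (f : z ⟶ z') (t : c ⟶ (K.obj (op z')).obj y') :
      (t ≫ (K.map f.op).app y') ⊵ₗ z ≫ LeftInternalHom.ev (hK.adj z) y' =
        c ⊴ₗ f ≫ t ⊵ₗ z' ≫ LeftInternalHom.ev (hK.adj z') y' := by
    rw [MonoidalLeftAction.comp_actionHomLeft, Category.assoc, actionHomLeft_enrichedHom_ev,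
      MonoidalLeftAction.action_exchange_assoc]
  have h0 : c ⊴ₗ d ≫ s ⊵ₗ Q ≫ LeftInternalHom.ev (hK.adj Q) y' = 0 := by
    have := hlin'.additive_left Q'
    rw [← key, hs]
    exact (congrArg (· ≫ _) ((MonoidalLeftAction.actionRight C Q').map_zero _ _)).trans zero_comp
  obtain ⟨u, hu⟩ : ∃ u : c ⊙ₗ y ⟶ y',
      c ⊴ₗ p ≫ u = s ⊵ₗ Q ≫ LeftInternalHom.ev (hK.adj Q) y' := hc.exists_desc _ h0
  refine ⟨LeftInternalHom.curry (hK.adj y) u, LeftInternalHom.hom_ext (hK.adj Q) ?_, fun t ht => ?_⟩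
  · rw [key, LeftInternalHom.curry_ev, hu]
  · have := hc.epi
    refine LeftInternalHom.hom_ext (hK.adj y) ?_
    have h1 : c ⊴ₗ p ≫ t ⊵ₗ y ≫ LeftInternalHom.ev (hK.adj y) y' = c ⊴ₗ p ≫ u := by
      rw [← key, ht, hu]
    rw [LeftInternalHom.curry_ev]
    exact (cancel_epi ((MonoidalLeftAction.actionLeft N c).map p)).1 h1

-- Tensoring with `b` is left exact, so it preserves the kernel found in
-- `existsUnique_enrichedHom_lift`.
include hlin' hK in
lemma existsUnique_tensor_enrichedHom_lift {Q Q' y : N} {d : Q' ⟶ Q} {p : Q ⟶ y}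
    (hp : IsCoker d p) (y' : N) (b : C) {c : C} (s : c ⟶ b ⊗ (K.obj (op Q)).obj y') (hs : s ≫ b ◁ (K.map d.op).app y' = 0) :
    ∃! t : c ⟶ b ⊗ (K.obj (op y)).obj y', t ≫ b ◁ (K.map p.op).app y' = s := by
  have hw : (K.map p.op).app y' ≫ (K.map d.op).app y' = 0 := by
    have h := hp.w
    refine LeftInternalHom.hom_ext (hK.adj Q') ?_
    have := hlin'.additive_left Q'
    have := hlin'.additive_right ((K.obj (op y)).obj y')
    rw [← NatTrans.comp_app, ← Functor.map_comp, ← op_comp, h, actionHomLeft_enrichedHom_ev]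
    exact ((congrArg (· ≫ _) ((MonoidalLeftAction.actionLeft N _).map_zero _ _)).trans
      zero_comp).trans
      ((congrArg (· ≫ _) ((MonoidalLeftAction.actionRight C Q').map_zero _ _)).trans zero_comp).symm
  have hl : IsLimit (KernelFork.ofι ((K.map p.op).app y') hw) :=
    KernelFork.IsLimit.ofι _ _
      (fun s hs => (existsUnique_enrichedHom_lift (k := k) hK hp y' s hs).exists.choose)
      (fun s hs => (existsUnique_enrichedHom_lift (k := k) hK hp y' s hs).exists.choose_spec)
      (fun s hs m hm => (existsUnique_enrichedHom_lift (k := k) hK hp y' s hs).unique hm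
        (existsUnique_enrichedHom_lift (k := k) hK hp y' s hs).exists.choose_spec)
  have : PreservesFiniteLimits (tensorLeft b) :=
    inferInstanceAs (PreservesFiniteLimits (MonoidalLeftAction.actionLeft C b))
  have hl' := KernelFork.mapIsLimit _ hl (tensorLeft b)
  refine ⟨(KernelFork.IsLimit.lift' hl' s hs).1, (KernelFork.IsLimit.lift' hl' s hs).2,
    fun t ht => Fork.IsLimit.hom_ext hl' (ht.trans (KernelFork.IsLimit.lift' hl' s hs).2.symm)⟩

/-- The linear map from morphisms `𝟙 ⟶ H (x, x') ⊗ K (y, y')` to morphisms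
`x ⊠ y ⟶ x' ⊠ y'`. -/
def homOfTensor (x x' : M) (y y' : N) :
    (𝟙_ C ⟶ (H.obj (op x)).obj x' ⊗ (K.obj (op y)).obj y') →ₗ[k]
      ((box.functor.obj x).obj y ⟶ (box.functor.obj x').obj y') where
  toFun u := box.balancing.homOfAct (hK.adj y) (InternalHom.tensorUncurry (hH.adj x) u)
  map_add' u u' := by
    have := hlin.additive_right x
    have := box.bilinear.additive_left y
    have h1 : x ⊴ᵣ (u + u') = x ⊴ᵣ u + x ⊴ᵣ u' :=
      (MonoidalRightAction.actionLeft C x).map_add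
    have h2 {z z' : M} (f g : z ⟶ z') : (box.functor.map (f + g)).app y =
        (box.functor.map f).app y + (box.functor.map g).app y :=
      (box.functor.flip.obj y).map_add
    simp only [Balancing.homOfAct, InternalHom.tensorUncurry, h1, Preadditive.add_comp,
      Preadditive.comp_add, h2]
  map_smul' r u := by
    have := hlin.linear_right x
    have := hlin.additive_right x
    have := box.bilinear.additive_left y
    have := box.bilinear.linear_left y
    have h1 : x ⊴ᵣ (r • u) = r • x ⊴ᵣ u :=
      (MonoidalRightAction.actionLeft C x).map_smul r u
    have h2 {z z' : M} (f : z ⟶ z') : (box.functor.map (r • f)).app y =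
        r • (box.functor.map f).app y :=
      (box.functor.flip.obj y).map_smul r f
    simp only [Balancing.homOfAct, InternalHom.tensorUncurry, h1, Linear.smul_comp,
      Linear.comp_smul, h2, RingHom.id_apply]

lemma homOfTensor_naturality {x₁ x₂ x₁' x₂' : M} {y₁ y₂ y₁' y₂' : N} (f : x₂ ⟶ x₁)
    (f' : x₁' ⟶ x₂') (g : y₂ ⟶ y₁) (g' : y₁' ⟶ y₂')
    (u : 𝟙_ C ⟶ (H.obj (op x₁)).obj x₁' ⊗ (K.obj (op y₁)).obj y₁') :
    homOfTensor box hH hK x₂ x₂' y₂ y₂' (u ≫ (prodMap H f.op f' ⊗ₘ prodMap K g.op g')) =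
      prodMap box.functor f g ≫ homOfTensor box hH hK x₁ x₁' y₁ y₁' u ≫
        prodMap box.functor f' g' :=
  (congrArg (box.balancing.homOfAct (hK.adj y₂))
    (tensorUncurry_naturality hH f f' (prodMap K g.op g') u)).trans
    (box.balancing.homOfAct_naturality hK f f' g g' _)

lemma homOfTensor_comp_whiskerLeft {x x' : M} {y₁ y₂ y' : N} (g : y₂ ⟶ y₁)
    (u : 𝟙_ C ⟶ (H.obj (op x)).obj x' ⊗ (K.obj (op y₁)).obj y') :
    homOfTensor box hH hK x x' y₂ y' (u ≫ (H.obj (op x)).obj x' ◁ (K.map g.op).app y') =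
      (box.functor.obj x).map g ≫ homOfTensor box hH hK x x' y₁ y' u := by
  simpa [prodMap] using homOfTensor_naturality box hH hK (𝟙 x) (𝟙 x') g (𝟙 y') u

/-- A five lemma argument. Both sides turn `Q' ⟶ Q ⟶ y` into a kernel: the morphisms of `T` by right
exactness of `x ⊠ -`, the tensors by the preceding lemma. Injectivity at `Q'` is what makes
surjectivity at `Q` descend to `y`. -/
lemma homOfTensor_bijective_of_isCoker (x x' : M) {Q Q' y : N} {d : Q' ⟶ Q} {p : Q ⟶ y}
    (hp : IsCoker d p) (y' : N) (h : Function.Bijective (homOfTensor box hH hK x x' Q y'))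
    (h' : Function.Injective (homOfTensor box hH hK x x' Q' y')) :
    Function.Bijective (homOfTensor box hH hK x x' y y') := by
  have := box.bilinear.additive_right x
  have := box.rightExact.right x
  have hF := hp.map (box.functor.obj x)
  have := hF.epi
  constructor
  · rw [injective_iff_map_eq_zero]
    intro u hu
    have h1 : u ≫ (H.obj (op x)).obj x' ◁ (K.map p.op).app y' = 0 := h.1 (by
      rw [homOfTensor_comp_whiskerLeft, hu, comp_zero, map_zero])
    exact (existsUnique_tensor_enrichedHom_lift (k := k) hK hp y' _ (0 : 𝟙_ C ⟶ _)
      zero_comp).unique h1 zero_comp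
  · intro t
    obtain ⟨u, hu⟩ := h.2 ((box.functor.obj x).map p ≫ t)
    have h1 : u ≫ (H.obj (op x)).obj x' ◁ (K.map d.op).app y' = 0 := h' (by
      rw [homOfTensor_comp_whiskerLeft, hu, reassoc_of% hF.w, zero_comp, map_zero])
    obtain ⟨s, hs⟩ := (existsUnique_tensor_enrichedHom_lift (k := k) hK hp y' _ u h1).exists
    refine ⟨s, ?_⟩
    rw [← cancel_epi ((box.functor.obj x).map p), ← homOfTensor_comp_whiskerLeft, hs, hu]

-- Projectivity of `y` makes `Hom(y, -)` right exact, so `(x, n) ↦ x ⊙ Hom(y, n)` is a balanced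
-- functor and induces the functor `W` needed for `homOfAct_bijective`.
include hM in
lemma homOfTensor_bijective_of_projective [(box.restriction T).IsEquivalence]
    [(box.restriction M).IsEquivalence] (x x' : M) {y : N} (hy : Projective y) (y' : N) :
    Function.Bijective (homOfTensor box hH hK x x' y y') := by
  let adj : MonoidalLeftAction.actionRight C y ⊣ K.obj (op y) := hK.adj y
  have := hlin'.additive_left y
  have := hlin'.linear_left y
  have : (K.obj (op y)).Additive := adj.right_adjoint_additive
  have : (K.obj (op y)).Linear k := linear_of_adjunction adj
  have := LeftInternalHom.preservesFiniteColimits_of_projective adj hy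
  let _ := actionRightLeftLinear (C := C) y
  let _ := rightAdjointLeftLinear (C := C) adj
  let S := K.obj (op y)
  let W := (box.restriction M).objPreimage (actBalanced k M S hM)
  let i : box.postcomp W ≅ actBalanced k M S hM := (box.restriction M).objObjPreimageIso _
  exact (homOfAct_bijective adj (rightAdjointLeftLinear_mu_ev adj) i x x' y').comp
    (InternalHom.tensorUncurry_bijective (hH.adj x) x' _)

include hM hH hK in
/-- The formula for morphisms between objects of the form `x ⊠ y`. -/
theorem homFormula [EnoughProjectives N] [(box.restriction T).IsEquivalence]
    [(box.restriction M).IsEquivalence] : HomFormula k box.functor H K := by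
  have hbij (x x' : M) (y y' : N) : Function.Bijective (homOfTensor box hH hK x x' y y') := by
    obtain ⟨Q, Q', d, p, hQ, hQ', hp⟩ := exists_projective_presentation y
    exact homOfTensor_bijective_of_isCoker box hH hK x x' hp y'
      (homOfTensor_bijective_of_projective (hM := hM) box hH hK x x' hQ y')
      (homOfTensor_bijective_of_projective (hM := hM) box hH hK x x' hQ' y').1
  refine ⟨fun x x' y y' => (LinearEquiv.ofBijective _ (hbij x x' y y')).symm, ?_⟩
  intro x₁ x₂ x₁' x₂' y₁ y₂ y₁' y₂' f f' g g' h
  obtain ⟨u, rfl⟩ := (hbij x₁ x₁' y₁ y₁').2 h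
  rw [← homOfTensor_naturality]
  exact (LinearEquiv.ofBijective_symm_apply_apply _ _).trans
    (congrArg (· ≫ _) (LinearEquiv.ofBijective_symm_apply_apply _ _).symm)

end HomFormula

/-! ### Exactness of induced functors -/

section InducedFunctor

universe w' u v x₁ y₁ x₂ y₂ x₃ y₃ x₄ y₄ s s'

open Functor

variable {k : Type w'} [Field k] {C : Type u} [Category.{v} C] [Abelian C] [Linear k C]
  [MonoidalCategory C] [MonoidalPreadditive C] [MonoidalLinear k C] [RigidCategory C]
  [FiniteLinear k C]
  {M : Type x₁} [Category.{y₁} M] [Abelian M] [Linear k M] [MonoidalRightAction C M]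
  [LinearRightAction k C M] [FiniteLinear k M] (hM : RightActionRightExact C M)
  {N : Type x₂} [Category.{y₂} N] [Abelian N] [Linear k N] [MonoidalLeftAction C N]
  [LinearLeftAction k C N] [FiniteLinear k N] (hN : LeftActionRightExact C N)

include hM hN in
lemma isEquivalence_restriction {T : Type (max s v)} [Category.{max s' v} T] [Abelian T]
    [Linear k T] {box : BalancedFunctor k C M N T} (hbox : IsBalancedTensorProduct box)
    (D : Type x₃) [Category.{y₃} D] [Abelian D] [Linear k D] :
    (box.restriction D).IsEquivalence := by
  obtain ⟨A, P, _, _, _, _⟩ := exists_mod_equivalence k C M hM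
  exact isEquivalence_restriction_of_isBalancedTensorProduct hN P hbox D

variable {M' : Type x₃} [Category.{y₃} M'] [Abelian M'] [Linear k M'] [MonoidalRightAction C M']
  [LinearRightAction k C M'] [FiniteLinear k M'] (hM' : RightActionRightExact C M')
  {N' : Type x₄} [Category.{y₄} N'] [Abelian N'] [Linear k N'] [MonoidalLeftAction C N']
  [hlin : LinearLeftAction k C N'] [FiniteLinear k N'] (hN' : LeftActionRightExact C N')
  {T : Type (max s v)} [Category.{max s' v} T] [Abelian T] [Linear k T]
  {box : BalancedFunctor k C M N T} (hbox : IsBalancedTensorProduct box)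
  {T' : Type (max s v)} [Category.{max s' v} T'] [Abelian T'] [Linear k T']
  {box' : BalancedFunctor k C M' N' T'} (hbox' : IsBalancedTensorProduct box')
  (F₀ : M ⥤ M') [F₀.Additive] [F₀.Linear k] [F₀.RightLinear C]
  [PreservesFiniteLimits F₀] [PreservesFiniteColimits F₀]
  (F₁ : N ⥤ N') [F₁.Additive] [F₁.Linear k] [F₁.LeftLinear C]
  [PreservesFiniteLimits F₁] [PreservesFiniteColimits F₁]

include hM hN hM' hN' hbox hbox' in
/-- Functors of balanced tensor products induced by exact module functors are exact. -/
theorem preservesFiniteLimits_of_precomp (G : RightExactLinearFunctor k T T')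
    (g : box.postcomp G ≅ box'.precomp F₀ F₁) : PreservesFiniteLimits G.obj := by
  -- `S = Hom(n, -)` will detect exactness: it is exact because `n` is projective and faithful
  -- because `n` generates.
  obtain ⟨n, hn⟩ := exists_isProgenerator k N'
  have := isLeftAdjoint_actionRight k hN' n
  let adj := Adjunction.ofIsLeftAdjoint (MonoidalLeftAction.actionRight C n)
  let S := (MonoidalLeftAction.actionRight C n).rightAdjoint
  have := hlin.additive_left n
  have := hlin.linear_left n
  have : S.Additive := adj.right_adjoint_additive
  have : S.Linear k := linear_of_adjunction adj
  have : PreservesFiniteColimits S :=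
    LeftInternalHom.preservesFiniteColimits_of_projective adj hn.projective
  have := adj.rightAdjoint_preservesLimits.{0, 0}
  have : PreservesFiniteLimits S := PreservesLimitsOfSize.preservesFiniteLimits _
  have : S.Faithful := LeftInternalHom.faithful_of_isProgenerator adj hn
  let _ := actionRightLeftLinear (C := C) n
  let _ : S.LeftLinear C := rightAdjointLeftLinear (C := C) adj
  let _ := compLeftLinear (C := C) F₁ S
  have : PreservesFiniteColimits (F₁ ⋙ S) := comp_preservesFiniteColimits _ _
  have : PreservesFiniteLimits (F₁ ⋙ S) := comp_preservesFiniteLimits _ _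
  have := isEquivalence_restriction hM hN hbox M
  have := isEquivalence_restriction hM hN hbox C
  have := isEquivalence_restriction hM hN hbox M'
  have := isEquivalence_restriction hM' hN' hbox' M'
  have := isEquivalence_restriction hM' hN' hbox' C
  -- Exactness of `F₁` makes `F₁ ⋙ S` exact, so `W` is left exact; `W'` is left exact and faithful
  -- because `S` is.
  let W := (box.restriction M).objPreimage (actBalanced k M (F₁ ⋙ S) hM)
  let i : box.postcomp W ≅ actBalanced k M (F₁ ⋙ S) hM := (box.restriction M).objObjPreimageIso _
  let W' := (box'.restriction M').objPreimage (actBalanced k M' S hM')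
  let i' : box'.postcomp W' ≅ actBalanced k M' S hM' := (box'.restriction M').objObjPreimageIso _
  obtain ⟨A, P, _, _, _, _⟩ := exists_mod_equivalence k C M hM
  obtain ⟨A', P', _, _, _, _⟩ := exists_mod_equivalence k C M' hM'
  obtain ⟨E, _, ⟨e⟩⟩ := exists_equivalence_modIn hN P hbox
  obtain ⟨E', _, ⟨e'⟩⟩ := exists_equivalence_modIn hN' P' hbox'
  have := preservesFiniteLimits_induced e i
  have := preservesFiniteLimits_induced e' i'
  have := faithful_induced e' i'
  exact preservesFiniteLimits_of_induced F₀ F₁ S g i' i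

end InducedFunctor

end BalancedTensor

/-! ### The theorem -/

theorem theorem3p3 (k : Type w) [Field k]
    (C : Type u₁) [Category.{v₁} C] [Abelian C] [Linear k C] [MonoidalCategory C]
    [MonoidalPreadditive C] [MonoidalLinear k C] [RigidCategory C] [FiniteLinear k C]
    (M : Type u₂) [Category.{v₂} M] [Abelian M] [Linear k M] [MonoidalRightAction C M]
    [LinearRightAction k C M] [FiniteLinear k M] (hM : RightActionRightExact C M)
    (N : Type u₃) [Category.{v₃} N] [Abelian N] [Linear k N] [MonoidalLeftAction C N]
    [LinearLeftAction k C N] [FiniteLinear k N] (hN : LeftActionRightExact C N) :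
    -- the balanced tensor product exists
    (∃ (T : Type (max t u₁ v₁)) (_ : Category.{max t' v₁} T) (_ : Abelian T) (_ : Linear k T)
      (box : BalancedFunctor k C M N T), IsBalancedTensorProduct box) ∧
    -- enriched homs of `M` and `N` exist
    (∃ H : Mᵒᵖ ⥤ M ⥤ C, Nonempty (RightEnrichedHom C M H)) ∧
    (∃ K : Nᵒᵖ ⥤ N ⥤ C, Nonempty (LeftEnrichedHom C N K)) ∧
    -- properties of every balanced tensor product `T` of `M` and `N`
    ∀ (T : Type (max t u₁ v₁)) [Category.{max t' v₁} T] [Abelian T] [Linear k T]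
      (box : BalancedFunctor k C M N T), IsBalancedTensorProduct box →
      -- `T` is a finite linear category
      FiniteLinear k T ∧
      -- if `M` is the category of left `A`-modules and `N` is the category of right `B`-modules
      -- in `C`, then `T` is the category of `A`-`B`-bimodules in `C`
      (∀ (A B : Mon C)
        (EM : M ⥤ Mod C A.X) [EM.IsEquivalence] [EM.Additive] [EM.Linear k] [EM.RightLinear C]
        (EN : N ⥤ RightMod B) [EN.IsEquivalence] [EN.Additive] [EN.Linear k] [EN.LeftLinear C],
        ∃ E : T ⥤ Bimod A B, E.IsEquivalence ∧ E.Additive ∧ E.Linear k ∧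
          ∃ θ : box.functor ⋙ (Functor.whiskeringRight N T (Bimod A B)).obj E ≅
              EM ⋙ tensorBimod A B ⋙ (Functor.whiskeringLeft N (RightMod B) (Bimod A B)).obj EN,
            (box.balancing.postcomp E).Compatible
              ((tensorBimodBalancing A B).precomp EM EN) θ.hom) ∧
      -- the functor `M × N → T` is exact in each variable
      (IsLeftExact₂ box.functor ∧ IsRightExact₂ box.functor) ∧
      -- the morphism spaces between objects `x ⊠ y`
      (∀ (H : Mᵒᵖ ⥤ M ⥤ C) (K : Nᵒᵖ ⥤ N ⥤ C),
        RightEnrichedHom C M H → LeftEnrichedHom C N K → HomFormula k box.functor H K) ∧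
      -- exact module functors induce exact functors of balanced tensor products
      (∀ (M' : Type u₄) [Category.{v₄} M'] [Abelian M'] [Linear k M'] [MonoidalRightAction C M']
        [LinearRightAction k C M'] [FiniteLinear k M'] (_ : RightActionRightExact C M')
        (N' : Type u₅) [Category.{v₅} N'] [Abelian N'] [Linear k N'] [MonoidalLeftAction C N']
        [LinearLeftAction k C N'] [FiniteLinear k N'] (_ : LeftActionRightExact C N')
        (T' : Type (max t u₁ v₁)) [Category.{max t' v₁} T'] [Abelian T'] [Linear k T']
        (box' : BalancedFunctor k C M' N' T') (_ : IsBalancedTensorProduct box')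
        (F₀ : M ⥤ M') [F₀.Additive] [F₀.Linear k] [F₀.RightLinear C]
        [PreservesFiniteLimits F₀] [PreservesFiniteColimits F₀]
        (F₁ : N ⥤ N') [F₁.Additive] [F₁.Linear k] [F₁.LeftLinear C]
        [PreservesFiniteLimits F₁] [PreservesFiniteColimits F₁],
        (∃ G : RightExactLinearFunctor k T T',
          Nonempty ((box.restriction T').obj G ≅ box'.precomp F₀ F₁)) ∧
        ∀ G : RightExactLinearFunctor k T T',
          Nonempty ((box.restriction T').obj G ≅ box'.precomp F₀ F₁) →
            PreservesFiniteLimits G.obj ∧ PreservesFiniteColimits G.obj) := by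
  have := FiniteLinear.enough_projectives (k := k) (X := C)
  have := FiniteLinear.enough_projectives (k := k) (X := N)
  -- Only `M` is replaced by modules over an algebra; `N` enters through its action alone.
  obtain ⟨A, P, _, _, _, _⟩ := exists_mod_equivalence k C M hM
  refine ⟨exists_isBalancedTensorProduct_of_equivalence.{w, _, _, _, _, _, _, max t u₁, t'} hN P,
    exists_parametrizedAdjunction _ (isLeftAdjoint_actionLeft k hM),
    exists_parametrizedAdjunction _ (isLeftAdjoint_actionRight k hN), ?_⟩
  intro T _ _ _ box hbox
  have := hbox T
  -- `M` need not lie in the universes of `T`, so the extended universal property is required for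
  -- the hom formula.
  have := isEquivalence_restriction.{w, _, _, _, _, _, _, _, _, max t u₁, t'} hM hN hbox M
  obtain ⟨E, _, ⟨e⟩⟩ :=
    exists_equivalence_modIn.{w, _, _, _, _, _, _, max t u₁, t'} hN P hbox
  refine ⟨finiteLinear_of_equivalence E, ?_,
    ⟨isLeftExact₂_of_equivalence hN P box E e, box.rightExact⟩, ?_, ?_⟩
  · intro A B EM _ _ _ _ EN _ _ _ _
    exact exists_equivalence_bimod.{w, _, _, _, _, _, _, max t u₁, t'} hN EM EN hbox
  · intro H K hH hK
    exact homFormula (hM := hM) box hH hK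
  · intro M' _ _ _ _ _ _ hM' N' _ _ _ _ _ _ hN' T' _ _ _ box' hbox' F₀ _ _ _ _ _ F₁ _ _ _ _ _
    have := hbox T'
    -- Existence is the universal property of `T`. Right exactness is part of the data of `G`, so
    -- only left exactness has to be proved.
    exact ⟨⟨(box.restriction T').objPreimage _, ⟨(box.restriction T').objObjPreimageIso _⟩⟩,
      fun G ⟨g⟩ => ⟨preservesFiniteLimits_of_precomp.{w, _, _, _, _, _, _, _, _, _, _, max t u₁, t'}
        hM hN hM' hN' hbox hbox' F₀ F₁ G g, inferInstance⟩⟩
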